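/- **Schrödinger problems.** Let $0<b\le\infty$, let $V$ be real-valued and locally integrable on $[0,b)$, and let $\alpha\in[0,\pi)$. Consider $-y''+Vy=zy$ on $(0,b)$ with the condition $y(0)\cos\alpha-y'(0)\sin\alpha=0$ at $0$ and the following condition at $b$. If not all solutions are in $L^2(0,b)$ (limit point case), there is no further condition, and $\tilde y(\cdot,z)$ denotes a nontrivial solution in $L^2(0,b)$. If $b<\infty$ and $V\in L^1(0,b)$ (regular endpoint), fix $\beta\in[0,\pi)$; $\tilde y$ is a nontrivial solution with $\tilde y(b)\cos\beta+\tilde y'(b)\sin\beta=0$. In the remaining case (all solutions are in $L^2(0,b)$ for all $z$, $b$ not regular), fix $z_0\in\mathbb C^+$ and a solution $f=u_\alpha+m_0v_\alpha$ at $z_0$ on the limit circle, i.e. $\lim_{x\uparrow b}W_x(\bar f,f)=0$; $\tilde y$ is a nontrivial solution with $\lim_{x\uparrow b}W_x(\bar f,\tilde y)=0$. Here $W(f,g)=fg'-f'g$, and $u_\alpha,v_\alpha$ are the solutions with $u_\alpha(0)=v_\alpha'(0)=\cos\alpha$, $-u_\alpha'(0)=v_\alpha(0)=\sin\alpha$.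 The $m$ function is, for $z\in\mathbb C^+$, $$m^S(z)=\frac{\tilde y'(0,z)\cos\alpha+\tilde y(0,z)\sin\alpha}{-\tilde y'(0,z)\sin\alpha+\tilde y(0,z)\cos\alpha}.$$ **Canonical systems.** For $J=\begin{pmatrix}0&-1\\1&0\end{pmatrix}$ and a trace-normed (positive semidefinite, locally integrable, $\operatorname{Tr}H=1$ a.e.) real matrix function $H$, the canonical system $Ju'=zHu$ on $(0,\infty)$ has the $m$ function $m_H(z)=\tilde u_2(0)/\tilde u_1(0)$, where $\tilde u$ is a nontrivial solution with $\int_0^\infty\tilde u^*H\tilde u<\infty$. Put $$P_\varphi=\begin{pmatrix}\cos^2\varphi&\cos\varphi\sin\varphi\\ \cos\varphi\sin\varphi&\sin^2\varphi\end{pmatrix}.$$ **Proposition.** (a) For every Schrödinger problem let $u_0,v_0$ be the solutions $u_\alpha,v_\alpha$ for $z=0$, and put $t(x)=\int_0^x(u_0^2+v_0^2)\,ds$, $t_b=\lim_{x\uparrow b}t(x)\in(0,\infty]$. There is a function $\varphi$ on $[0,\infty)$ such that: 1. on $[0,t_b)$, $\varphi$ is $C^2$, $\varphi''$ is locally absolutely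 continuous (so $\varphi'''$ is locally integrable on $[0,t_b)$), and $\varphi$ is strictly increasing with $\varphi'>0$; moreover $\varphi(0)=\alpha$, $\varphi'(0)=1$, $\varphi''(0)=0$; 2. if $t_b<\infty$, then $\varphi$ equals a constant $\tilde\beta\in[0,\pi)$ on $(t_b,\infty)$; 3. $P_\varphi$ is trace-normed, and $u_0(x)+iv_0(x)=R(x)e^{i\varphi(t(x))}$ with $R(x)>0$ for $x\in[0,b)$; 4. for every $z\in\mathbb C$, a function $y$ solves $-y''+Vy=zy$ on $(0,b)$ if and only if $\begin{pmatrix}y\\y'\end{pmatrix}(x)=\begin{pmatrix}u_0(x)&v_0(x)\\u_0'(x)&v_0'(x)\end{pmatrix}u(t(x))$ for a solution $u$ of $J\frac{du}{dt}=zP_\varphi u$ on $(0,t_b)$; 5. the Schrödinger problem and the canonical system $J\frac{du}{dt}=zP_\varphi u$ on $(0,\infty)$ have the same $m$ function (both exist and are uniquely determined on $\mathbb C^+$). (b) Conversely, let $\alpha\in[0,\pi)$, $t_b\in(0,\infty]$, and let $\varphi$ satisfy 1 and 2. Then there is a Schrödinger problem with this $\alpha$ for which $t_b=\lim_{x\uparrow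 b}t(x)$ and 3, 4, 5 hold. With $x(t)=\int_0^t\sqrt{\varphi'(s)}\,ds$, its interval is given by $b=\lim_{t\uparrow t_b}x(t)$ and its potential by $$V(x(t))=\frac7{16}\frac{\varphi''(t)^2}{\varphi'(t)^3}-\frac14\frac{\varphi'''(t)}{\varphi'(t)^2}-\varphi'(t)\qquad(\text{a.e. }t\in(0,t_b)),$$ the derivatives being taken with respect to $t$. -/

import Mathlib

open Set Filter Topology MeasureTheory

/-- The half-open interval `[0, b)` of real numbers, where `b` may be `∞`. -/
def halfOpen (b : EReal) : Set ℝ := {x : ℝ | 0 ≤ x ∧ (x : EReal) < b}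

/-- The filter of real `x` tending to `b` from the left (`x ↑ b`); for `b = ∞` it is `x → ∞`. -/
noncomputable def leftEnd (b : EReal) : Filter ℝ := comap (fun x : ℝ => (x : EReal)) (𝓝[<] b)

/-! ### Schrödinger equations -/

/-- `y`, with derivative `dy`, is a solution of `-y'' + V y = z y` on `[0, b)`:
`y` is differentiable with derivative `dy` (one-sided at `0`), and `dy` is locally absolutely
continuous with `dy' = (V - z) y` almost everywhere. -/
structure IsSchrodingerSolution (V : ℝ → ℝ) (b : EReal) (z : ℂ) (y dy : ℝ → ℂ) : Prop where
  hasDeriv : ∀ x ∈ halfOpen b, HasDerivWithinAt y (dy x) (Ici 0) x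
  deriv_eq : ∀ x ∈ halfOpen b, dy x = dy 0 + ∫ s in (0 : ℝ)..x, ((V s : ℂ) - z) * y s

/-- The Wronskian `W_x(f, g) = f(x) g'(x) - f'(x) g(x)`. -/
def wronskian (f df g dg : ℝ → ℂ) (x : ℝ) : ℂ := f x * dg x - df x * g x

/-- Square-integrability on `(0, b)`. -/
def SquareIntegrable (b : EReal) (y : ℝ → ℂ) : Prop :=
  IntegrableOn (fun x => ‖y x‖ ^ 2) (halfOpen b)

/-- The endpoint `b` is regular: `b` is finite and `V` is integrable up to `b`. -/
def IsRegularEnd (V : ℝ → ℝ) (b : EReal) : Prop := b ≠ ⊤ ∧ IntegrableOn V (halfOpen b)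

/-- The limit circle case at `b`: all solutions are square-integrable.
The limit point case is the negation. -/
def IsLimitCircle (V : ℝ → ℝ) (b : EReal) : Prop :=
  ∀ (z : ℂ) (y dy : ℝ → ℂ), IsSchrodingerSolution V b z y dy → SquareIntegrable b y

/-- The kinds of boundary condition at the right endpoint `b`:
* no condition (limit point case);
* `y(b) cos β + y'(b) sin β = 0` (regular endpoint);
* `lim_{x ↑ b} W_x(f̄, y) = 0` (singular endpoint in the limit circle case), where `f`
  (with derivative `df`) is a reference solution for the spectral parameter `z₀`, which lies on
  the limit circle. -/
inductive EndCondition where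
  | limitPoint : EndCondition
  | regular (β : ℝ) : EndCondition
  | limitCircle (z₀ : ℂ) (f df : ℝ → ℂ) : EndCondition

/-- The boundary condition at `b` is of the kind that the potential calls for.
In the singular limit circle case the reference solution is `f = u_α + m₀ v_α` with `m₀` on the
limit circle at `z₀`, that is `lim_{x ↑ b} W_x(f̄, f) = 0`. Here `u_α, v_α` are the solutions with
`u_α(0) = v_α'(0) = cos α` and `-u_α'(0) = v_α(0) = sin α`. -/
def EndCondition.Admissible (V : ℝ → ℝ) (b : EReal) (α : ℝ) : EndCondition → Prop
  | .limitPoint => ¬ IsLimitCircle V b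
  | .regular β => IsRegularEnd V b ∧ β ∈ Ico 0 Real.pi
  | .limitCircle z₀ f df =>
      IsLimitCircle V b ∧ ¬ IsRegularEnd V b ∧ 0 < z₀.im ∧
      IsSchrodingerSolution V b z₀ f df ∧
      (∃ m₀ : ℂ, f 0 = (Real.cos α : ℂ) + m₀ * (Real.sin α : ℂ) ∧
        df 0 = -(Real.sin α : ℂ) + m₀ * (Real.cos α : ℂ)) ∧
      Tendsto (wronskian (fun x => star (f x)) (fun x => star (df x)) f df) (leftEnd b) (𝓝 0)

/-- The function `y` (with derivative `dy`) satisfies the condition at `b`; in the limit point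
case this means that `y` is square-integrable. -/
def EndCondition.Holds (b : EReal) (y dy : ℝ → ℂ) : EndCondition → Prop
  | .limitPoint => SquareIntegrable b y
  | .regular β =>
      Tendsto (fun x => y x * (Real.cos β : ℂ) + dy x * (Real.sin β : ℂ)) (leftEnd b) (𝓝 0)
  | .limitCircle _ f df =>
      Tendsto (wronskian (fun x => star (f x)) (fun x => star (df x)) y dy) (leftEnd b) (𝓝 0)

/-- A Schrödinger equation `-y'' + V y = z y` on `(0, b)`, `0 < b ≤ ∞`, with a real potential
that is locally integrable on `[0, b)`, the boundary condition
`y(0) cos α - y'(0) sin α = 0` at `0`, and, if necessary, a boundary condition at `b`. -/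
structure SchrodingerProblem where
  b : EReal
  b_pos : 0 < b
  V : ℝ → ℝ
  locInt : LocallyIntegrableOn V (halfOpen b)
  α : ℝ
  α_mem : α ∈ Ico 0 Real.pi
  endCond : EndCondition
  admissible : endCond.Admissible V b α

namespace SchrodingerProblem

/-- The nontrivial solutions `ỹ` at `z` that satisfy the condition at `b`. -/
def IsWeylSolution (S : SchrodingerProblem) (z : ℂ) (y dy : ℝ → ℂ) : Prop :=
  IsSchrodingerSolution S.V S.b z y dy ∧ (y 0 ≠ 0 ∨ dy 0 ≠ 0) ∧ S.endCond.Holds S.b y dy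

/-- `m` is the Weyl-Titchmarsh `m` function of the problem: for every `z` in the upper half plane
there is a nontrivial solution `ỹ` satisfying the condition at `b`, and for each of them
`m(z) = (ỹ'(0) cos α + ỹ(0) sin α) / (-ỹ'(0) sin α + ỹ(0) cos α)`, which is the rotation by `α`
acting as a linear fractional transformation on `ỹ'(0) / ỹ(0)`. -/
def IsMFunction (S : SchrodingerProblem) (m : ℂ → ℂ) : Prop :=
  ∀ z : ℂ, 0 < z.im →
    (∃ y dy, S.IsWeylSolution z y dy) ∧
    ∀ y dy, S.IsWeylSolution z y dy →
      -dy 0 * (Real.sin S.α : ℂ) + y 0 * (Real.cos S.α : ℂ) ≠ 0 ∧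
      m z = (dy 0 * (Real.cos S.α : ℂ) + y 0 * (Real.sin S.α : ℂ)) /
        (-dy 0 * (Real.sin S.α : ℂ) + y 0 * (Real.cos S.α : ℂ))

/-- `u₀, v₀` are the real solutions for `z = 0` with `u₀(0) = v₀'(0) = cos α` and
`-u₀'(0) = v₀(0) = sin α`. -/
structure IsZeroBasis (S : SchrodingerProblem) (u₀ du₀ v₀ dv₀ : ℝ → ℝ) : Prop where
  sol_u : IsSchrodingerSolution S.V S.b 0 (fun x => (u₀ x : ℂ)) (fun x => (du₀ x : ℂ))
  sol_v : IsSchrodingerSolution S.V S.b 0 (fun x => (v₀ x : ℂ)) (fun x => (dv₀ x : ℂ))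
  u_init : u₀ 0 = Real.cos S.α
  du_init : du₀ 0 = -Real.sin S.α
  v_init : v₀ 0 = Real.sin S.α
  dv_init : dv₀ 0 = Real.cos S.α

end SchrodingerProblem

/-! ### Canonical systems -/

/-- The matrix `J`. -/
def matJ : Matrix (Fin 2) (Fin 2) ℂ := !![0, -1; 1, 0]

/-- A coefficient matrix with real entries, regarded as a complex matrix. -/
def toComplexMat (H : ℝ → Matrix (Fin 2) (Fin 2) ℝ) (t : ℝ) : Matrix (Fin 2) (Fin 2) ℂ :=
  (H t).map (fun r : ℝ => (r : ℂ))

/-- `H` is the coefficient matrix of a trace-normed half-line canonical system. -/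
structure IsTraceNormed (H : ℝ → Matrix (Fin 2) (Fin 2) ℝ) : Prop where
  posSemidef : ∀ᵐ t : ℝ, 0 < t → (H t).PosSemidef
  locInt : ∀ i j, LocallyIntegrableOn (fun t => H t i j) (Ici 0)
  trace_eq : ∀ᵐ t : ℝ, 0 < t → (H t).trace = 1

/-- `u` is a (locally absolutely continuous) solution of `J u' = z H u` on `[0, T)`,
in integrated form. -/
structure IsCanonicalSolution (H : ℝ → Matrix (Fin 2) (Fin 2) ℝ) (T : EReal) (z : ℂ)
    (u : ℝ → Fin 2 → ℂ) : Prop where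
  cont : ContinuousOn u (halfOpen T)
  eq : ∀ t ∈ halfOpen T,
    matJ.mulVec (u t - u 0) = z • ∫ s in (0 : ℝ)..t, (toComplexMat H s).mulVec (u s)

/-- The nontrivial solutions on the half line that are `H`-integrable: `∫₀^∞ u* H u < ∞`. -/
def IsHIntegrableSolution (H : ℝ → Matrix (Fin 2) (Fin 2) ℝ) (z : ℂ) (u : ℝ → Fin 2 → ℂ) :
    Prop :=
  IsCanonicalSolution H ⊤ z u ∧ u 0 ≠ 0 ∧
    IntegrableOn (fun t => star (u t) ⬝ᵥ (toComplexMat H t).mulVec (u t)) (Ioi 0)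

/-- `m` is the `m` function of the half-line canonical system `J u' = z H u` with the boundary
condition `u₁(0) = 0`: for every `z` in the upper half plane there is a nontrivial `H`-integrable
solution `ũ`, and for each of them `m(z) = ũ₂(0) / ũ₁(0)`. -/
def IsCanonicalMFunction (H : ℝ → Matrix (Fin 2) (Fin 2) ℝ) (m : ℂ → ℂ) : Prop :=
  ∀ z : ℂ, 0 < z.im →
    (∃ u, IsHIntegrableSolution H z u) ∧
    ∀ u, IsHIntegrableSolution H z u → u 0 0 ≠ 0 ∧ m z = u 0 1 / u 0 0

/-- The projection `P_φ(t)` onto the line spanned by `(cos φ(t), sin φ(t))`. -/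
noncomputable def projMat (φ : ℝ → ℝ) (t : ℝ) : Matrix (Fin 2) (Fin 2) ℝ :=
  !![Real.cos (φ t) ^ 2, Real.cos (φ t) * Real.sin (φ t);
     Real.cos (φ t) * Real.sin (φ t), Real.sin (φ t) ^ 2]

/-! ### The correspondence -/

/-- The conditions on `φ`, with first, second and third derivatives `φ₁, φ₂, φ₃` on `[0, t_b)`
(the third one in the almost everywhere sense, `φ₂` being locally absolutely continuous). -/
structure IsSchrodingerPhase (α : ℝ) (tb : EReal) (φ φ₁ φ₂ φ₃ : ℝ → ℝ) : Prop where
  tb_pos : 0 < tb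
  hasDeriv₁ : ∀ t ∈ halfOpen tb, HasDerivWithinAt φ (φ₁ t) (Ici 0) t
  hasDeriv₂ : ∀ t ∈ halfOpen tb, HasDerivWithinAt φ₁ (φ₂ t) (Ici 0) t
  locInt₃ : LocallyIntegrableOn φ₃ (halfOpen tb)
  deriv₃ : ∀ t ∈ halfOpen tb, φ₂ t = φ₂ 0 + ∫ s in (0 : ℝ)..t, φ₃ s
  strictMono : StrictMonoOn φ (halfOpen tb)
  deriv_pos : ∀ t ∈ halfOpen tb, 0 < φ₁ t
  init : φ 0 = α
  init₁ : φ₁ 0 = 1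
  init₂ : φ₂ 0 = 0
  const_after : tb ≠ ⊤ → ∃ β' ∈ Ico 0 Real.pi, ∀ t : ℝ, tb < (t : EReal) → φ t = β'

/-- The new variable `t(x) = ∫₀ˣ (u₀² + v₀²)`. -/
noncomputable def newTime (u₀ v₀ : ℝ → ℝ) (x : ℝ) : ℝ :=
  ∫ s in (0 : ℝ)..x, (u₀ s ^ 2 + v₀ s ^ 2)

/-- The Schrödinger problem `S` is expressed by the half-line canonical system
`J du/dt = z P_φ u`, and both have the same `m` function:
* `P_φ` is a trace-normed coefficient matrix;
* `t_b = lim_{x ↑ b} t(x)` and `u₀(x) + i v₀(x) = R(x) exp (i φ(t(x)))` with `R > 0`;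
* `y` solves the Schrödinger equation on `(0, b)` if and only if
  `y(x) = u₁(t(x)) u₀(x) + u₂(t(x)) v₀(x)`, `y'(x) = u₁(t(x)) u₀'(x) + u₂(t(x)) v₀'(x)` for a
  solution `u` of the canonical system on `(0, t_b)`;
* one function `m` is the `m` function of both. -/
def SchrodingerProblem.IsExpressedBy (S : SchrodingerProblem) (tb : EReal) (φ : ℝ → ℝ) : Prop :=
  IsTraceNormed (projMat φ) ∧
  (∃ u₀ du₀ v₀ dv₀ : ℝ → ℝ, S.IsZeroBasis u₀ du₀ v₀ dv₀ ∧
    Tendsto (fun x => (newTime u₀ v₀ x : EReal)) (leftEnd S.b) (𝓝 tb) ∧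
    (∀ x ∈ halfOpen S.b, ∃ R : ℝ, 0 < R ∧
      u₀ x = R * Real.cos (φ (newTime u₀ v₀ x)) ∧
      v₀ x = R * Real.sin (φ (newTime u₀ v₀ x))) ∧
    (∀ (z : ℂ) (y dy : ℝ → ℂ), IsSchrodingerSolution S.V S.b z y dy ↔
      ∃ u : ℝ → Fin 2 → ℂ, IsCanonicalSolution (projMat φ) tb z u ∧
        ∀ x ∈ halfOpen S.b,
          y x = u (newTime u₀ v₀ x) 0 * (u₀ x : ℂ) + u (newTime u₀ v₀ x) 1 * (v₀ x : ℂ) ∧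
          dy x = u (newTime u₀ v₀ x) 0 * (du₀ x : ℂ) +
            u (newTime u₀ v₀ x) 1 * (dv₀ x : ℂ))) ∧
  ∃ m : ℂ → ℂ, S.IsMFunction m ∧ IsCanonicalMFunction (projMat φ) m

/-!
The proof is a change of variables followed by Weyl theory for canonical systems with coefficient
matrix `P_φ`.

*Solutions.* Let `u, v` be the solutions for `z = 0` that belong to the boundary condition `α`;
their Wronskian is `1`. Variation of constants with respect to this basis turns `-y'' + V y = z y`
into `c' = z (v y, -u y)` with `y = c₁ u + c₂ v`, in which the potential no longer appears. In polar
coordinates `(u, v) = R (cos θ, sin θ)` and in the time `t` with `dt/dx = R²` this is exactly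
`J dc/dt = z P_φ c` with `φ(t) = θ(x)`. The notion `IsPolarBasis` collects these data, and
`IsPolarBasis.isPhaseSolution` and `IsPolarBasis.isSchrodingerSolution` are the two directions of
the correspondence. Since `θ' = 1 / R²`, one has `dφ/dt = R⁻⁴`, which gives the regularity of the
phase (`exists_isPolarBasis`). Conversely `R = (dφ/dt)^(-1/4)` can be read off from a phase, and
`u = R cos φ`, `v = R sin φ` solve the equation with the stated potential
(`IsSchrodingerPhase.exists_isPolarBasis`).

*The `m` functions.* On the half line the system `J u' = z P_φ u` has, for `z` in the upper half
plane, a nontrivial square-integrable solution by compactness of Weyl's nested disks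
(`exists_squareIntegrable_isPhaseSolution`), and never two independent ones, because `P_φ` has
trace one (`IsPhaseSolution.wronskian_eq_zero`). So its `m` function exists, for every measurable
phase for which `sin φ` is not almost everywhere zero. It remains to identify the Weyl solutions of
the Schrödinger problem with the square-integrable solutions of the canonical system. As `|y|² dx`
becomes `|cos φ c₁ + sin φ c₂|² dt`, this is immediate if `t_b = ∞`, which is the limit point case.
If `t_b < ∞`, which is the limit circle case, then `c` has a limit at `b`, and the phase is a
constant `β` after `t_b`, so that square-integrability says that `c(t_b)` is orthogonal to
`(cos β, sin β)`. Every boundary condition at `b` has this form (`IsPolarBasis.exists_matches`),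
and every `β` is obtained (`IsPolarBasis.exists_admissible`).

Locally integrable coefficients are treated in integrated form: `HasLocACDeriv` is the calculus of
locally absolutely continuous functions on `[0, b)`, and `IsCaratheodoryField` is the existence and
uniqueness theorem for the corresponding differential equations.
-/

/-! ### Half-open intervals and their left ends -/

lemma halfOpen_top : halfOpen ⊤ = Ici 0 := by
  ext x; simp [halfOpen]

lemma halfOpen_coe (T : ℝ) : halfOpen (T : EReal) = Ico 0 T := by
  ext x; simp [halfOpen]

lemma zero_mem_halfOpen {b : EReal} (hb : 0 < b) : (0 : ℝ) ∈ halfOpen b := ⟨le_rfl, by simpa using hb⟩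

lemma mem_halfOpen_of_le {b : EReal} {x y : ℝ} (hx : x ∈ halfOpen b) (h0 : 0 ≤ y) (hy : y ≤ x) :
    y ∈ halfOpen b := ⟨h0, lt_of_le_of_lt (EReal.coe_le_coe_iff.2 hy) hx.2⟩

lemma Icc_subset_halfOpen {b : EReal} {x : ℝ} (hx : x ∈ halfOpen b) : Icc 0 x ⊆ halfOpen b :=
  fun _ hy => mem_halfOpen_of_le hx hy.1 hy.2

lemma halfOpen_subset_Ici (b : EReal) : halfOpen b ⊆ Ici 0 := fun _ hx => hx.1

lemma exists_gt_mem_halfOpen {b : EReal} {x : ℝ} (hx : x ∈ halfOpen b) :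
    ∃ x' ∈ halfOpen b, x < x' := by
  obtain ⟨x', h1, h2⟩ := EReal.lt_iff_exists_real_btwn.1 hx.2
  have h1 : x < x' := EReal.coe_lt_coe_iff.1 h1
  exact ⟨x', ⟨hx.1.trans h1.le, h2⟩, h1⟩

lemma halfOpen_eq_inter (b : EReal) :
    halfOpen b = Ici 0 ∩ (fun x : ℝ => (x : EReal)) ⁻¹' Iio b := rfl

lemma measurableSet_halfOpen (b : EReal) : MeasurableSet (halfOpen b) :=
  measurableSet_Ici.inter (measurable_coe_real_ereal measurableSet_Iio)

lemma halfOpen_mem_nhdsWithin {b : EReal} {x : ℝ} (hx : x ∈ halfOpen b) :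
    halfOpen b ∈ 𝓝[Ici 0] x :=
  inter_mem self_mem_nhdsWithin <| mem_nhdsWithin_of_mem_nhds <|
    (continuous_coe_real_ereal.isOpen_preimage _ isOpen_Iio).mem_nhds hx.2

lemma nhdsWithin_halfOpen {b : EReal} {x : ℝ} (hx : x ∈ halfOpen b) :
    𝓝[halfOpen b] x = 𝓝[Ici 0] x :=
  nhdsWithin_eq_nhdsWithin' (s := (fun x : ℝ => (x : EReal)) ⁻¹' Iio b)
    ((continuous_coe_real_ereal.isOpen_preimage _ isOpen_Iio).mem_nhds hx.2)
    (by rw [halfOpen_eq_inter]; ext; simp +contextual)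

lemma convex_halfOpen (b : EReal) : Convex ℝ (halfOpen b) := by
  refine Set.OrdConnected.convex ⟨fun x hx y hy z hz => ?_⟩
  exact mem_halfOpen_of_le hy (hx.1.trans hz.1) hz.2

/-- On `[0, b)` local integrability is integrability up to each point. -/
lemma locallyIntegrableOn_halfOpen_iff {E : Type*} [NormedAddCommGroup E] {b : EReal} {f : ℝ → E} :
    LocallyIntegrableOn f (halfOpen b) ↔ ∀ x ∈ halfOpen b, IntervalIntegrable f volume 0 x := by
  constructor
  · intro h x hx
    rw [intervalIntegrable_iff_integrableOn_Icc_of_le hx.1]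
    exact h.integrableOn_compact_subset (Icc_subset_halfOpen hx) isCompact_Icc
  · intro h x hx
    obtain ⟨x', hx', hlt⟩ := exists_gt_mem_halfOpen hx
    refine ⟨Icc 0 x', ?_, (intervalIntegrable_iff_integrableOn_Icc_of_le hx'.1).1 (h x' hx')⟩
    rw [nhdsWithin_halfOpen hx]
    exact inter_mem self_mem_nhdsWithin (mem_nhdsWithin_of_mem_nhds (Iic_mem_nhds hlt))

lemma mem_leftEnd {b : EReal} (hb : 0 < b) {s : Set ℝ} :
    s ∈ leftEnd b ↔ ∃ x₀ ∈ halfOpen b, ∀ x ∈ halfOpen b, x₀ < x → x ∈ s := by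
  rw [leftEnd, ((nhdsLT_basis_of_exists_lt ⟨0, hb⟩).comap _).mem_iff]
  constructor
  · rintro ⟨l, hl, h⟩
    obtain ⟨x₀, h1, h2⟩ := EReal.lt_iff_exists_real_btwn.1 (max_lt hl hb)
    refine ⟨x₀, ⟨?_, h2⟩, fun x hx hlt => h ⟨?_, hx.2⟩⟩
    · exact_mod_cast ((le_max_right l 0).trans h1.le)
    · exact (le_max_left l 0).trans_lt (h1.trans (EReal.coe_lt_coe_iff.2 hlt))
  · rintro ⟨x₀, hx₀, h⟩
    refine ⟨x₀, hx₀.2, fun x hx => h x ⟨?_, hx.2⟩ (EReal.coe_lt_coe_iff.1 hx.1)⟩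
    exact hx₀.1.trans (EReal.coe_lt_coe_iff.1 hx.1).le

lemma halfOpen_mem_leftEnd {b : EReal} (hb : 0 < b) : halfOpen b ∈ leftEnd b :=
  (mem_leftEnd hb).2 ⟨0, zero_mem_halfOpen hb, fun _ hx _ => hx⟩

lemma leftEnd_neBot {b : EReal} (hb : 0 < b) : (leftEnd b).NeBot := by
  refine ⟨fun h => ?_⟩
  have : ∅ ∈ leftEnd b := by rw [h]; trivial
  obtain ⟨x₀, hx₀, h⟩ := (mem_leftEnd hb).1 this
  obtain ⟨x', hx', hlt⟩ := exists_gt_mem_halfOpen hx₀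
  exact h x' hx' hlt

lemma leftEnd_coe_le {T : ℝ} (hT : 0 < T) : leftEnd (T : EReal) ≤ 𝓝[Ici 0] T := by
  intro s hs
  obtain ⟨u, hu, hus⟩ := (mem_nhdsWithin_iff_exists_mem_nhds_inter).1 hs
  obtain ⟨l, hl, h⟩ := exists_Ioc_subset_of_mem_nhds hu ⟨0, hT⟩
  rw [mem_leftEnd (by exact_mod_cast hT)]
  simp only [halfOpen_coe]
  refine ⟨max l 0, ⟨le_max_right _ _, max_lt hl hT⟩, fun x hx hlt => hus ⟨h ⟨?_, hx.2.le⟩, hx.1⟩⟩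
  exact (le_max_left _ _).trans_lt hlt

lemma ContinuousOn.intervalIntegrable_halfOpen {E : Type*} [NormedAddCommGroup E] {b : EReal}
    {f : ℝ → E} (hf : ContinuousOn f (halfOpen b)) {x : ℝ} (hx : x ∈ halfOpen b) :
    IntervalIntegrable f volume 0 x :=
  (hf.mono (by rw [uIcc_of_le hx.1]; exact Icc_subset_halfOpen hx)).intervalIntegrable

/-! ### Locally absolutely continuous functions on `[0, b)` -/

section Calculus

variable {E F : Type*} [NormedAddCommGroup E] [NormedSpace ℝ E] [NormedAddCommGroup F]
  [NormedSpace ℝ F]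

/-- A function whose increments are dominated by those of an absolutely continuous function is
absolutely continuous. -/
lemma AbsolutelyContinuousOnInterval.of_dist_le {X Y : Type*} [PseudoMetricSpace X]
    [PseudoMetricSpace Y] {f : ℝ → X} {g : ℝ → Y} {a b : ℝ}
    (hg : AbsolutelyContinuousOnInterval g a b)
    (h : ∀ x ∈ uIcc a b, ∀ y ∈ uIcc a b, dist (f x) (f y) ≤ dist (g x) (g y)) :
    AbsolutelyContinuousOnInterval f a b := by
  refine squeeze_zero' (Eventually.of_forall fun E => Finset.sum_nonneg fun _ _ => dist_nonneg) ?_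
    hg
  have : ∀ᶠ E in totalLengthFilter ⊓ 𝓟 (disjWithin a b), E ∈ disjWithin a b :=
    mem_inf_of_right (mem_principal_self _)
  filter_upwards [this] with E hE
  exact Finset.sum_le_sum fun i hi => h _ (hE.1 i hi).1 _ (hE.1 i hi).2

/-- `f` is locally absolutely continuous on `[0, b)` with almost everywhere derivative `f'`;
this is encoded by the integrated form `f x = f 0 + ∫₀ˣ f'`. -/
structure HasLocACDeriv (b : EReal) (f f' : ℝ → E) : Prop where
  intervalIntegrable : ∀ x ∈ halfOpen b, IntervalIntegrable f' volume 0 x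
  eq : ∀ x ∈ halfOpen b, f x = f 0 + ∫ s in (0 : ℝ)..x, f' s

namespace HasLocACDeriv

variable {b : EReal} {f f' : ℝ → E}

lemma mono {b' : EReal} (h : HasLocACDeriv b f f') (hb : b' ≤ b) : HasLocACDeriv b' f f' :=
  ⟨fun x hx => h.1 x ⟨hx.1, hx.2.trans_le hb⟩, fun x hx => h.2 x ⟨hx.1, hx.2.trans_le hb⟩⟩

lemma congr_deriv {f'' : ℝ → E} (h : HasLocACDeriv b f f') (he : EqOn f' f'' (halfOpen b)) :
    HasLocACDeriv b f f'' := by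
  have key : ∀ x ∈ halfOpen b, EqOn f' f'' (uIcc 0 x) := fun x hx =>
    he.mono (by rw [uIcc_of_le hx.1]; exact Icc_subset_halfOpen hx)
  refine ⟨fun x hx => (h.1 x hx).congr ((key x hx).mono uIoc_subset_uIcc), fun x hx => ?_⟩
  rw [h.2 x hx, intervalIntegral.integral_congr (key x hx)]

lemma congr (hb : 0 < b) {g : ℝ → E} (h : HasLocACDeriv b f f') (he : EqOn f g (halfOpen b)) :
    HasLocACDeriv b g f' :=
  ⟨h.1, fun x hx => by rw [← he hx, ← he (zero_mem_halfOpen hb), h.2 x hx]⟩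

lemma locallyIntegrableOn (h : HasLocACDeriv b f f') : LocallyIntegrableOn f' (halfOpen b) :=
  locallyIntegrableOn_halfOpen_iff.2 h.1

lemma sub_eq (h : HasLocACDeriv b f f') {x y : ℝ} (hx : x ∈ halfOpen b) (hy : y ∈ halfOpen b) :
    f y - f x = ∫ s in x..y, f' s := by
  rw [h.2 y hy, h.2 x hx, add_sub_add_left_eq_sub,
    intervalIntegral.integral_interval_sub_left (h.1 y hy) (h.1 x hx)]

lemma continuousOn (h : HasLocACDeriv b f f') : ContinuousOn f (halfOpen b) := by
  intro x hx
  obtain ⟨x', hx', hlt⟩ := exists_gt_mem_halfOpen hx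
  have h1 : ContinuousOn (fun x => f 0 + ∫ s in (0 : ℝ)..x, f' s) (Icc 0 x') := by
    have := intervalIntegral.continuousOn_primitive_interval (μ := volume) (f := f') (a := 0)
      (b := x') (by
        rw [uIcc_of_le hx'.1]
        exact (intervalIntegrable_iff_integrableOn_Icc_of_le hx'.1).1 (h.1 x' hx'))
    rw [uIcc_of_le hx'.1] at this
    exact continuousOn_const.add this
  have h2 : ContinuousOn f (Icc 0 x') := h1.congr fun y hy => h.2 y (Icc_subset_halfOpen hx' hy)
  have h3 : Icc 0 x' ∈ 𝓝[halfOpen b] x := by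
    rw [nhdsWithin_halfOpen hx]
    exact inter_mem self_mem_nhdsWithin (mem_nhdsWithin_of_mem_nhds (Iic_mem_nhds hlt))
  exact (h2 x ⟨hx.1, hlt.le⟩).mono_of_mem_nhdsWithin h3

lemma const (c : E) : HasLocACDeriv b (fun _ => c) (fun _ => 0) :=
  ⟨fun x _ => by simp, fun x _ => by simp⟩

lemma add {g g' : ℝ → E} (h : HasLocACDeriv b f f') (hg : HasLocACDeriv b g g') :
    HasLocACDeriv b (fun x => f x + g x) (fun x => f' x + g' x) :=
  ⟨fun x hx => (h.1 x hx).add (hg.1 x hx), fun x hx => by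
    rw [intervalIntegral.integral_add (h.1 x hx) (hg.1 x hx), h.2 x hx, hg.2 x hx]; abel⟩

lemma neg (h : HasLocACDeriv b f f') : HasLocACDeriv b (fun x => -f x) (fun x => -f' x) :=
  ⟨fun x hx => (h.1 x hx).neg, fun x hx => by
    rw [intervalIntegral.integral_neg, h.2 x hx]; abel⟩

lemma sub {g g' : ℝ → E} (h : HasLocACDeriv b f f') (hg : HasLocACDeriv b g g') :
    HasLocACDeriv b (fun x => f x - g x) (fun x => f' x - g' x) := by
  simpa only [sub_eq_add_neg] using h.add hg.neg

lemma clm_comp [CompleteSpace E] [CompleteSpace F] (h : HasLocACDeriv b f f') (L : E →L[ℝ] F) :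
    HasLocACDeriv b (fun x => L (f x)) (fun x => L (f' x)) :=
  ⟨fun x hx => ⟨L.integrable_comp (h.1 x hx).1, L.integrable_comp (h.1 x hx).2⟩, fun x hx => by
    rw [L.intervalIntegral_comp_comm (h.1 x hx), h.2 x hx, map_add]⟩

lemma const_mul {𝕜 : Type*} [RCLike 𝕜] {f f' : ℝ → 𝕜} (h : HasLocACDeriv b f f') (c : 𝕜) :
    HasLocACDeriv b (fun x => c * f x) (fun x => c * f' x) :=
  h.clm_comp (ContinuousLinearMap.mul ℝ 𝕜 c)

lemma ofReal {f f' : ℝ → ℝ} (h : HasLocACDeriv b f f') :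
    HasLocACDeriv b (fun x => (f x : ℂ)) (fun x => (f' x : ℂ)) := h.clm_comp Complex.ofRealCLM

lemma star {f f' : ℝ → ℂ} (h : HasLocACDeriv b f f') :
    HasLocACDeriv b (fun x => star (f x)) (fun x => star (f' x)) :=
  h.clm_comp (Complex.conjCLE : ℂ →L[ℝ] ℂ)

lemma prodMk [CompleteSpace E] [CompleteSpace F] {g g' : ℝ → F} (h : HasLocACDeriv b f f')
    (hg : HasLocACDeriv b g g') :
    HasLocACDeriv b (fun x => (f x, g x)) (fun x => (f' x, g' x)) := by
  have := (h.clm_comp (ContinuousLinearMap.inl ℝ E F)).add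
    (hg.clm_comp (ContinuousLinearMap.inr ℝ E F))
  simpa using this

/-- The fundamental theorem of calculus: a function with a locally integrable derivative
everywhere. -/
lemma of_hasDerivWithinAt [CompleteSpace E]
    (h : ∀ x ∈ halfOpen b, HasDerivWithinAt f (f' x) (Ici 0) x)
    (hi : LocallyIntegrableOn f' (halfOpen b)) : HasLocACDeriv b f f' := by
  have hi := locallyIntegrableOn_halfOpen_iff.1 hi
  refine ⟨hi, fun x hx => ?_⟩
  rw [intervalIntegral.integral_eq_sub_of_hasDerivAt_of_le hx.1 (f := f)
    (fun y hy => ((h y (Icc_subset_halfOpen hx hy)).continuousWithinAt).mono Icc_subset_Ici_self)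
    (fun y hy => (h y (Icc_subset_halfOpen hx (Ioo_subset_Icc_self hy))).hasDerivAt
      (Ici_mem_nhds hy.1)) (hi x hx)]
  abel

lemma of_hasDerivWithinAt_of_continuousOn [CompleteSpace E]
    (h : ∀ x ∈ halfOpen b, HasDerivWithinAt f (f' x) (Ici 0) x)
    (hc : ContinuousOn f' (halfOpen b)) : HasLocACDeriv b f f' :=
  of_hasDerivWithinAt h (hc.locallyIntegrableOn (measurableSet_halfOpen b))

/-- The fundamental theorem of calculus: if the almost everywhere derivative is continuous, it is
the derivative at every point. -/
lemma hasDerivWithinAt [CompleteSpace E] (h : HasLocACDeriv b f f')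
    (hc : ContinuousOn f' (halfOpen b)) {x : ℝ} (hx : x ∈ halfOpen b) :
    HasDerivWithinAt f (f' x) (Ici 0) x := by
  obtain ⟨x', hx', hlt⟩ := exists_gt_mem_halfOpen hx
  have hmem : Icc 0 x' ∈ 𝓝[Ici 0] x :=
    inter_mem self_mem_nhdsWithin (mem_nhdsWithin_of_mem_nhds (Iic_mem_nhds hlt))
  have hx1 : x ∈ Icc 0 x' := ⟨hx.1, hlt.le⟩
  have hc' : ContinuousOn f' (Icc 0 x') := hc.mono (Icc_subset_halfOpen hx')
  have : Fact (x ∈ Icc 0 x') := ⟨hx1⟩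
  have key : HasDerivWithinAt (fun u => ∫ s in (0 : ℝ)..u, f' s) (f' x) (Icc 0 x') x :=
    intervalIntegral.integral_hasDerivWithinAt_right (h.1 x hx) (s := Icc 0 x') (t := Icc 0 x')
      (hc'.stronglyMeasurableAtFilter_nhdsWithin measurableSet_Icc x) (hc' x hx1)
  have : HasDerivWithinAt f (f' x) (Icc 0 x') x :=
    (key.const_add (f 0)).congr (fun y hy => h.2 y (Icc_subset_halfOpen hx' hy)) (h.2 x hx)
  exact this.mono_of_mem_nhdsWithin hmem

lemma absolutelyContinuousOnInterval (h : HasLocACDeriv b f f') {x : ℝ} (hx : x ∈ halfOpen b) :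
    AbsolutelyContinuousOnInterval f 0 x := by
  have hi := (h.1 x hx).norm
  have := hi.absolutelyContinuousOnInterval_intervalIntegral (c := 0) (by simp)
  refine this.of_dist_le fun y hy w hw => ?_
  rw [uIcc_of_le hx.1] at hy hw
  have hy' := Icc_subset_halfOpen hx hy
  have hw' := Icc_subset_halfOpen hx hw
  rw [dist_eq_norm, h.sub_eq hw' hy', dist_eq_norm, Real.norm_eq_abs,
    intervalIntegral.integral_interval_sub_left (h.1 y hy').norm (h.1 w hw').norm]
  exact intervalIntegral.norm_integral_le_abs_integral_norm

lemma ae_hasDerivAt [CompleteSpace E] (h : HasLocACDeriv b f f') {x : ℝ} (hx : x ∈ halfOpen b) :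
    ∀ᵐ y, y ∈ uIcc 0 x → HasDerivAt f (f' y) y := by
  have h0 : ∀ᵐ y : ℝ, y ≠ 0 := by simp [ae_iff, measure_singleton]
  have hx0 : ∀ᵐ y : ℝ, y ≠ x := by simp [ae_iff, measure_singleton]
  filter_upwards [(h.1 x hx).ae_hasDerivAt_integral, h0, hx0] with y hy hy0 hyx hmem
  have := (hy hmem 0 (by simp)).const_add (f 0)
  rw [uIcc_of_le hx.1] at hmem
  refine this.congr_of_eventuallyEq ?_
  filter_upwards [Icc_mem_nhds (lt_of_le_of_ne hmem.1 (Ne.symm hy0)) (lt_of_le_of_ne hmem.2 hyx)]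
    with w hw using h.2 w (Icc_subset_halfOpen hx hw)

/-- An absolutely continuous function is determined by its derivative. -/
lemma of_absolutelyContinuous [CompleteSpace E]
    (hi : ∀ x ∈ halfOpen b, IntervalIntegrable f' volume 0 x)
    (hac : ∀ x ∈ halfOpen b, AbsolutelyContinuousOnInterval f 0 x)
    (hd : ∀ x ∈ halfOpen b, ∀ᵐ y, y ∈ uIcc 0 x → HasDerivAt f (f' y) y) :
    HasLocACDeriv b f f' := by
  refine ⟨hi, fun x hx => ?_⟩
  have hP : HasLocACDeriv b (fun x => ∫ s in (0 : ℝ)..x, f' s) f' := ⟨hi, by simp⟩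
  have h1 := (hac x hx).sub (hP.absolutelyContinuousOnInterval hx)
  obtain ⟨C, hC⟩ := h1.const_of_ae_hasDerivAt_zero (by
    filter_upwards [hd x hx, hP.ae_hasDerivAt hx] with y h1 h2 hy
    simpa using (h1 hy).sub (h2 hy))
  have e1 := hC 0 (by simp)
  have e2 := hC x (by simp)
  simp only [Pi.sub_apply, intervalIntegral.integral_same, sub_zero] at e1 e2
  rw [e1, ← e2]; abel

/-- The product rule. -/
lemma smul {𝕜 : Type*} [RCLike 𝕜] [NormedSpace 𝕜 E] [CompleteSpace E]
    {k k' : ℝ → 𝕜} (hk : HasLocACDeriv b k k') (h : HasLocACDeriv b f f') :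
    HasLocACDeriv b (fun x => k x • f x) (fun x => k x • f' x + k' x • f x) := by
  refine of_absolutelyContinuous (fun x hx => ?_) (fun x hx => ?_) (fun x hx => ?_)
  · have hs : uIcc 0 x ⊆ halfOpen b := by rw [uIcc_of_le hx.1]; exact Icc_subset_halfOpen hx
    exact ((h.1 x hx).continuousOn_smul (hk.continuousOn.mono hs)).add
      ((hk.1 x hx).smul_continuousOn (h.continuousOn.mono hs))
  · exact (hk.absolutelyContinuousOnInterval hx).smul (h.absolutelyContinuousOnInterval hx)
  · filter_upwards [hk.ae_hasDerivAt hx, h.ae_hasDerivAt hx] with y h1 h2 hy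
    exact (h1 hy).smul (h2 hy)

lemma mul {𝕜 : Type*} [RCLike 𝕜] {k k' f f' : ℝ → 𝕜} (hk : HasLocACDeriv b k k')
    (h : HasLocACDeriv b f f') :
    HasLocACDeriv b (fun x => k x * f x) (fun x => k x * f' x + k' x * f x) :=
  hk.smul h

lemma pow {k k' : ℝ → ℝ} (hk : HasLocACDeriv b k k') (n : ℕ) :
    HasLocACDeriv b (fun x => k x ^ (n + 1)) (fun x => (n + 1) * k x ^ n * k' x) := by
  induction n with
  | zero => simpa using hk
  | succ n ih =>
    have h := hk.mul ih
    have e1 : (fun x => k x ^ (n + 1 + 1)) = fun x => k x * k x ^ (n + 1) := by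
      ext x; ring
    rw [e1]
    refine h.congr_deriv fun x _ => ?_
    push_cast; ring

lemma eq_of_deriv_eq_zero (h : HasLocACDeriv b f f') (h0 : EqOn f' 0 (halfOpen b)) {x : ℝ}
    (hx : x ∈ halfOpen b) : f x = f 0 := by
  have := (h.congr_deriv h0).2 x hx
  simpa using this

end HasLocACDeriv

end Calculus

/-! ### Linear Volterra equations with integrable Lipschitz constant -/

section Volterra

variable {E : Type*} [NormedAddCommGroup E]

/-- A time-dependent vector field on `[0, b)` that is Lipschitz in the space variable, with a
locally integrable Lipschitz constant `g`. -/
structure IsCaratheodoryField (b : EReal) (f : ℝ → E → E) (g : ℝ → ℝ) : Prop where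
  locInt : LocallyIntegrableOn g (halfOpen b)
  comp : ∀ u : ℝ → E, ContinuousOn u (halfOpen b) →
    LocallyIntegrableOn (fun s => f s (u s)) (halfOpen b)
  lip : ∀ s ∈ halfOpen b, ∀ x y, ‖f s x - f s y‖ ≤ g s * ‖x - y‖

namespace IsCaratheodoryField

variable {b : EReal} {f : ℝ → E → E} {g : ℝ → ℝ} {T : ℝ}

lemma intervalIntegrable (h : IsCaratheodoryField b f g) {u : ℝ → E}
    (hu : ContinuousOn u (halfOpen b)) {x : ℝ} (hx : x ∈ halfOpen b) :
    IntervalIntegrable (fun s => f s (u s)) volume 0 x :=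
  locallyIntegrableOn_halfOpen_iff.1 (h.comp u hu) x hx

lemma continuous_iccExtend (hT : 0 ≤ T) (u : C(Icc 0 T, E)) : Continuous (IccExtend hT u) :=
  u.continuous.Icc_extend'

lemma hasLocACDeriv_lipschitz (h : IsCaratheodoryField b f g) :
    HasLocACDeriv b (fun x => ∫ s in (0 : ℝ)..x, g s) g :=
  ⟨locallyIntegrableOn_halfOpen_iff.1 h.locInt, by simp⟩

variable [NormedSpace ℝ E]

/-- The Picard map `u ↦ c + ∫₀ᵗ f(s, u(s)) ds` on the continuous functions on `[0, T]`. -/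
noncomputable def picard (h : IsCaratheodoryField b f g) (hT : T ∈ halfOpen b) (c : E)
    (u : C(Icc 0 T, E)) : C(Icc 0 T, E) where
  toFun t := c + ∫ s in (0 : ℝ)..t, f s (IccExtend hT.1 u s)
  continuous_toFun := by
    have hu := (continuous_iccExtend hT.1 u).continuousOn (s := halfOpen b)
    have : HasLocACDeriv b (fun t => ∫ s in (0 : ℝ)..t, f s (IccExtend hT.1 u s))
        (fun s => f s (IccExtend hT.1 u s)) :=
      ⟨fun x hx => h.intervalIntegrable hu hx, by simp⟩
    exact continuous_const.add
      (continuousOn_iff_continuous_domRestrict.1 (this.continuousOn.mono (Icc_subset_halfOpen hT)))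

/-- The iterates of the Picard map satisfy `‖Φⁿ u - Φⁿ v‖(t) ≤ G(t)ⁿ / n! ‖u - v‖`, where
`G = ∫ g`. -/
lemma norm_iterate_picard_sub_le (h : IsCaratheodoryField b f g) (hT : T ∈ halfOpen b) (c : E)
    (u v : C(Icc 0 T, E)) (n : ℕ) (t : Icc 0 T) :
    ‖(h.picard hT c)^[n] u t - (h.picard hT c)^[n] v t‖ ≤
      (∫ s in (0 : ℝ)..t, g s) ^ n / n.factorial * dist u v := by
  induction n generalizing t with
  | zero => simpa [dist_eq_norm] using (u - v).norm_coe_le_norm t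
  | succ n ih =>
    have ht : (t : ℝ) ∈ halfOpen b := Icc_subset_halfOpen hT t.2
    rw [Function.iterate_succ_apply', Function.iterate_succ_apply']
    set U := (h.picard hT c)^[n] u
    set V := (h.picard hT c)^[n] v
    have hU := (continuous_iccExtend hT.1 U).continuousOn (s := halfOpen b)
    have hV := (continuous_iccExtend hT.1 V).continuousOn (s := halfOpen b)
    have e : h.picard hT c U t - h.picard hT c V t =
        ∫ s in (0 : ℝ)..t, (f s (IccExtend hT.1 U s) - f s (IccExtend hT.1 V s)) := by
      rw [intervalIntegral.integral_sub (h.intervalIntegrable hU ht) (h.intervalIntegrable hV ht)]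
      simp [picard]
    have hG := h.hasLocACDeriv_lipschitz.pow n
    have hGi : IntervalIntegrable (fun s => dist u v / (n + 1).factorial *
        ((n + 1) * (∫ r in (0 : ℝ)..s, g r) ^ n * g s)) volume 0 t := (hG.1 t ht).const_mul _
    rw [e]
    refine (intervalIntegral.norm_integral_le_of_norm_le ht.1 (ae_of_all _ fun s hs => ?_)
      hGi).trans_eq ?_
    · have hsT : s ∈ Icc 0 T := ⟨hs.1.le, hs.2.trans t.2.2⟩
      refine (h.lip s (Icc_subset_halfOpen hT hsT) _ _).trans ?_
      rw [IccExtend_of_mem _ _ hsT, IccExtend_of_mem _ _ hsT]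
      have hg : 0 ≤ g s ∨ ∀ x y : E, ‖x - y‖ = 0 := by
        by_cases hg : 0 ≤ g s
        · exact Or.inl hg
        · refine Or.inr fun x y => ?_
          have := h.lip s (Icc_subset_halfOpen hT hsT) x y
          have h1 := norm_nonneg (f s x - f s y)
          have h2 := norm_nonneg (x - y)
          nlinarith
      have hfac : ((n + 1).factorial : ℝ) = (n + 1) * n.factorial := by
        push_cast [Nat.factorial_succ]; ring
      have hr : dist u v / (n + 1).factorial * ((n + 1) * (∫ r in (0 : ℝ)..s, g r) ^ n * g s) =
          g s * ((∫ r in (0 : ℝ)..s, g r) ^ n / n.factorial * dist u v) := by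
        have : (n.factorial : ℝ) ≠ 0 := by positivity
        rw [hfac]; field_simp
      rcases hg with hg | hg
      · rw [hr]
        exact mul_le_mul_of_nonneg_left (ih ⟨s, hsT⟩) hg
      · have hd : dist u v = 0 := by
          have : u = v := by
            ext x; exact sub_eq_zero.1 (norm_eq_zero.1 (hg _ _))
          simp [this]
        rw [hg, hd]; simp
    · rw [intervalIntegral.integral_const_mul]
      have := hG.2 t ht
      simp only [intervalIntegral.integral_same, ne_eq, Nat.add_eq_zero_iff, one_ne_zero,
        and_false, not_false_eq_true, zero_pow, zero_add] at this
      rw [← this]; ring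

lemma exists_contracting_iterate (h : IsCaratheodoryField b f g) (hT : T ∈ halfOpen b) (c : E) :
    ∃ n, ∃ K, ContractingWith K (h.picard hT c)^[n] := by
  set A := ∫ s in (0 : ℝ)..T, |g s|
  obtain ⟨n, hn⟩ := ((FloorSemiring.tendsto_pow_div_factorial_atTop A).eventually
    (gt_mem_nhds (show (0 : ℝ) < 1 / 2 by norm_num))).exists
  refine ⟨n, 1 / 2, NNReal.half_lt_self one_ne_zero, LipschitzWith.of_dist_le_mul fun u v => ?_⟩
  refine (ContinuousMap.dist_le (by positivity)).2 fun t => ?_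
  have hgT := locallyIntegrableOn_halfOpen_iff.1 h.locInt T hT
  have ht : (t : ℝ) ∈ halfOpen b := Icc_subset_halfOpen hT t.2
  rw [dist_eq_norm]
  refine (h.norm_iterate_picard_sub_le hT c u v n t).trans ?_
  gcongr
  have h1 : |∫ s in (0 : ℝ)..t, g s| ≤ A := by
    refine (intervalIntegral.abs_integral_le_integral_abs t.2.1).trans ?_
    exact intervalIntegral.integral_mono_interval le_rfl t.2.1 t.2.2
      (ae_of_all _ fun _ => abs_nonneg _) hgT.abs
  calc (∫ s in (0 : ℝ)..t, g s) ^ n / n.factorial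
      ≤ |∫ s in (0 : ℝ)..t, g s| ^ n / n.factorial := by
        gcongr ?_ / _; exact (le_abs_self _).trans (abs_pow _ _).le
    _ ≤ A ^ n / n.factorial := by gcongr
    _ ≤ _ := by simpa using hn.le

lemma eqOn_of_solutions (h : IsCaratheodoryField b f g) (hT : T ∈ halfOpen b) {c : E}
    {u v : ℝ → E} (hu : ContinuousOn u (Icc 0 T)) (hv : ContinuousOn v (Icc 0 T))
    (hu' : ∀ t ∈ Icc 0 T, u t = c + ∫ s in (0 : ℝ)..t, f s (u s))
    (hv' : ∀ t ∈ Icc 0 T, v t = c + ∫ s in (0 : ℝ)..t, f s (v s)) : EqOn u v (Icc 0 T) := by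
  obtain ⟨n, K, hK⟩ := h.exists_contracting_iterate hT c
  have key : ∀ w : ℝ → E, (hw : ContinuousOn w (Icc 0 T)) →
      (∀ t ∈ Icc 0 T, w t = c + ∫ s in (0 : ℝ)..t, f s (w s)) →
      Function.IsFixedPt (h.picard hT c) ⟨(Icc 0 T).domRestrict w, hw.domRestrict⟩ := by
    intro w hw hw'
    ext t
    have : ∀ s ∈ uIcc 0 (t : ℝ), f s (IccExtend hT.1 ((Icc 0 T).domRestrict w) s) = f s (w s) := by
      intro s hs
      rw [uIcc_of_le t.2.1] at hs
      rw [IccExtend_of_mem _ _ (⟨hs.1, hs.2.trans t.2.2⟩ : s ∈ Icc 0 T)]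
      rfl
    simp only [picard, ContinuousMap.coe_mk]
    rw [intervalIntegral.integral_congr this, ← hw' t t.2]
    rfl
  have := hK.fixedPoint_unique' ((key u hu hu').iterate n) ((key v hv hv').iterate n)
  intro t ht
  exact congrArg (fun w : C(Icc 0 T, E) => w ⟨t, ht⟩) this

theorem eqOn_of_hasLocACDeriv (h : IsCaratheodoryField b f g) {u v : ℝ → E}
    (hu : HasLocACDeriv b u (fun s => f s (u s))) (hv : HasLocACDeriv b v (fun s => f s (v s)))
    (h0 : u 0 = v 0) : EqOn u v (halfOpen b) := by
  intro x hx
  refine h.eqOn_of_solutions hx (hu.continuousOn.mono (Icc_subset_halfOpen hx))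
    (hv.continuousOn.mono (Icc_subset_halfOpen hx))
    (fun t ht => hu.2 t (Icc_subset_halfOpen hx ht)) (fun t ht => ?_) ⟨hx.1, le_rfl⟩
  rw [h0]
  exact hv.2 t (Icc_subset_halfOpen hx ht)

variable [CompleteSpace E]

lemma exists_solution_Icc (h : IsCaratheodoryField b f g) (hT : T ∈ halfOpen b) (c : E) :
    ∃ u : ℝ → E, Continuous u ∧ ∀ t ∈ Icc 0 T, u t = c + ∫ s in (0 : ℝ)..t, f s (u s) := by
  obtain ⟨n, K, hK⟩ := h.exists_contracting_iterate hT c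
  have : Nonempty C(Icc 0 T, E) := ⟨0⟩
  have hfix := hK.isFixedPt_fixedPoint_iterate
  set w := ContractingWith.fixedPoint _ hK
  refine ⟨IccExtend hT.1 w, continuous_iccExtend hT.1 w, fun t ht => ?_⟩
  conv_lhs => rw [IccExtend_of_mem _ _ ht, ← hfix.eq]
  rfl

/-- Existence of global solutions on `[0, b)`. -/
theorem exists_solution (h : IsCaratheodoryField b f g) (hb : 0 < b) (c : E) :
    ∃ u : ℝ → E, u 0 = c ∧ HasLocACDeriv b u (fun s => f s (u s)) := by
  choose! U hUc hU using fun (T : ℝ) (hT : T ∈ halfOpen b) => h.exists_solution_Icc hT c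
  have hUU : ∀ x ∈ halfOpen b, ∀ s ∈ Icc 0 x, U s s = U x s := by
    intro x hx s hs
    have hsb := Icc_subset_halfOpen hx hs
    exact h.eqOn_of_solutions hsb (hUc s hsb).continuousOn (hUc x hx).continuousOn (hU s hsb)
      (fun t ht => hU x hx t ⟨ht.1, ht.2.trans hs.2⟩) ⟨hs.1, le_rfl⟩
  have h0 : U 0 0 = c := by simpa using hU 0 (zero_mem_halfOpen hb) 0 (by simp)
  refine ⟨fun t => U t t, h0, fun x hx => ?_, fun x hx => ?_⟩
  · refine (h.intervalIntegrable (hUc x hx).continuousOn hx).congr fun s hs => ?_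
    rw [uIoc_of_le hx.1] at hs
    simp only [hUU x hx s ⟨hs.1.le, hs.2⟩]
  · rw [h0, hU x hx x ⟨hx.1, le_rfl⟩]
    congr 1
    refine intervalIntegral.integral_congr fun s hs => ?_
    rw [uIcc_of_le hx.1] at hs
    simp only [hUU x hx s hs]

end IsCaratheodoryField

end Volterra

/-! ### Canonical systems with coefficient matrix `P_φ` -/

section Canonical

/-- The component `p cos φ + q sin φ` of `(p, q)` in the range of `P_φ`. -/
noncomputable def phaseProj (φ : ℝ → ℝ) (p q : ℝ → ℂ) (t : ℝ) : ℂ :=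
  (Real.cos (φ t) : ℂ) * p t + (Real.sin (φ t) : ℂ) * q t

/-- The system `J u' = z P_φ u` on `[0, T)` for `u = (p, q)`, written in components. -/
structure IsPhaseSolution (φ : ℝ → ℝ) (T : EReal) (z : ℂ) (p q : ℝ → ℂ) : Prop where
  fst : HasLocACDeriv T p (fun t => z * (Real.sin (φ t) * phaseProj φ p q t))
  snd : HasLocACDeriv T q (fun t => -z * (Real.cos (φ t) * phaseProj φ p q t))

variable {φ : ℝ → ℝ} {T : EReal} {z : ℂ} {p q P Q : ℝ → ℂ}

lemma norm_ofReal_cos_le (x : ℝ) : ‖(Real.cos x : ℂ)‖ ≤ 1 := by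
  rw [Complex.norm_real]; exact Real.abs_cos_le_one x

lemma norm_ofReal_sin_le (x : ℝ) : ‖(Real.sin x : ℂ)‖ ≤ 1 := by
  rw [Complex.norm_real]; exact Real.abs_sin_le_one x

lemma norm_phaseProj_le (t : ℝ) : ‖phaseProj φ p q t‖ ≤ ‖p t‖ + ‖q t‖ := by
  refine (norm_add_le _ _).trans ?_
  rw [norm_mul, norm_mul]
  exact add_le_add (mul_le_of_le_one_left (norm_nonneg _) (norm_ofReal_cos_le _))
    (mul_le_of_le_one_left (norm_nonneg _) (norm_ofReal_sin_le _))

section Measurability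

variable (hφ : AEMeasurable φ (volume.restrict (Ici 0)))
include hφ

lemma aestronglyMeasurable_cos {s : Set ℝ} (hs : s ⊆ Ici 0) :
    AEStronglyMeasurable (fun t => (Real.cos (φ t) : ℂ)) (volume.restrict s) :=
  (Complex.measurable_ofReal.comp_aemeasurable
    (Real.measurable_cos.comp_aemeasurable (hφ.mono_set hs))).aestronglyMeasurable

lemma aestronglyMeasurable_sin {s : Set ℝ} (hs : s ⊆ Ici 0) :
    AEStronglyMeasurable (fun t => (Real.sin (φ t) : ℂ)) (volume.restrict s) :=
  (Complex.measurable_ofReal.comp_aemeasurable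
    (Real.measurable_sin.comp_aemeasurable (hφ.mono_set hs))).aestronglyMeasurable

lemma intervalIntegrable_cos_mul {f : ℝ → ℂ} {x : ℝ} (hx : 0 ≤ x)
    (hf : IntervalIntegrable f volume 0 x) :
    IntervalIntegrable (fun t => (Real.cos (φ t) : ℂ) * f t) volume 0 x := by
  rw [intervalIntegrable_iff_integrableOn_Icc_of_le hx] at hf ⊢
  exact hf.bdd_mul (aestronglyMeasurable_cos hφ Icc_subset_Ici_self)
    (ae_of_all _ fun t => norm_ofReal_cos_le (φ t))

lemma intervalIntegrable_sin_mul {f : ℝ → ℂ} {x : ℝ} (hx : 0 ≤ x)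
    (hf : IntervalIntegrable f volume 0 x) :
    IntervalIntegrable (fun t => (Real.sin (φ t) : ℂ) * f t) volume 0 x := by
  rw [intervalIntegrable_iff_integrableOn_Icc_of_le hx] at hf ⊢
  exact hf.bdd_mul (aestronglyMeasurable_sin hφ Icc_subset_Ici_self)
    (ae_of_all _ fun t => norm_ofReal_sin_le (φ t))

lemma intervalIntegrable_phaseProj (hp : ContinuousOn p (halfOpen T))
    (hq : ContinuousOn q (halfOpen T)) {x : ℝ} (hx : x ∈ halfOpen T) :
    IntervalIntegrable (phaseProj φ p q) volume 0 x :=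
  (intervalIntegrable_cos_mul hφ hx.1 (hp.intervalIntegrable_halfOpen hx)).add
    (intervalIntegrable_sin_mul hφ hx.1 (hq.intervalIntegrable_halfOpen hx))

lemma aestronglyMeasurable_phaseProj (hp : ContinuousOn p (Ici 0)) (hq : ContinuousOn q (Ici 0))
    {s : Set ℝ} (hs : s ⊆ Ici 0) :
    AEStronglyMeasurable (phaseProj φ p q) (volume.restrict s) :=
  (((aestronglyMeasurable_cos hφ le_rfl).mul
    (hp.aestronglyMeasurable measurableSet_Ici)).add
    ((aestronglyMeasurable_sin hφ le_rfl).mul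
    (hq.aestronglyMeasurable measurableSet_Ici))).mono_set hs

end Measurability

lemma projMat_mulVec (u : ℝ → Fin 2 → ℂ) (t : ℝ) :
    (toComplexMat (projMat φ) t).mulVec (u t) =
      ![Real.cos (φ t) * phaseProj φ (u · 0) (u · 1) t,
        Real.sin (φ t) * phaseProj φ (u · 0) (u · 1) t] := by
  ext i
  fin_cases i <;> simp [toComplexMat, projMat, phaseProj, Matrix.mulVec, dotProduct,
    Fin.sum_univ_two] <;> ring

lemma star_dotProduct_projMat (u : ℝ → Fin 2 → ℂ) (t : ℝ) :
    star (u t) ⬝ᵥ (toComplexMat (projMat φ) t).mulVec (u t) =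
      ((‖phaseProj φ (u · 0) (u · 1) t‖ ^ 2 : ℝ) : ℂ) := by
  rw [projMat_mulVec]
  rw [Complex.ofReal_pow, ← Complex.conj_mul']
  simp only [phaseProj, dotProduct, Fin.sum_univ_two, Pi.star_apply, RCLike.star_def, map_add,
    map_mul, Complex.conj_ofReal, Matrix.cons_val_zero, Matrix.cons_val_one]
  ring

lemma isCanonicalSolution_iff (hφ : AEMeasurable φ (volume.restrict (Ici 0)))
    {u : ℝ → Fin 2 → ℂ} :
    IsCanonicalSolution (projMat φ) T z u ↔ IsPhaseSolution φ T z (u · 0) (u · 1) := by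
  have hint : ContinuousOn u (halfOpen T) → ∀ t ∈ halfOpen T,
      IntervalIntegrable (phaseProj φ (u · 0) (u · 1)) volume 0 t := fun hu t ht =>
    intervalIntegrable_phaseProj hφ (T := T) (continuousOn_pi.1 hu 0) (continuousOn_pi.1 hu 1) ht
  have hvec : ContinuousOn u (halfOpen T) → ∀ t ∈ halfOpen T,
      ∫ s in (0 : ℝ)..t, (toComplexMat (projMat φ) s).mulVec (u s) =
        ![∫ s in (0 : ℝ)..t, Real.cos (φ s) * phaseProj φ (u · 0) (u · 1) s,
          ∫ s in (0 : ℝ)..t, Real.sin (φ s) * phaseProj φ (u · 0) (u · 1) s] := by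
    intro hu t ht
    have hi : ∀ i, IntervalIntegrable
        (fun s => (toComplexMat (projMat φ) s).mulVec (u s) i) volume 0 t := by
      intro i
      simp_rw [projMat_mulVec]
      fin_cases i
      · exact intervalIntegrable_cos_mul hφ ht.1 (hint hu t ht)
      · exact intervalIntegrable_sin_mul hφ ht.1 (hint hu t ht)
    have hI : IntervalIntegrable
        (fun s => (toComplexMat (projMat φ) s).mulVec (u s)) volume 0 t :=
      ⟨Integrable.of_eval fun i => (hi i).1, Integrable.of_eval fun i => (hi i).2⟩
    have hproj := fun i => (ContinuousLinearMap.proj (R := ℝ) (φ := fun _ : Fin 2 => ℂ)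
      i).intervalIntegral_comp_comm hI
    ext i
    have := hproj i
    simp only [ContinuousLinearMap.proj_apply] at this
    rw [← this]
    simp_rw [projMat_mulVec]
    fin_cases i <;> simp
  have hJ : ∀ w : Fin 2 → ℂ, matJ.mulVec w = ![-w 1, w 0] := by
    intro w; ext i; fin_cases i <;> simp [matJ, Matrix.mulVec, dotProduct, Fin.sum_univ_two]
  constructor
  · intro h
    refine ⟨⟨fun t ht => ?_, fun t ht => ?_⟩, ⟨fun t ht => ?_, fun t ht => ?_⟩⟩
    · exact (intervalIntegrable_sin_mul hφ ht.1 (hint h.cont t ht)).const_mul z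
    · have := congrFun (h.eq t ht) 1
      rw [hvec h.cont t ht, hJ] at this
      simp only [Matrix.cons_val_one, Pi.smul_apply, smul_eq_mul, Pi.sub_apply,
        Matrix.cons_val_fin_one] at this
      rw [intervalIntegral.integral_const_mul, ← this]; ring
    · exact (intervalIntegrable_cos_mul hφ ht.1 (hint h.cont t ht)).const_mul (-z)
    · have := congrFun (h.eq t ht) 0
      rw [hvec h.cont t ht, hJ] at this
      simp only [Matrix.cons_val_zero, Pi.smul_apply, smul_eq_mul, Pi.sub_apply] at this
      rw [intervalIntegral.integral_const_mul, neg_mul, ← this]; ring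
  · intro h
    have hu : ContinuousOn u (halfOpen T) := by
      refine continuousOn_pi.2 fun i => ?_
      fin_cases i
      · exact h.fst.continuousOn
      · exact h.snd.continuousOn
    refine ⟨hu, fun t ht => ?_⟩
    rw [hvec hu t ht, hJ]
    have h1 := h.fst.2 t ht
    have h2 := h.snd.2 t ht
    rw [intervalIntegral.integral_const_mul] at h1 h2
    ext i
    fin_cases i
    · simp [h2]
    · simp [h1]

namespace IsPhaseSolution

lemma mono {T' : EReal} (h : IsPhaseSolution φ T z p q) (hT : T' ≤ T) :
    IsPhaseSolution φ T' z p q := ⟨h.fst.mono hT, h.snd.mono hT⟩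

lemma linearComb (h : IsPhaseSolution φ T z p q) (H : IsPhaseSolution φ T z P Q) (a b : ℂ) :
    IsPhaseSolution φ T z (fun t => a * p t + b * P t) (fun t => a * q t + b * Q t) := by
  refine ⟨((h.fst.const_mul a).add (H.fst.const_mul b)).congr_deriv fun t _ => ?_,
    ((h.snd.const_mul a).add (H.snd.const_mul b)).congr_deriv fun t _ => ?_⟩ <;>
  · simp only [phaseProj]; ring

lemma const_mul (h : IsPhaseSolution φ T z p q) (a : ℂ) :
    IsPhaseSolution φ T z (fun t => a * p t) (fun t => a * q t) := by
  simpa using h.linearComb h a 0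

/-- The Wronskian of two solutions for the same spectral parameter is constant. -/
lemma wronskian_eq (h : IsPhaseSolution φ T z p q) (H : IsPhaseSolution φ T z P Q) {t : ℝ}
    (ht : t ∈ halfOpen T) : p t * Q t - q t * P t = p 0 * Q 0 - q 0 * P 0 := by
  refine ((h.fst.mul H.snd).sub (h.snd.mul H.fst)).eq_of_deriv_eq_zero (fun s _ => ?_) ht
  simp only [phaseProj, Pi.zero_apply]; ring

/-- Lagrange's identity for `Im (p̄ q)`. -/
lemma im_eq (h : IsPhaseSolution φ T z p q) {t : ℝ} (ht : t ∈ halfOpen T) :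
    (star (p t) * q t).im =
      (star (p 0) * q 0).im - z.im * ∫ s in (0 : ℝ)..t, ‖phaseProj φ p q s‖ ^ 2 := by
  have key := ((h.fst.star.mul h.snd).clm_comp Complex.imCLM).2 t ht
  simp only [Complex.imCLM_apply] at key
  rw [key, ← intervalIntegral.integral_const_mul, sub_eq_add_neg, ← intervalIntegral.integral_neg]
  congr 1
  refine intervalIntegral.integral_congr fun s _ => ?_
  simp only [← Complex.normSq_eq_norm_sq, phaseProj, Complex.normSq_apply, RCLike.star_def,
    map_mul, map_add, Complex.conj_ofReal, Complex.add_im, Complex.mul_im, Complex.add_re,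
    Complex.mul_re, Complex.ofReal_re, Complex.ofReal_im, Complex.conj_re, Complex.conj_im,
    Complex.neg_re, Complex.neg_im]
  ring

end IsPhaseSolution

/-- The vector field of the system `J u' = z P_φ u`. -/
noncomputable def phaseField (φ : ℝ → ℝ) (z : ℂ) (t : ℝ) (u : ℂ × ℂ) : ℂ × ℂ :=
  (z * (Real.sin (φ t) * phaseProj φ (fun _ => u.1) (fun _ => u.2) t),
    -z * (Real.cos (φ t) * phaseProj φ (fun _ => u.1) (fun _ => u.2) t))

lemma isCaratheodoryField_phaseField (hφ : AEMeasurable φ (volume.restrict (Ici 0))) (z : ℂ) :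
    IsCaratheodoryField T (phaseField φ z) (fun _ => 2 * ‖z‖) where
  locInt := continuousOn_const.locallyIntegrableOn (measurableSet_halfOpen T)
  comp u hu := by
    refine locallyIntegrableOn_halfOpen_iff.2 fun x hx => ?_
    have h1 : IntervalIntegrable (phaseProj φ (fun t => (u t).1) (fun t => (u t).2)) volume 0 x :=
      intervalIntegrable_phaseProj hφ (T := T) (continuous_fst.comp_continuousOn hu)
        (continuous_snd.comp_continuousOn hu) hx
    have h2 := (intervalIntegrable_sin_mul hφ hx.1 h1).const_mul z
    have h3 := (intervalIntegrable_cos_mul hφ hx.1 h1).const_mul (-z)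
    exact ⟨h2.1.prodMk h3.1, h2.2.prodMk h3.2⟩
  lip t _ u v := by
    have hE : ‖phaseProj φ (fun _ => u.1 - v.1) (fun _ => u.2 - v.2) t‖ ≤ 2 * ‖u - v‖ := by
      refine (norm_phaseProj_le t).trans ?_
      have h1 : ‖u.1 - v.1‖ ≤ ‖u - v‖ := norm_fst_le (u - v)
      have h2 : ‖u.2 - v.2‖ ≤ ‖u - v‖ := norm_snd_le (u - v)
      linarith
    have e1 : (phaseField φ z t u - phaseField φ z t v).1 =
        z * (Real.sin (φ t) * phaseProj φ (fun _ => u.1 - v.1) (fun _ => u.2 - v.2) t) := by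
      simp only [phaseField, phaseProj, Prod.fst_sub]; ring
    have e2 : (phaseField φ z t u - phaseField φ z t v).2 =
        -z * (Real.cos (φ t) * phaseProj φ (fun _ => u.1 - v.1) (fun _ => u.2 - v.2) t) := by
      simp only [phaseField, phaseProj, Prod.snd_sub]; ring
    rw [Prod.norm_def, e1, e2, norm_mul, norm_mul, norm_mul, norm_mul, norm_neg,
      show 2 * ‖z‖ * ‖u - v‖ = ‖z‖ * (2 * ‖u - v‖) by ring]
    refine max_le ?_ ?_ <;> refine mul_le_mul_of_nonneg_left ?_ (norm_nonneg z)
    · exact (mul_le_of_le_one_left (norm_nonneg _) (norm_ofReal_sin_le _)).trans hE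
    · exact (mul_le_of_le_one_left (norm_nonneg _) (norm_ofReal_cos_le _)).trans hE

lemma exists_isPhaseSolution (hφ : AEMeasurable φ (volume.restrict (Ici 0))) (hT : 0 < T) (z : ℂ)
    (a b : ℂ) : ∃ p q, IsPhaseSolution φ T z p q ∧ p 0 = a ∧ q 0 = b := by
  obtain ⟨u, hu0, hu⟩ := (isCaratheodoryField_phaseField hφ z).exists_solution hT (a, b)
  refine ⟨fun t => (u t).1, fun t => (u t).2,
    ⟨hu.clm_comp (ContinuousLinearMap.fst ℝ ℂ ℂ), hu.clm_comp (ContinuousLinearMap.snd ℝ ℂ ℂ)⟩,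
    ?_, ?_⟩ <;> simp [hu0]

lemma IsPhaseSolution.eqOn (hφ : AEMeasurable φ (volume.restrict (Ici 0)))
    (h : IsPhaseSolution φ T z p q) (H : IsPhaseSolution φ T z P Q) (hp : p 0 = P 0)
    (hq : q 0 = Q 0) : EqOn p P (halfOpen T) ∧ EqOn q Q (halfOpen T) := by
  have := (isCaratheodoryField_phaseField (T := T) hφ z).eqOn_of_hasLocACDeriv
    (u := fun t => (p t, q t)) (v := fun t => (P t, Q t)) (h.fst.prodMk h.snd)
    (H.fst.prodMk H.snd) (by simp [hp, hq])
  exact ⟨fun t ht => congrArg Prod.fst (this ht), fun t ht => congrArg Prod.snd (this ht)⟩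

end Canonical

/-! ### Square-integrable solutions on the half line and the `m` function -/

section HalfLine

/-- Gronwall's inequality with an integrable coefficient: the solution stays bounded. -/
lemma HasLocACDeriv.exists_bound {E : Type*} [NormedAddCommGroup E] [NormedSpace ℝ E]
    {X X' : ℝ → E} {g : ℝ → ℝ} (h : HasLocACDeriv ⊤ X X') (hg : IntegrableOn g (Ioi 0))
    (hX : ∀ t, 0 ≤ t → ‖X' t‖ ≤ g t * ‖X t‖) : ∃ C, ∀ t, 0 ≤ t → ‖X t‖ ≤ C := by
  have hIci : ∀ {t : ℝ}, 0 ≤ t → t ∈ halfOpen ⊤ := fun ht => by rw [halfOpen_top]; exact ht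
  have hcont : ContinuousOn X (Ici 0) := halfOpen_top ▸ h.continuousOn
  have hg' : IntegrableOn (fun t => |g t|) (Ioi 0) := hg.abs
  have hgi : ∀ t, 0 ≤ t → IntervalIntegrable (fun t => |g t|) volume 0 t := fun t ht =>
    (intervalIntegrable_iff_integrableOn_Ioc_of_le ht).2 (hg'.mono_set Ioc_subset_Ioi_self)
  set I := ∫ t in Ioi (0 : ℝ), |g t|
  have hle : ∀ t, 0 ≤ t → ∫ s in (0 : ℝ)..t, |g s| ≤ I := fun t ht => by
    rw [intervalIntegral.integral_of_le ht]
    exact setIntegral_mono_set hg' (ae_of_all _ fun _ => abs_nonneg _)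
      (Ioc_subset_Ioi_self.eventuallyLE)
  -- beyond `N` the total mass of `|g|` is at most `1 / 2`
  obtain ⟨N, hN, hN0⟩ : ∃ N, I - 1 / 2 < ∫ s in (0 : ℝ)..N, |g s| ∧ 0 ≤ N := by
    have := (intervalIntegral_tendsto_integral_Ioi 0 hg' tendsto_id).eventually
      (lt_mem_nhds (show I - 1 / 2 < I by linarith))
    exact (this.and (eventually_ge_atTop 0)).exists
  obtain ⟨C, hC⟩ := isCompact_Icc.exists_bound_of_continuousOn
    (hcont.mono (Icc_subset_Ici_self : Icc 0 N ⊆ Ici 0))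
  refine ⟨max C (2 * ‖X N‖), fun t ht => ?_⟩
  rcases le_total t N with htN | htN
  · exact (hC t ⟨ht, htN⟩).trans (le_max_left _ _)
  refine le_trans ?_ (le_max_right _ _)
  obtain ⟨s, hs, hmax⟩ := isCompact_Icc.exists_isMaxOn (nonempty_Icc.2 htN)
    ((hcont.mono (fun r hr => hN0.trans hr.1 : Icc N t ⊆ Ici 0)).norm)
  have hs0 : 0 ≤ s := hN0.trans hs.1
  have hmass : ∫ r in N..s, |g r| ≤ 1 / 2 := by
    rw [← intervalIntegral.integral_interval_sub_left (hgi s hs0) (hgi N hN0)]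
    linarith [hle s hs0]
  have h1 : ‖X s - X N‖ ≤ 1 / 2 * ‖X s‖ := by
    rw [h.sub_eq (hIci hN0) (hIci hs0)]
    have hi : IntervalIntegrable (fun r => |g r|) volume N s := (hgi N hN0).symm.trans (hgi s hs0)
    refine (intervalIntegral.norm_integral_le_of_norm_le hs.1 (ae_of_all _ fun r hr => ?_)
      (hi.mul_const ‖X s‖)).trans ?_
    · have hr0 : 0 ≤ r := hN0.trans hr.1.le
      refine (hX r hr0).trans (mul_le_mul (le_abs_self _) ?_ (norm_nonneg _) (abs_nonneg _))
      exact hmax ⟨hr.1.le, hr.2.trans hs.2⟩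
    · rw [intervalIntegral.integral_mul_const]
      exact mul_le_mul_of_nonneg_right hmass (norm_nonneg _)
  have h2 : ‖X t‖ ≤ ‖X s‖ := hmax ⟨htN, le_rfl⟩
  have h3 : ‖X s‖ ≤ ‖X N‖ + ‖X s - X N‖ := by
    simpa using norm_add_le (X N) (X s - X N)
  linarith

variable {φ : ℝ → ℝ} {z : ℂ} {p q P Q : ℝ → ℂ}

lemma not_integrableOn_one_Ioi (a : ℝ) : ¬ IntegrableOn (fun _ => (1 : ℝ)) (Ioi a) := by
  simp [integrableOn_const_iff]

lemma IsPhaseSolution.integrableOn_sq_Icc (hφ : AEMeasurable φ (volume.restrict (Ici 0)))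
    (h : IsPhaseSolution φ ⊤ z p q) (N : ℝ) :
    IntegrableOn (fun t => ‖phaseProj φ p q t‖ ^ 2) (Icc 0 N) := by
  have hcp : ContinuousOn p (Ici 0) := halfOpen_top ▸ h.fst.continuousOn
  have hcq : ContinuousOn q (Ici 0) := halfOpen_top ▸ h.snd.continuousOn
  obtain ⟨C, hC⟩ := isCompact_Icc.exists_bound_of_continuousOn
    (hcp.mono (Icc_subset_Ici_self : Icc 0 N ⊆ Ici 0))
  obtain ⟨C', hC'⟩ := isCompact_Icc.exists_bound_of_continuousOn
    (hcq.mono (Icc_subset_Ici_self : Icc 0 N ⊆ Ici 0))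
  refine IntegrableOn.of_bound (by simp)
    ((aestronglyMeasurable_phaseProj hφ hcp hcq Icc_subset_Ici_self).norm.pow 2) ((C + C') ^ 2) ?_
  filter_upwards [ae_restrict_mem measurableSet_Icc] with t ht
  rw [norm_pow, norm_norm]
  exact pow_le_pow_left₀ (norm_nonneg _)
    ((norm_phaseProj_le t).trans (add_le_add (hC t ht) (hC' t ht))) 2

/-- On the half line, two linearly independent solutions are never both square-integrable:
otherwise Gronwall's inequality makes all solutions bounded, and then `cos φ` and `sin φ`, which
are bounded combinations of the two projections, are both square-integrable on `(0, ∞)`. -/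
lemma IsPhaseSolution.wronskian_eq_zero (h : IsPhaseSolution φ ⊤ z p q)
    (H : IsPhaseSolution φ ⊤ z P Q) (hi : IntegrableOn (fun t => ‖phaseProj φ p q t‖ ^ 2) (Ioi 0))
    (Hi : IntegrableOn (fun t => ‖phaseProj φ P Q t‖ ^ 2) (Ioi 0)) :
    p 0 * Q 0 - q 0 * P 0 = 0 := by
  by_contra hD
  set D := p 0 * Q 0 - q 0 * P 0
  have hDpos : 0 < ‖D‖ := norm_pos_iff.2 hD
  have hW : ∀ t, 0 ≤ t → p t * Q t - q t * P t = D := fun t ht =>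
    h.wronskian_eq H (by rw [halfOpen_top]; exact ht)
  set A := fun t => ‖phaseProj φ p q t‖
  set B := fun t => ‖phaseProj φ P Q t‖
  set X : ℝ → (ℂ × ℂ) × (ℂ × ℂ) := fun t => ((p t, q t), (P t, Q t))
  have hcos : ∀ t, 0 ≤ t → ‖D‖ * ‖(Real.cos (φ t) : ℂ)‖ ≤ (A t + B t) * ‖X t‖ := fun t ht => by
    have e : D * Real.cos (φ t) = phaseProj φ p q t * Q t - phaseProj φ P Q t * q t := by
      rw [← hW t ht]; simp only [phaseProj]; ring
    rw [← norm_mul, e, add_mul]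
    refine (norm_sub_le _ _).trans ?_
    rw [norm_mul, norm_mul]
    have h1 : ‖Q t‖ ≤ ‖X t‖ := (norm_snd_le (P t, Q t)).trans (norm_snd_le (X t))
    have h2 : ‖q t‖ ≤ ‖X t‖ := (norm_snd_le (p t, q t)).trans (norm_fst_le (X t))
    gcongr
  have hsin : ∀ t, 0 ≤ t → ‖D‖ * ‖(Real.sin (φ t) : ℂ)‖ ≤ (A t + B t) * ‖X t‖ := fun t ht => by
    have e : D * Real.sin (φ t) = phaseProj φ P Q t * p t - phaseProj φ p q t * P t := by
      rw [← hW t ht]; simp only [phaseProj]; ring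
    rw [← norm_mul, e, add_mul, add_comm]
    refine (norm_sub_le _ _).trans ?_
    rw [norm_mul, norm_mul]
    have h1 : ‖p t‖ ≤ ‖X t‖ := (norm_fst_le (p t, q t)).trans (norm_fst_le (X t))
    have h2 : ‖P t‖ ≤ ‖X t‖ := (norm_fst_le (P t, Q t)).trans (norm_snd_le (X t))
    gcongr
  have hAB : IntegrableOn (fun t => A t ^ 2 + B t ^ 2) (Ioi 0) := hi.add Hi
  have hA0 : ∀ t, 0 ≤ A t := fun _ => norm_nonneg _
  have hB0 : ∀ t, 0 ≤ B t := fun _ => norm_nonneg _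
  obtain ⟨C, hC⟩ := ((h.fst.prodMk h.snd).prodMk (H.fst.prodMk H.snd)).exists_bound
    (hAB.const_mul (2 * ‖z‖ / ‖D‖)) (fun t ht => by
      have key : ∀ (c : ℝ) (e : ℝ), ‖D‖ * ‖(c : ℂ)‖ ≤ (A t + B t) * ‖X t‖ → 0 ≤ e →
          e ≤ A t + B t → ‖z‖ * (‖(c : ℂ)‖ * e) ≤
            2 * ‖z‖ / ‖D‖ * (A t ^ 2 + B t ^ 2) * ‖X t‖ := by
        intro c e hc he0 he
        have h1 : ‖(c : ℂ)‖ ≤ (A t + B t) * ‖X t‖ / ‖D‖ := by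
          rw [le_div_iff₀ hDpos, mul_comm]; exact hc
        have h2 : (A t + B t) ^ 2 ≤ 2 * (A t ^ 2 + B t ^ 2) := by
          nlinarith [sq_nonneg (A t - B t)]
        calc ‖z‖ * (‖(c : ℂ)‖ * e)
            ≤ ‖z‖ * ((A t + B t) * ‖X t‖ / ‖D‖ * (A t + B t)) := by
              gcongr
          _ = ‖z‖ / ‖D‖ * (A t + B t) ^ 2 * ‖X t‖ := by ring
          _ ≤ ‖z‖ / ‖D‖ * (2 * (A t ^ 2 + B t ^ 2)) * ‖X t‖ := by gcongr
          _ = _ := by ring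
      have hA1 : A t ≤ A t + B t := le_add_of_nonneg_right (hB0 t)
      have hB1 : B t ≤ A t + B t := le_add_of_nonneg_left (hA0 t)
      simp only [Prod.norm_def (_, _), norm_mul, norm_neg]
      refine max_le (max_le ?_ ?_) (max_le ?_ ?_)
      · exact key _ _ (hsin t ht) (hA0 t) hA1
      · exact key _ _ (hcos t ht) (hA0 t) hA1
      · exact key _ _ (hsin t ht) (hB0 t) hB1
      · exact key _ _ (hcos t ht) (hB0 t) hB1)
  refine not_integrableOn_one_Ioi 0 ?_
  refine Integrable.mono' (hAB.const_mul (4 * C ^ 2 / ‖D‖ ^ 2))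
    aestronglyMeasurable_const ?_
  filter_upwards [ae_restrict_mem measurableSet_Ioi] with t ht
  have ht : 0 ≤ t := le_of_lt ht
  have hXC : (A t + B t) * ‖X t‖ ≤ (A t + B t) * C :=
    mul_le_mul_of_nonneg_left (hC t ht) (add_nonneg (hA0 t) (hB0 t))
  have h1 := (hcos t ht).trans hXC
  have h2 := (hsin t ht).trans hXC
  have h1' := mul_self_le_mul_self (by positivity) h1
  have h2' := mul_self_le_mul_self (by positivity) h2
  simp only [Complex.norm_real, Real.norm_eq_abs] at h1' h2'
  have hcs := Real.cos_sq_add_sin_sq (φ t)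
  rw [← sq_abs (Real.cos (φ t)), ← sq_abs (Real.sin (φ t))] at hcs
  rw [norm_one, div_mul_eq_mul_div, le_div_iff₀ (by positivity)]
  have h3 : (A t + B t) ^ 2 * C ^ 2 ≤ 2 * (A t ^ 2 + B t ^ 2) * C ^ 2 :=
    mul_le_mul_of_nonneg_right (by nlinarith [sq_nonneg (A t - B t)]) (sq_nonneg _)
  have h4 : ‖D‖ ^ 2 = ‖D‖ ^ 2 * (|Real.cos (φ t)| ^ 2 + |Real.sin (φ t)| ^ 2) := by
    rw [hcs, mul_one]
  nlinarith

/-- Weyl's nested disks: in the upper half plane there is a nontrivial square-integrable solution.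
For each `N` the initial values in the unit sphere for which `Im (p̄ q)(N) ≥ 0` form a nonempty
compact set, and these sets decrease with `N` by Lagrange's identity. -/
lemma exists_squareIntegrable_isPhaseSolution (hφ : AEMeasurable φ (volume.restrict (Ici 0)))
    (hz : 0 < z.im) : ∃ p q, IsPhaseSolution φ ⊤ z p q ∧ (p 0 ≠ 0 ∨ q 0 ≠ 0) ∧
      IntegrableOn (fun t => ‖phaseProj φ p q t‖ ^ 2) (Ioi 0) ∧
      ∀ N, 0 ≤ N → z.im * ∫ t in (0 : ℝ)..N, ‖phaseProj φ p q t‖ ^ 2 ≤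
        (star (p 0) * q 0).im := by
  have hIci : ∀ {t : ℝ}, 0 ≤ t → t ∈ halfOpen ⊤ := fun ht => by rw [halfOpen_top]; exact ht
  obtain ⟨p, q, h, hp0, hq0⟩ := exists_isPhaseSolution hφ (T := ⊤) EReal.zero_lt_top z 1 0
  obtain ⟨P, Q, H, hP0, hQ0⟩ := exists_isPhaseSolution hφ (T := ⊤) EReal.zero_lt_top z 0 1
  have hW : ∀ t, 0 ≤ t → p t * Q t - q t * P t = 1 := fun t ht => by
    rw [h.wronskian_eq H (hIci ht), hp0, hq0, hP0, hQ0]; simp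
  set S : ℕ → Set (ℂ × ℂ) := fun N => {w | w ∈ Metric.sphere 0 1 ∧
    0 ≤ (star (w.1 * p N + w.2 * P N) * (w.1 * q N + w.2 * Q N)).im}
  have hint : ∀ w : ℂ × ℂ, ∀ N, 0 ≤ N → IntervalIntegrable (fun t =>
      ‖phaseProj φ (fun t => w.1 * p t + w.2 * P t) (fun t => w.1 * q t + w.2 * Q t) t‖ ^ 2)
      volume 0 N := fun w N hN => by
    rw [intervalIntegrable_iff_integrableOn_Icc_of_le hN]
    exact (h.linearComb H w.1 w.2).integrableOn_sq_Icc hφ N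
  have him : ∀ w : ℂ × ℂ, ∀ N, 0 ≤ N →
      (star (w.1 * p N + w.2 * P N) * (w.1 * q N + w.2 * Q N)).im = (star w.1 * w.2).im -
        z.im * ∫ t in (0 : ℝ)..N, ‖phaseProj φ (fun t => w.1 * p t + w.2 * P t)
          (fun t => w.1 * q t + w.2 * Q t) t‖ ^ 2 := fun w N hN => by
    rw [(h.linearComb H w.1 w.2).im_eq (hIci hN), hp0, hq0, hP0, hQ0]; simp
  have hclosed : ∀ N, IsClosed (S N) := fun N => by
    have hc : Continuous fun w : ℂ × ℂ =>
        (star (w.1 * p N + w.2 * P N) * (w.1 * q N + w.2 * Q N)).im :=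
      Complex.continuous_im.comp (by fun_prop)
    exact Metric.isClosed_sphere.inter (isClosed_le continuous_const hc)
  obtain ⟨w, hw⟩ : (⋂ N, S N).Nonempty := by
    refine IsCompact.nonempty_iInter_of_sequence_nonempty_isCompact_isClosed S (fun N w hw => ?_)
      (fun N => ?_) ?_ hclosed
    · refine ⟨hw.1, hw.2.trans ?_⟩
      have hN0 : (0 : ℝ) ≤ N := by positivity
      have hN1 : (N : ℝ) ≤ (N + 1 : ℕ) := by push_cast; linarith
      rw [him w N hN0, him w _ (hN0.trans hN1)]
      have := intervalIntegral.integral_mono_interval (μ := volume) (le_refl (0 : ℝ)) hN0 hN1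
        (ae_of_all _ fun t => by positivity) (hint w _ (hN0.trans hN1))
      have := mul_le_mul_of_nonneg_left this hz.le
      linarith
    · -- the solution with value a multiple of `(1, i)` at `N`
      set v : ℂ × ℂ := (Q N - Complex.I * P N, Complex.I * p N - q N)
      have hWN := hW N (by positivity)
      have e1 : v.1 * p N + v.2 * P N = 1 := by
        rw [← hWN]; ring
      have e2 : v.1 * q N + v.2 * Q N = Complex.I := by
        linear_combination Complex.I * hWN
      have hv : v ≠ 0 := fun hv => by simp [hv] at e1
      have hnv : (0 : ℝ) < ‖v‖ := norm_pos_iff.2 hv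
      refine ⟨((‖v‖⁻¹ : ℝ) : ℂ) • v, ?_, ?_⟩
      · simp [norm_smul, hnv.ne']
      · have e3 : (((‖v‖⁻¹ : ℝ) : ℂ) • v).1 * p N + (((‖v‖⁻¹ : ℝ) : ℂ) • v).2 * P N =
            ((‖v‖⁻¹ : ℝ) : ℂ) := by
          simp only [Prod.smul_fst, Prod.smul_snd, smul_eq_mul]
          linear_combination ((‖v‖⁻¹ : ℝ) : ℂ) * e1
        have e4 : (((‖v‖⁻¹ : ℝ) : ℂ) • v).1 * q N + (((‖v‖⁻¹ : ℝ) : ℂ) • v).2 * Q N =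
            ((‖v‖⁻¹ : ℝ) : ℂ) * Complex.I := by
          simp only [Prod.smul_fst, Prod.smul_snd, smul_eq_mul]
          linear_combination ((‖v‖⁻¹ : ℝ) : ℂ) * e2
        rw [e3, e4, RCLike.star_def, Complex.conj_ofReal, ← mul_assoc, ← Complex.ofReal_mul,
          Complex.im_ofReal_mul, Complex.I_im]
        positivity
    · exact (isCompact_sphere 0 1).of_isClosed_subset (hclosed 0) (fun w hw => hw.1)
  rw [mem_iInter] at hw
  have hbound : ∀ N, 0 ≤ N → z.im * ∫ t in (0 : ℝ)..N, ‖phaseProj φ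
      (fun t => w.1 * p t + w.2 * P t) (fun t => w.1 * q t + w.2 * Q t) t‖ ^ 2 ≤
        (star w.1 * w.2).im := fun N hN => by
    obtain ⟨n, hn⟩ := exists_nat_ge N
    have h1 := (hw n).2
    rw [him w n (hN.trans hn)] at h1
    have := intervalIntegral.integral_mono_interval (μ := volume) (le_refl (0 : ℝ)) hN hn
      (ae_of_all _ fun t => by positivity) (hint w _ (hN.trans hn))
    have := mul_le_mul_of_nonneg_left this hz.le
    linarith
  refine ⟨_, _, h.linearComb H w.1 w.2, ?_, ?_, ?_⟩
  · by_contra! hcon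
    have hs := (hw 0).1
    have : w = 0 := by
      ext
      · simpa [hp0, hP0] using hcon.1
      · simpa [hq0, hQ0] using hcon.2
    rw [this] at hs; simp at hs
  · refine integrableOn_Ioi_of_intervalIntegral_norm_bounded ((star w.1 * w.2).im / z.im) 0
      (l := atTop) (b := fun n : ℕ => (n : ℝ)) (fun n => ?_) tendsto_natCast_atTop_atTop
      (Eventually.of_forall fun n => ?_)
    · exact (intervalIntegrable_iff_integrableOn_Ioc_of_le (by positivity)).1
        (hint w n (by positivity))
    · simp only [norm_pow, norm_norm]
      rw [le_div_iff₀ hz, mul_comm]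
      exact hbound n (by positivity)
  · intro N hN
    simpa [hp0, hq0, hP0, hQ0] using hbound N hN

/-- If `sin φ` does not vanish almost everywhere, a nontrivial square-integrable solution does not
satisfy the boundary condition `p(0) = 0` at `0`. -/
lemma exists_squareIntegrable_isPhaseSolution_ne_zero
    (hφ : AEMeasurable φ (volume.restrict (Ici 0)))
    (hsin : ¬ ∀ᵐ t ∂volume.restrict (Ioi 0), Real.sin (φ t) = 0) (hz : 0 < z.im) :
    ∃ p q, IsPhaseSolution φ ⊤ z p q ∧ p 0 ≠ 0 ∧
      IntegrableOn (fun t => ‖phaseProj φ p q t‖ ^ 2) (Ioi 0) := by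
  obtain ⟨p, q, h, h0, hi, hle⟩ := exists_squareIntegrable_isPhaseSolution hφ hz
  refine ⟨p, q, h, fun hp0 => hsin ?_, hi⟩
  have hq0 : q 0 ≠ 0 := h0.resolve_left (by simp [hp0])
  -- the projection vanishes almost everywhere, so the solution is the constant `(0, q 0)`
  have hzero : ∫ t in Ioi (0 : ℝ), ‖phaseProj φ p q t‖ ^ 2 ≤ 0 := by
    refine le_of_tendsto (intervalIntegral_tendsto_integral_Ioi 0 hi tendsto_id) ?_
    filter_upwards [eventually_ge_atTop 0] with N hN
    have := hle N hN
    rw [hp0, star_zero, zero_mul, Complex.zero_im] at this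
    exact nonpos_of_mul_nonpos_right this hz
  have hae : ∀ᵐ t ∂volume.restrict (Ioi 0), phaseProj φ p q t = 0 := by
    have := (setIntegral_eq_zero_iff_of_nonneg_ae (ae_of_all _ fun t => by positivity) hi).1
      (le_antisymm hzero (setIntegral_nonneg measurableSet_Ioi fun t _ => by positivity))
    filter_upwards [this] with t ht
    simpa using ht
  have hae' : ∀ x : ℝ, ∀ᵐ t, t ∈ uIoc 0 x → 0 ≤ x → phaseProj φ p q t = 0 := fun x => by
    filter_upwards [(ae_restrict_iff' measurableSet_Ioi).1 hae] with t ht htx hx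
    rw [uIoc_of_le hx] at htx
    exact ht htx.1
  have hpq : ∀ t, 0 < t → p t = 0 ∧ q t = q 0 := fun t ht => by
    have htm : t ∈ halfOpen ⊤ := by rw [halfOpen_top]; exact ht.le
    rw [h.fst.2 t htm, h.snd.2 t htm,
      intervalIntegral.integral_congr_ae (g := fun _ => (0 : ℂ)),
      intervalIntegral.integral_congr_ae
        (f := fun s => -z * (Real.cos (φ s) * phaseProj φ p q s)) (g := fun _ => (0 : ℂ))]
    · simp [hp0]
    · filter_upwards [hae' t] with s hs hst
      simp [hs hst ht.le]
    · filter_upwards [hae' t] with s hs hst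
      simp [hs hst ht.le]
  filter_upwards [hae, ae_restrict_mem measurableSet_Ioi] with t ht ht0
  simp only [phaseProj, (hpq t ht0).1, (hpq t ht0).2, mul_zero, zero_add, mul_eq_zero, hq0,
    or_false] at ht
  exact_mod_cast ht

lemma isHIntegrableSolution_iff (hφ : AEMeasurable φ (volume.restrict (Ici 0)))
    {u : ℝ → Fin 2 → ℂ} :
    IsHIntegrableSolution (projMat φ) z u ↔ IsPhaseSolution φ ⊤ z (u · 0) (u · 1) ∧ u 0 ≠ 0 ∧
      IntegrableOn (fun t => ‖phaseProj φ (u · 0) (u · 1) t‖ ^ 2) (Ioi 0) := by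
  simp only [IsHIntegrableSolution, isCanonicalSolution_iff hφ, star_dotProduct_projMat]
  refine and_congr_right fun _ => and_congr_right fun _ => ⟨fun h => ?_, fun h => ?_⟩
  · exact (RCLike.reCLM (K := ℂ)).integrable_comp h
  · exact h.ofReal

/-- The `m` function of the half-line system with coefficient matrix `P_φ` exists. -/
theorem exists_isCanonicalMFunction (hφ : AEMeasurable φ (volume.restrict (Ici 0)))
    (hsin : ¬ ∀ᵐ t ∂volume.restrict (Ioi 0), Real.sin (φ t) = 0) :
    ∃ m, IsCanonicalMFunction (projMat φ) m := by
  have key : ∀ z : ℂ, ∃ m : ℂ, 0 < z.im → (∃ u, IsHIntegrableSolution (projMat φ) z u) ∧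
      ∀ u, IsHIntegrableSolution (projMat φ) z u → u 0 0 ≠ 0 ∧ m = u 0 1 / u 0 0 := by
    intro z
    by_cases hz : 0 < z.im
    swap
    · exact ⟨0, fun h => absurd h hz⟩
    obtain ⟨p, q, h, hp0, hi⟩ := exists_squareIntegrable_isPhaseSolution_ne_zero hφ hsin hz
    refine ⟨q 0 / p 0, fun _ => ⟨⟨fun t => ![p t, q t], ?_⟩, fun u hu => ?_⟩⟩
    · exact (isHIntegrableSolution_iff hφ).2 ⟨h, fun h0 => hp0 (congrFun h0 0), hi⟩
    · obtain ⟨hu, hu0, hui⟩ := (isHIntegrableSolution_iff hφ).1 hu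
      have hW := h.wronskian_eq_zero hu hi hui
      have hu00 : u 0 0 ≠ 0 := fun h00 => by
        rw [h00, mul_zero, sub_zero] at hW
        refine hu0 (funext fun i => ?_)
        fin_cases i
        · exact h00
        · exact (mul_eq_zero.1 hW).resolve_left hp0
      refine ⟨hu00, ?_⟩
      rw [div_eq_div_iff hp0 hu00]
      linear_combination -hW
  choose m hm using key
  exact ⟨m, hm⟩

/-- If `φ` is constant on `(T, ∞)`, then square-integrability is a boundary condition at `T`. -/
lemma IsPhaseSolution.integrableOn_iff_of_const_after
    (hφ : AEMeasurable φ (volume.restrict (Ici 0))) (h : IsPhaseSolution φ ⊤ z p q) {T β : ℝ}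
    (hT : 0 ≤ T) (hβ : ∀ t, T < t → φ t = β) :
    IntegrableOn (fun t => ‖phaseProj φ p q t‖ ^ 2) (Ioi 0) ↔
      (Real.cos β : ℂ) * p T + (Real.sin β : ℂ) * q T = 0 := by
  have hIci : ∀ {t : ℝ}, 0 ≤ t → t ∈ halfOpen ⊤ := fun ht => by rw [halfOpen_top]; exact ht
  have hE : ∀ t ∈ Ioi T, phaseProj φ p q t = (Real.cos β : ℂ) * p T + (Real.sin β : ℂ) * q T := by
    intro t ht
    have ht : T < t := ht
    have hF := (h.fst.const_mul (Real.cos β)).add (h.snd.const_mul (Real.sin β))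
    have := hF.sub_eq (hIci hT) (hIci (hT.trans ht.le))
    rw [intervalIntegral.integral_congr_ae (g := fun _ => (0 : ℂ)),
      intervalIntegral.integral_zero, sub_eq_zero] at this
    · rw [phaseProj, hβ t ht, this]
    · refine ae_of_all _ fun s hs => ?_
      rw [uIoc_of_le ht.le] at hs
      rw [hβ s hs.1]; ring
  rw [← Ioc_union_Ioi_eq_Ioi hT, integrableOn_union]
  have hIoc : IntegrableOn (fun t => ‖phaseProj φ p q t‖ ^ 2) (Ioc 0 T) :=
    (h.integrableOn_sq_Icc hφ T).mono_set Ioc_subset_Icc_self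
  rw [integrableOn_congr_fun (g := fun _ => ‖(Real.cos β : ℂ) * p T + Real.sin β * q T‖ ^ 2)
    (fun t ht => by simp only [hE t ht]) measurableSet_Ioi]
  simp [hIoc, integrableOn_const_iff]

end HalfLine

/-! ### Changes of the independent variable -/

section TimeChange

instance ordConnected_halfOpen (b : EReal) : OrdConnected (halfOpen b) :=
  ⟨fun _ hx _ hy _ hz => mem_halfOpen_of_le hy (hx.1.trans hz.1) hz.2⟩

/-- A `C¹` change of variables `τ : [0, b) → [0, T)` with positive derivative `ρ` and
inverse `ξ`. -/
structure IsTimeChange (b T : EReal) (τ ρ ξ : ℝ → ℝ) : Prop where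
  mapsTo : MapsTo τ (halfOpen b) (halfOpen T)
  mapsTo_inv : MapsTo ξ (halfOpen T) (halfOpen b)
  left_inv : ∀ x ∈ halfOpen b, ξ (τ x) = x
  right_inv : ∀ t ∈ halfOpen T, τ (ξ t) = t
  hasDeriv : ∀ x ∈ halfOpen b, HasDerivWithinAt τ (ρ x) (Ici 0) x
  cont : ContinuousOn ρ (halfOpen b)
  pos : ∀ x ∈ halfOpen b, 0 < ρ x
  zero : τ 0 = 0

lemma strictMonoOn_halfOpen {b : EReal} {τ ρ : ℝ → ℝ}
    (hd : ∀ x ∈ halfOpen b, HasDerivWithinAt τ (ρ x) (Ici 0) x)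
    (hpos : ∀ x ∈ halfOpen b, 0 < ρ x) : StrictMonoOn τ (halfOpen b) :=
  strictMonoOn_of_hasDerivWithinAt_pos (convex_halfOpen b)
    (fun x hx => (hd x hx).continuousWithinAt.mono (halfOpen_subset_Ici b))
    (fun x hx => (hd x (interior_subset hx)).mono (interior_subset.trans (halfOpen_subset_Ici b)))
    (fun x hx => hpos x (interior_subset hx))

lemma tendsto_coe_leftEnd (b : EReal) : Tendsto (fun x : ℝ => (x : EReal)) (leftEnd b) (𝓝 b) :=
  tendsto_comap.mono_right nhdsWithin_le_nhds

namespace IsTimeChange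

variable {b T : EReal} {τ ρ ξ : ℝ → ℝ}

lemma strictMonoOn (h : IsTimeChange b T τ ρ ξ) : StrictMonoOn τ (halfOpen b) :=
  strictMonoOn_halfOpen h.hasDeriv h.pos

/-- The change of variables as an order isomorphism. -/
def orderIso (h : IsTimeChange b T τ ρ ξ) : halfOpen b ≃o halfOpen T where
  toFun x := ⟨τ x, h.mapsTo x.2⟩
  invFun t := ⟨ξ t, h.mapsTo_inv t.2⟩
  left_inv x := Subtype.ext (h.left_inv x x.2)
  right_inv t := Subtype.ext (h.right_inv t t.2)
  map_rel_iff' {x y} := h.strictMonoOn.le_iff_le x.2 y.2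

lemma continuousOn_inv (h : IsTimeChange b T τ ρ ξ) : ContinuousOn ξ (halfOpen T) := by
  rw [continuousOn_iff_continuous_domRestrict]
  exact continuous_subtype_val.comp h.orderIso.symm.continuous

lemma image_eq (h : IsTimeChange b T τ ρ ξ) : τ '' halfOpen b = halfOpen T :=
  Subset.antisymm h.mapsTo.image_subset fun t ht => ⟨ξ t, h.mapsTo_inv ht, h.right_inv t ht⟩

lemma strictMonoOn_inv (h : IsTimeChange b T τ ρ ξ) : StrictMonoOn ξ (halfOpen T) :=
  fun s hs t ht hst => h.orderIso.symm.strictMono (show (⟨s, hs⟩ : halfOpen T) < ⟨t, ht⟩ from hst)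

lemma pos_end (h : IsTimeChange b T τ ρ ξ) (hb : 0 < b) : 0 < T := by
  have := (h.mapsTo (zero_mem_halfOpen hb)).2
  rwa [h.zero] at this

lemma inv_zero (h : IsTimeChange b T τ ρ ξ) (hb : 0 < b) : ξ 0 = 0 := by
  have := h.left_inv 0 (zero_mem_halfOpen hb)
  rwa [h.zero] at this

lemma hasDerivWithinAt_inv (h : IsTimeChange b T τ ρ ξ) {t : ℝ} (ht : t ∈ halfOpen T) :
    HasDerivWithinAt ξ (ρ (ξ t))⁻¹ (Ici 0) t := by
  have hξ := h.mapsTo_inv ht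
  have hev : ∀ᶠ s in 𝓝[Ici 0] t, s ∈ halfOpen T := halfOpen_mem_nhdsWithin ht
  have htend : Tendsto ξ (𝓝[Ici 0] t) (𝓝[Ici 0] (ξ t)) := by
    refine tendsto_nhdsWithin_iff.2 ⟨?_, hev.mono fun s hs => (h.mapsTo_inv hs).1⟩
    have := h.continuousOn_inv t ht
    rwa [ContinuousWithinAt, nhdsWithin_halfOpen ht] at this
  have hequiv : HasFDerivWithinAt τ (ContinuousLinearEquiv.unitsEquivAut ℝ
      (Units.mk0 (ρ (ξ t)) (h.pos _ hξ).ne') : ℝ →L[ℝ] ℝ) (Ici 0) (ξ t) := h.hasDeriv _ hξ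
  exact HasFDerivWithinAt.of_local_left_inverse htend hequiv ht.1
    (hev.mono fun s hs => h.right_inv s hs)

lemma symm (h : IsTimeChange b T τ ρ ξ) (hb : 0 < b) :
    IsTimeChange T b ξ (fun t => (ρ (ξ t))⁻¹) τ where
  mapsTo := h.mapsTo_inv
  mapsTo_inv := h.mapsTo
  left_inv := h.right_inv
  right_inv := h.left_inv
  hasDeriv _ ht := h.hasDerivWithinAt_inv ht
  cont := (h.cont.comp h.continuousOn_inv h.mapsTo_inv).inv₀ fun _ ht =>
    (h.pos _ (h.mapsTo_inv ht)).ne'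
  pos _ ht := inv_pos.2 (h.pos _ (h.mapsTo_inv ht))
  zero := h.inv_zero hb

lemma tendsto_leftEnd (h : IsTimeChange b T τ ρ ξ) (hb : 0 < b) :
    Tendsto τ (leftEnd b) (leftEnd T) := by
  intro s hs
  obtain ⟨t₀, ht₀, hs⟩ := (mem_leftEnd (h.pos_end hb)).1 hs
  refine (mem_leftEnd hb).2 ⟨ξ t₀, h.mapsTo_inv ht₀, fun x hx hlt => hs _ (h.mapsTo hx) ?_⟩
  have := h.strictMonoOn (h.mapsTo_inv ht₀) hx hlt
  rwa [h.right_inv t₀ ht₀] at this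

lemma tendsto_end (h : IsTimeChange b T τ ρ ξ) (hb : 0 < b) :
    Tendsto (fun x => (τ x : EReal)) (leftEnd b) (𝓝 T) :=
  (tendsto_coe_leftEnd T).comp (h.tendsto_leftEnd hb)

lemma comp_hasDerivWithinAt (h : IsTimeChange b T τ ρ ξ) {F : ℝ → ℝ} {F' x : ℝ}
    (hx : x ∈ halfOpen b) (hF : HasDerivWithinAt F F' (Ici 0) (τ x)) :
    HasDerivWithinAt (fun x => F (τ x)) (F' * ρ x) (Ici 0) x := by
  have hmaps : MapsTo τ (halfOpen b) (Ici 0) := fun y hy => (h.mapsTo hy).1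
  exact (hF.comp x ((h.hasDeriv x hx).mono (halfOpen_subset_Ici b)) hmaps).mono_of_mem_nhdsWithin
    (halfOpen_mem_nhdsWithin hx)

lemma congr_density (h : IsTimeChange b T τ ρ ξ) {ρ' : ℝ → ℝ} (he : EqOn ρ ρ' (halfOpen b)) :
    EqOn τ (fun x => ∫ s in (0 : ℝ)..x, ρ' s) (halfOpen b) ∧
      IsTimeChange b T (fun x => ∫ s in (0 : ℝ)..x, ρ' s) ρ' ξ := by
  have hAC : HasLocACDeriv b τ ρ' :=
    (HasLocACDeriv.of_hasDerivWithinAt_of_continuousOn h.hasDeriv h.cont).congr_deriv he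
  have hτ : EqOn τ (fun x => ∫ s in (0 : ℝ)..x, ρ' s) (halfOpen b) := fun x hx => by
    rw [hAC.2 x hx, h.zero, zero_add]
  have hc : ContinuousOn ρ' (halfOpen b) := h.cont.congr he.symm
  refine ⟨hτ, h.mapsTo.congr hτ, h.mapsTo_inv, fun x hx => ?_, fun t ht => ?_, fun x hx => ?_, hc,
    fun x hx => he hx ▸ h.pos x hx, by simp⟩
  · exact (congrArg ξ (hτ hx)).symm.trans (h.left_inv x hx)
  · exact (hτ (h.mapsTo_inv ht)).symm.trans (h.right_inv t ht)
  · exact HasLocACDeriv.hasDerivWithinAt ⟨hAC.1, by simp⟩ hc hx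

lemma image_Icc (h : IsTimeChange b T τ ρ ξ) {x : ℝ} (hx : x ∈ halfOpen b) :
    τ '' Icc 0 x = Icc 0 (τ x) := by
  have h0 : (0 : ℝ) ∈ halfOpen b := mem_halfOpen_of_le hx le_rfl hx.1
  refine Subset.antisymm ?_ fun t ht => ?_
  · rintro _ ⟨y, hy, rfl⟩
    have hyb := Icc_subset_halfOpen hx hy
    exact ⟨(h.mapsTo hyb).1, h.strictMonoOn.monotoneOn hyb hx hy.2⟩
  · have htT := Icc_subset_halfOpen (h.mapsTo hx) ht
    refine ⟨ξ t, ⟨(h.mapsTo_inv htT).1, ?_⟩, h.right_inv t htT⟩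
    have := h.strictMonoOn_inv.monotoneOn htT (h.mapsTo hx) ht.2
    rwa [h.left_inv x hx] at this

variable {E : Type*} [NormedAddCommGroup E] [NormedSpace ℝ E]

lemma integrableOn_iff (h : IsTimeChange b T τ ρ ξ) (g : ℝ → E) :
    IntegrableOn g (halfOpen T) ↔ IntegrableOn (fun x => ρ x • g (τ x)) (halfOpen b) := by
  rw [← h.image_eq, integrableOn_image_iff_integrableOn_deriv_smul_of_monotoneOn
    (measurableSet_halfOpen b) (fun x hx => (h.hasDeriv x hx).mono (halfOpen_subset_Ici b))
    h.strictMonoOn.monotoneOn]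

/-- Absolutely continuous functions may be composed with a change of variables. -/
lemma comp (h : IsTimeChange b T τ ρ ξ) {F F' : ℝ → E} (hF : HasLocACDeriv T F F') :
    HasLocACDeriv b (fun x => F (τ x)) (fun x => ρ x • F' (τ x)) := by
  have hd : ∀ x ∈ halfOpen b, ∀ y ∈ Icc 0 x, HasDerivWithinAt τ (ρ y) (Icc 0 x) y :=
    fun x hx y hy => (h.hasDeriv y (Icc_subset_halfOpen hx hy)).mono Icc_subset_Ici_self
  have hm : ∀ x ∈ halfOpen b, MonotoneOn τ (Icc 0 x) := fun x hx =>
    (h.strictMonoOn.monotoneOn).mono (Icc_subset_halfOpen hx)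
  refine ⟨fun x hx => ?_, fun x hx => ?_⟩
  · have := hF.1 _ (h.mapsTo hx)
    rw [intervalIntegrable_iff_integrableOn_Icc_of_le (h.mapsTo hx).1, ← h.image_Icc hx,
      integrableOn_image_iff_integrableOn_deriv_smul_of_monotoneOn measurableSet_Icc (hd x hx)
        (hm x hx)] at this
    exact (intervalIntegrable_iff_integrableOn_Icc_of_le hx.1).2 this
  · simp only [h.zero]
    rw [hF.2 _ (h.mapsTo hx), intervalIntegral.integral_of_le (h.mapsTo hx).1,
      intervalIntegral.integral_of_le hx.1, ← integral_Icc_eq_integral_Ioc,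
      ← integral_Icc_eq_integral_Ioc, ← h.image_Icc hx,
      integral_image_eq_integral_deriv_smul_of_monotoneOn measurableSet_Icc (hd x hx) (hm x hx)]

end IsTimeChange

/-- The primitive of a continuous positive density is a change of variables. -/
lemma exists_isTimeChange {b : EReal} (hb : 0 < b) {ρ : ℝ → ℝ} (hc : ContinuousOn ρ (halfOpen b))
    (hpos : ∀ x ∈ halfOpen b, 0 < ρ x) :
    ∃ T ξ, IsTimeChange b T (fun x => ∫ s in (0 : ℝ)..x, ρ s) ρ ξ := by
  set τ : ℝ → ℝ := fun x => ∫ s in (0 : ℝ)..x, ρ s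
  have hAC : HasLocACDeriv b τ ρ := ⟨fun x hx => hc.intervalIntegrable_halfOpen hx, by simp [τ]⟩
  have hd : ∀ x ∈ halfOpen b, HasDerivWithinAt τ (ρ x) (Ici 0) x := fun x hx =>
    hAC.hasDerivWithinAt hc hx
  have hmono := strictMonoOn_halfOpen hd hpos
  have h0 : τ 0 = 0 := by simp [τ]
  set T : EReal := ⨆ x ∈ halfOpen b, (τ x : EReal)
  have hmaps : MapsTo τ (halfOpen b) (halfOpen T) := fun x hx => by
    obtain ⟨x', hx', hlt⟩ := exists_gt_mem_halfOpen hx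
    refine ⟨?_, lt_of_lt_of_le (EReal.coe_lt_coe_iff.2 (hmono hx hx' hlt))
      (le_biSup (fun x => (τ x : EReal)) hx')⟩
    rw [← h0]
    exact hmono.monotoneOn (zero_mem_halfOpen hb) hx hx.1
  have hsurj : SurjOn τ (halfOpen b) (halfOpen T) := fun t ht => by
    obtain ⟨x, hx, hlt⟩ := lt_biSup_iff.1 ht.2
    have hlt : t < τ x := EReal.coe_lt_coe_iff.1 hlt
    obtain ⟨y, hy, rfl⟩ := intermediate_value_Icc hx.1
      (hAC.continuousOn.mono (Icc_subset_halfOpen hx)) ⟨by rw [h0]; exact ht.1, hlt.le⟩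
    exact ⟨y, Icc_subset_halfOpen hx hy, rfl⟩
  exact ⟨T, Function.invFunOn τ (halfOpen b),
    { mapsTo := hmaps
      mapsTo_inv := fun _ ht => Function.invFunOn_mem (hsurj ht)
      left_inv := fun _ hx => hmono.injOn.leftInvOn_invFunOn hx
      right_inv := fun t ht => Function.invFunOn_eq (hsurj ht)
      hasDeriv := hd
      cont := hc
      pos := hpos
      zero := h0 }⟩

end TimeChange

/-! ### The correspondence between the solutions -/

section Correspondence

lemma isSchrodingerSolution_iff {V : ℝ → ℝ} {b : EReal} (hV : LocallyIntegrableOn V (halfOpen b))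
    {z : ℂ} {y dy : ℝ → ℂ} : IsSchrodingerSolution V b z y dy ↔
      HasLocACDeriv b y dy ∧ HasLocACDeriv b dy (fun x => ((V x : ℂ) - z) * y x) := by
  constructor
  · intro h
    have hy : ContinuousOn y (halfOpen b) := fun x hx =>
      (h.hasDeriv x hx).continuousWithinAt.mono (halfOpen_subset_Ici b)
    have hd : HasLocACDeriv b dy (fun x => ((V x : ℂ) - z) * y x) := by
      refine ⟨fun x hx => ?_, h.deriv_eq⟩
      have h1 := locallyIntegrableOn_halfOpen_iff.1 hV x hx
      have h2 : IntervalIntegrable (fun s => (V s : ℂ)) volume 0 x := ⟨h1.1.ofReal, h1.2.ofReal⟩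
      exact (h2.sub intervalIntegrable_const).mul_continuousOn
        (hy.mono (by rw [uIcc_of_le hx.1]; exact Icc_subset_halfOpen hx))
    exact ⟨.of_hasDerivWithinAt_of_continuousOn h.hasDeriv hd.continuousOn, hd⟩
  · rintro ⟨h1, h2⟩
    exact ⟨fun x hx => h1.hasDerivWithinAt h2.continuousOn hx, h2.2⟩

/-- The solution basis `u, v` of `-y'' + V y = 0` on `[0, b)` that belongs to the boundary
condition `α` at `0` (its Wronskian is `1`), together with the new time `τ = ∫ (u² + v²)`, which maps `[0, b)` onto `[0, T)` and has the inverse `ξ`, and a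
phase `φ` with `u + i v = R exp (i φ(τ))`, `R > 0`. -/
structure IsPolarBasis (V : ℝ → ℝ) (b : EReal) (α : ℝ) (u du v dv : ℝ → ℝ)
    (T : EReal) (φ τ ξ : ℝ → ℝ) : Prop where
  b_pos : 0 < b
  locInt : LocallyIntegrableOn V (halfOpen b)
  deriv_u : HasLocACDeriv b u du
  deriv_du : HasLocACDeriv b du (fun x => V x * u x)
  deriv_v : HasLocACDeriv b v dv
  deriv_dv : HasLocACDeriv b dv (fun x => V x * v x)
  init_u : u 0 = Real.cos α
  init_du : du 0 = -Real.sin α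
  init_v : v 0 = Real.sin α
  init_dv : dv 0 = Real.cos α
  time : IsTimeChange b T τ (fun x => u x ^ 2 + v x ^ 2) ξ
  polar : ∀ x ∈ halfOpen b, ∃ R : ℝ, 0 < R ∧ u x = R * Real.cos (φ (τ x)) ∧
    v x = R * Real.sin (φ (τ x))
  measurable : AEMeasurable φ (volume.restrict (Ici 0))

/-- The first coordinate of `(y, y')` in the basis `(u, u'), (v, v')` of Wronskian `1`. -/
def coordFst (v dv : ℝ → ℝ) (y dy : ℝ → ℂ) (x : ℝ) : ℂ := dv x * y x - v x * dy x

/-- The second coordinate of `(y, y')` in the basis `(u, u'), (v, v')` of Wronskian `1`. -/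
def coordSnd (u du : ℝ → ℝ) (y dy : ℝ → ℂ) (x : ℝ) : ℂ := u x * dy x - du x * y x

lemma schrodinger_wronskian_eq {V u du v dv : ℝ → ℝ} {b : EReal} (hu : HasLocACDeriv b u du)
    (hdu : HasLocACDeriv b du (fun x => V x * u x)) (hv : HasLocACDeriv b v dv)
    (hdv : HasLocACDeriv b dv (fun x => V x * v x)) {x : ℝ} (hx : x ∈ halfOpen b) :
    u x * dv x - du x * v x = u 0 * dv 0 - du 0 * v 0 := by
  refine ((hu.mul hdv).sub (hdu.mul hv)).eq_of_deriv_eq_zero (fun s _ => ?_) hx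
  simp only [Pi.zero_apply]; ring

namespace IsPolarBasis

variable {V : ℝ → ℝ} {b T : EReal} {α : ℝ} {u du v dv φ τ ξ : ℝ → ℝ} {z : ℂ} {y dy p q : ℝ → ℂ}

lemma wronskian_eq_one (h : IsPolarBasis V b α u du v dv T φ τ ξ) {x : ℝ} (hx : x ∈ halfOpen b) :
    (u x : ℂ) * dv x - du x * v x = 1 := by
  have := schrodinger_wronskian_eq h.deriv_u h.deriv_du h.deriv_v h.deriv_dv hx
  rw [h.init_u, h.init_du, h.init_v, h.init_dv] at this
  have h1 : u x * dv x - du x * v x = 1 := by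
    rw [this]; linear_combination Real.cos_sq_add_sin_sq α
  exact_mod_cast h1

lemma pos_end (h : IsPolarBasis V b α u du v dv T φ τ ξ) : 0 < T := h.time.pos_end h.b_pos

lemma eq_coord (h : IsPolarBasis V b α u du v dv T φ τ ξ) {x : ℝ} (hx : x ∈ halfOpen b) :
    y x = coordFst v dv y dy x * u x + coordSnd u du y dy x * v x ∧
      dy x = coordFst v dv y dy x * du x + coordSnd u du y dy x * dv x := by
  have := h.wronskian_eq_one hx
  simp only [coordFst, coordSnd]
  constructor
  · linear_combination (-y x) * this
  · linear_combination (-dy x) * this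

lemma coord_eq (h : IsPolarBasis V b α u du v dv T φ τ ξ) {x : ℝ} (hx : x ∈ halfOpen b) {c d : ℂ}
    (hy : y x = c * u x + d * v x) (hdy : dy x = c * du x + d * dv x) :
    coordFst v dv y dy x = c ∧ coordSnd u du y dy x = d := by
  have := h.wronskian_eq_one hx
  simp only [coordFst, coordSnd, hy, hdy]
  constructor
  · linear_combination c * this
  · linear_combination d * this

/-- Variation of constants: in the new time, the coordinates of a solution of the Schrödinger
equation solve the canonical system. -/
lemma isPhaseSolution (h : IsPolarBasis V b α u du v dv T φ τ ξ)
    (hy : IsSchrodingerSolution V b z y dy) :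
    IsPhaseSolution φ T z (fun t => coordFst v dv y dy (ξ t))
      (fun t => coordSnd u du y dy (ξ t)) := by
  obtain ⟨h1, h2⟩ := (isSchrodingerSolution_iff h.locInt).1 hy
  have hc1 : HasLocACDeriv b (coordFst v dv y dy) (fun x => z * v x * y x) :=
    ((h.deriv_dv.ofReal.mul h1).sub (h.deriv_v.ofReal.mul h2)).congr_deriv fun x _ => by
      push_cast; ring
  have hc2 : HasLocACDeriv b (coordSnd u du y dy) (fun x => -z * u x * y x) :=
    ((h.deriv_u.ofReal.mul h2).sub (h.deriv_du.ofReal.mul h1)).congr_deriv fun x _ => by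
      push_cast; ring
  have hs := h.time.symm h.b_pos
  have key : ∀ t ∈ halfOpen T, ∃ R : ℝ, R ≠ 0 ∧ u (ξ t) = R * Real.cos (φ t) ∧
      v (ξ t) = R * Real.sin (φ t) ∧ u (ξ t) ^ 2 + v (ξ t) ^ 2 = R ^ 2 ∧
      y (ξ t) = R * phaseProj φ (fun t => coordFst v dv y dy (ξ t))
        (fun t => coordSnd u du y dy (ξ t)) t := by
    intro t ht
    have hx := h.time.mapsTo_inv ht
    obtain ⟨R, hR, hu, hv⟩ := h.polar _ hx
    rw [h.time.right_inv t ht] at hu hv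
    refine ⟨R, hR.ne', hu, hv, ?_, ?_⟩
    · rw [hu, hv]; linear_combination R ^ 2 * Real.cos_sq_add_sin_sq (φ t)
    · rw [(h.eq_coord (y := y) (dy := dy) hx).1, phaseProj, hu, hv]; push_cast; ring
  refine ⟨(hs.comp hc1).congr_deriv fun t ht => ?_, (hs.comp hc2).congr_deriv fun t ht => ?_⟩ <;>
  · obtain ⟨R, hR, hu, hv, hR2, hyR⟩ := key t ht
    have hR' : (R : ℂ) ≠ 0 := by exact_mod_cast hR
    simp only [hR2, Complex.real_smul]
    simp only [hyR, hu, hv]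
    push_cast
    field_simp

/-- Conversely, every solution of the canonical system gives a solution of the Schrödinger
equation. -/
lemma isSchrodingerSolution (h : IsPolarBasis V b α u du v dv T φ τ ξ)
    (hp : IsPhaseSolution φ T z p q) :
    IsSchrodingerSolution V b z (fun x => p (τ x) * u x + q (τ x) * v x)
      (fun x => p (τ x) * du x + q (τ x) * dv x) := by
  set y : ℝ → ℂ := fun x => p (τ x) * u x + q (τ x) * v x with hy
  have key : ∀ x ∈ halfOpen b, ∃ R : ℝ, u x = R * Real.cos (φ (τ x)) ∧
      v x = R * Real.sin (φ (τ x)) ∧ u x ^ 2 + v x ^ 2 = R ^ 2 ∧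
      y x = R * phaseProj φ p q (τ x) := by
    intro x hx
    obtain ⟨R, hR, hu, hv⟩ := h.polar _ hx
    refine ⟨R, hu, hv, ?_, ?_⟩
    · rw [hu, hv]; linear_combination R ^ 2 * Real.cos_sq_add_sin_sq (φ (τ x))
    · simp only [hy, phaseProj, hu, hv]; push_cast; ring
  have hc1 : HasLocACDeriv b (fun x => p (τ x)) (fun x => z * v x * y x) :=
    (h.time.comp hp.fst).congr_deriv fun x hx => by
      obtain ⟨R, hu, hv, hR2, hyR⟩ := key x hx
      simp only [hR2, Complex.real_smul]
      simp only [hyR, hv]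
      push_cast; ring
  have hc2 : HasLocACDeriv b (fun x => q (τ x)) (fun x => -z * u x * y x) :=
    (h.time.comp hp.snd).congr_deriv fun x hx => by
      obtain ⟨R, hu, hv, hR2, hyR⟩ := key x hx
      simp only [hR2, Complex.real_smul]
      simp only [hyR, hu]
      push_cast; ring
  refine (isSchrodingerSolution_iff h.locInt).2 ⟨?_, ?_⟩
  · refine ((hc1.mul h.deriv_u.ofReal).add (hc2.mul h.deriv_v.ofReal)).congr_deriv fun x _ => ?_
    ring
  · refine ((hc1.mul h.deriv_du.ofReal).add (hc2.mul h.deriv_dv.ofReal)).congr_deriv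
      fun x hx => ?_
    have := h.wronskian_eq_one hx
    push_cast
    simp only [hy] at *
    linear_combination (-z * (p (τ x) * u x + q (τ x) * v x)) * this

lemma isSchrodingerSolution_congr (h : IsPolarBasis V b α u du v dv T φ τ ξ) {Y dY : ℝ → ℂ}
    (hY : IsSchrodingerSolution V b z Y dY) (h1 : EqOn Y y (halfOpen b))
    (h2 : EqOn dY dy (halfOpen b)) : IsSchrodingerSolution V b z y dy := by
  obtain ⟨hy, hdy⟩ := (isSchrodingerSolution_iff h.locInt).1 hY
  exact (isSchrodingerSolution_iff h.locInt).2
    ⟨(hy.congr h.b_pos h1).congr_deriv h2,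
      (hdy.congr h.b_pos h2).congr_deriv fun x hx => by simp only [h1 hx]⟩

/-- A solution of the canonical system on the half line whose restriction to `[0, T)` corresponds
to the given solution of the Schrödinger equation. -/
lemma exists_phaseSolution_top (h : IsPolarBasis V b α u du v dv T φ τ ξ)
    (hy : IsSchrodingerSolution V b z y dy) :
    ∃ p q, IsPhaseSolution φ ⊤ z p q ∧ ∀ x ∈ halfOpen b,
      coordFst v dv y dy x = p (τ x) ∧ coordSnd u du y dy x = q (τ x) := by
  have hc := h.isPhaseSolution hy
  obtain ⟨p, q, hpq, hp0, hq0⟩ := exists_isPhaseSolution h.measurable (T := ⊤)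
    EReal.zero_lt_top z (coordFst v dv y dy (ξ 0)) (coordSnd u du y dy (ξ 0))
  obtain ⟨e1, e2⟩ := hc.eqOn h.measurable (hpq.mono le_top) hp0.symm hq0.symm
  refine ⟨p, q, hpq, fun x hx => ?_⟩
  have h1 := e1 (h.time.mapsTo hx)
  have h2 := e2 (h.time.mapsTo hx)
  simp only [h.time.left_inv x hx] at h1 h2
  exact ⟨h1, h2⟩

lemma squareIntegrable_iff (h : IsPolarBasis V b α u du v dv T φ τ ξ)
    (hy : ∀ x ∈ halfOpen b, y x = p (τ x) * u x + q (τ x) * v x) :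
    SquareIntegrable b y ↔ IntegrableOn (fun t => ‖phaseProj φ p q t‖ ^ 2) (halfOpen T) := by
  rw [h.time.integrableOn_iff, SquareIntegrable]
  refine integrableOn_congr_fun (fun x hx => ?_) (measurableSet_halfOpen b)
  obtain ⟨R, hR, hu, hv⟩ := h.polar x hx
  have hR2 : u x ^ 2 + v x ^ 2 = R ^ 2 := by
    rw [hu, hv]; linear_combination R ^ 2 * Real.cos_sq_add_sin_sq (φ (τ x))
  have hyR : y x = R * phaseProj φ p q (τ x) := by
    rw [hy x hx, phaseProj, hu, hv]; push_cast; ring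
  simp only [hR2, hyR, norm_mul, Complex.norm_real, mul_pow, smul_eq_mul, Real.norm_eq_abs, sq_abs]

lemma eq_of_coord (h : IsPolarBasis V b α u du v dv T φ τ ξ)
    (hc : ∀ x ∈ halfOpen b, coordFst v dv y dy x = p (τ x) ∧ coordSnd u du y dy x = q (τ x)) :
    ∀ x ∈ halfOpen b, y x = p (τ x) * u x + q (τ x) * v x := fun x hx => by
  rw [← (hc x hx).1, ← (hc x hx).2]
  exact (h.eq_coord hx).1

lemma isLimitCircle {T : ℝ} (h : IsPolarBasis V b α u du v dv T φ τ ξ) : IsLimitCircle V b := by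
  intro z y dy hy
  obtain ⟨p, q, hpq, hc⟩ := h.exists_phaseSolution_top hy
  rw [h.squareIntegrable_iff (h.eq_of_coord hc), halfOpen_coe]
  exact (hpq.integrableOn_sq_Icc h.measurable T).mono_set Ico_subset_Icc_self

lemma not_isLimitCircle (h : IsPolarBasis V b α u du v dv ⊤ φ τ ξ) : ¬ IsLimitCircle V b := by
  intro hLC
  -- for `z = 0` the solutions of the canonical system are constant
  have key : ∀ c d : ℂ, IntegrableOn (fun t => ‖phaseProj φ (fun _ => c) (fun _ => d) t‖ ^ 2)
      (halfOpen ⊤) := fun c d => by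
    have hcd : IsPhaseSolution φ ⊤ 0 (fun _ => c) (fun _ => d) :=
      ⟨(HasLocACDeriv.const c).congr_deriv fun _ _ => by simp,
        (HasLocACDeriv.const d).congr_deriv fun _ _ => by simp⟩
    exact (h.squareIntegrable_iff fun x _ => rfl).1 (hLC 0 _ _ (h.isSchrodingerSolution hcd))
  refine not_integrableOn_one_Ioi 0 (((key 1 0).add (key 0 1)).mono_set ?_ |>.congr_fun
    (fun t _ => ?_) measurableSet_Ioi)
  · rw [halfOpen_top]; exact Ioi_subset_Ici_self
  · simp only [phaseProj, mul_one, mul_zero, add_zero, zero_add, Pi.add_apply,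
      Complex.norm_real, Real.norm_eq_abs, sq_abs]
    exact Real.cos_sq_add_sin_sq (φ t)

/-- If the new time stays bounded, then the coordinates of every solution have limits at `b`. -/
lemma exists_tendsto_coord {T : ℝ} (h : IsPolarBasis V b α u du v dv T φ τ ξ)
    (hpq : IsPhaseSolution φ ⊤ z p q)
    (hc : ∀ x ∈ halfOpen b, coordFst v dv y dy x = p (τ x) ∧ coordSnd u du y dy x = q (τ x)) :
    Tendsto (coordFst v dv y dy) (leftEnd b) (𝓝 (p T)) ∧
      Tendsto (coordSnd u du y dy) (leftEnd b) (𝓝 (q T)) := by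
  have hT : (0 : ℝ) < T := by exact_mod_cast h.pos_end
  have hτ : Tendsto τ (leftEnd b) (𝓝[Ici 0] T) :=
    (h.time.tendsto_leftEnd h.b_pos).mono_right (leftEnd_coe_le hT)
  have hcp : ContinuousOn p (Ici 0) := halfOpen_top ▸ hpq.fst.continuousOn
  have hcq : ContinuousOn q (Ici 0) := halfOpen_top ▸ hpq.snd.continuousOn
  have hb := halfOpen_mem_leftEnd h.b_pos
  constructor
  · refine ((hcp T hT.le).tendsto.comp hτ).congr' ?_
    filter_upwards [hb] with x hx using (hc x hx).1.symm
  · refine ((hcq T hT.le).tendsto.comp hτ).congr' ?_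
    filter_upwards [hb] with x hx using (hc x hx).2.symm

end IsPolarBasis

lemma isTraceNormed_projMat {φ : ℝ → ℝ} (hφ : AEMeasurable φ (volume.restrict (Ici 0))) :
    IsTraceNormed (projMat φ) where
  posSemidef := ae_of_all _ fun t _ => by
    have := Matrix.posSemidef_vecMulVec_self_star ![Real.cos (φ t), Real.sin (φ t)]
    convert this using 1
    ext i j
    fin_cases i <;> fin_cases j <;> simp [projMat, Matrix.vecMulVec_apply, sq, mul_comm]
  locInt i j := by
    have hc : AEMeasurable (fun t => Real.cos (φ t)) (volume.restrict (Ici 0)) :=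
      Real.measurable_cos.comp_aemeasurable hφ
    have hs : AEMeasurable (fun t => Real.sin (φ t)) (volume.restrict (Ici 0)) :=
      Real.measurable_sin.comp_aemeasurable hφ
    have hm : AEStronglyMeasurable (fun t => projMat φ t i j) (volume.restrict (Ici 0)) := by
      refine AEMeasurable.aestronglyMeasurable ?_
      fin_cases i <;> fin_cases j <;> simp only [projMat]
      · exact hc.pow_const 2
      · exact hc.mul hs
      · exact hc.mul hs
      · exact hs.pow_const 2
    rw [← halfOpen_top, locallyIntegrableOn_halfOpen_iff]
    intro x hx
    rw [intervalIntegrable_iff_integrableOn_Icc_of_le hx.1]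
    refine IntegrableOn.of_bound (by simp) (hm.mono_set Icc_subset_Ici_self) 1
      (ae_of_all _ fun t => ?_)
    have h1 := Real.abs_cos_le_one (φ t)
    have h2 := Real.abs_sin_le_one (φ t)
    fin_cases i <;> fin_cases j <;> simp [projMat] <;>
      nlinarith [abs_nonneg (Real.cos (φ t)), abs_nonneg (Real.sin (φ t)),
        Real.sin_sq_add_cos_sq (φ t), sq_nonneg (Real.cos (φ t)), sq_nonneg (Real.sin (φ t))]
  trace_eq := ae_of_all _ fun t _ => by
    simp [projMat, Matrix.trace, Fin.sum_univ_two, Real.cos_sq_add_sin_sq]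

end Correspondence

/-! ### The regular endpoint -/

section RealSolutions

/-- The vector field of the first order system for `-y'' + W y = 0`. -/
def schrodingerField (W : ℝ → ℝ) (s : ℝ) (w : ℝ × ℝ) : ℝ × ℝ := (w.2, W s * w.1)

variable {W V : ℝ → ℝ} {b : EReal} {y dy Y dY : ℝ → ℝ}

lemma isCaratheodoryField_schrodingerField (hW : LocallyIntegrableOn W (halfOpen b)) :
    IsCaratheodoryField b (schrodingerField W) (fun s => 1 + |W s|) where
  locInt := (continuousOn_const.locallyIntegrableOn (measurableSet_halfOpen b)).add hW.norm
  comp w hw := by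
    refine locallyIntegrableOn_halfOpen_iff.2 fun x hx => ?_
    have h1 : IntervalIntegrable (fun s => (w s).2) volume 0 x :=
      (continuous_snd.comp_continuousOn hw).intervalIntegrable_halfOpen hx
    have h2 : IntervalIntegrable (fun s => W s * (w s).1) volume 0 x :=
      (locallyIntegrableOn_halfOpen_iff.1 hW x hx).mul_continuousOn
        ((continuous_fst.comp_continuousOn hw).mono
          (by rw [uIcc_of_le hx.1]; exact Icc_subset_halfOpen hx))
    exact ⟨h1.1.prodMk h2.1, h1.2.prodMk h2.2⟩
  lip s _ w w' := by
    have e : schrodingerField W s w - schrodingerField W s w' =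
        ((w - w').2, W s * (w - w').1) := by
      ext <;> simp [schrodingerField, mul_sub]
    rw [e, Prod.norm_def]
    have h1 := norm_fst_le (w - w')
    have h2 := norm_snd_le (w - w')
    refine max_le ?_ ?_
    · nlinarith [abs_nonneg (W s), norm_nonneg (w - w')]
    · simp only [norm_mul, Real.norm_eq_abs] at h1 ⊢
      nlinarith [abs_nonneg (W s), norm_nonneg (w - w')]

lemma exists_real_schrodinger_solution (hW : LocallyIntegrableOn W (halfOpen b)) (hb : 0 < b)
    (a c : ℝ) : ∃ y dy, HasLocACDeriv b y dy ∧ HasLocACDeriv b dy (fun x => W x * y x) ∧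
      y 0 = a ∧ dy 0 = c := by
  obtain ⟨w, hw0, hw⟩ := (isCaratheodoryField_schrodingerField hW).exists_solution hb (a, c)
  exact ⟨fun x => (w x).1, fun x => (w x).2, hw.clm_comp (ContinuousLinearMap.fst ℝ ℝ ℝ),
    hw.clm_comp (ContinuousLinearMap.snd ℝ ℝ ℝ), by simp [hw0], by simp [hw0]⟩

lemma eqOn_real_schrodinger_solution (hW : LocallyIntegrableOn W (halfOpen b))
    (h : HasLocACDeriv b y dy) (h' : HasLocACDeriv b dy (fun x => W x * y x))
    (H : HasLocACDeriv b Y dY) (H' : HasLocACDeriv b dY (fun x => W x * Y x))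
    (h0 : y 0 = Y 0) (h0' : dy 0 = dY 0) : EqOn y Y (halfOpen b) ∧ EqOn dy dY (halfOpen b) := by
  have := (isCaratheodoryField_schrodingerField hW).eqOn_of_hasLocACDeriv
    (u := fun x => (y x, dy x)) (v := fun x => (Y x, dY x)) (h.prodMk h') (H.prodMk H')
    (by simp [h0, h0'])
  exact ⟨fun x hx => congrArg Prod.fst (this hx), fun x hx => congrArg Prod.snd (this hx)⟩

/-- At a regular endpoint a solution and its derivative have limits: the solution extends beyond
`b` as a solution for the potential that is continued by zero. -/
lemma IsRegularEnd.exists_tendsto (hV : IsRegularEnd V b) (hb : 0 < b)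
    (h : HasLocACDeriv b y dy) (h' : HasLocACDeriv b dy (fun x => V x * y x)) :
    ∃ l l', Tendsto y (leftEnd b) (𝓝 l) ∧ Tendsto dy (leftEnd b) (𝓝 l') := by
  obtain ⟨hbt, hVi⟩ := hV
  lift b to ℝ using ⟨hbt, (bot_le.trans_lt hb).ne'⟩
  set W := (halfOpen b).indicator V
  have hW : LocallyIntegrableOn W (halfOpen ⊤) :=
    (hVi.integrable_indicator (measurableSet_halfOpen b)).locallyIntegrable.locallyIntegrableOn _
  obtain ⟨Y, dY, H, H', hY, hdY⟩ :=
    exists_real_schrodinger_solution hW EReal.zero_lt_top (y 0) (dy 0)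
  have hVW : EqOn W V (halfOpen b) := fun x hx => indicator_of_mem hx V
  obtain ⟨e, e'⟩ := eqOn_real_schrodinger_solution (locallyIntegrableOn_halfOpen_iff.2
    fun x hx => (intervalIntegrable_iff_integrableOn_Icc_of_le hx.1).2
      (hVi.mono_set (Icc_subset_halfOpen hx))) (H.mono le_top)
    ((H'.mono le_top).congr_deriv fun x hx => by simp only [hVW hx]) h h' hY hdY
  have hb' : (0 : ℝ) < b := by exact_mod_cast hb
  have hY : ContinuousOn Y (Ici 0) := halfOpen_top ▸ H.continuousOn
  have hdY : ContinuousOn dY (Ici 0) := halfOpen_top ▸ H'.continuousOn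
  have hmem := halfOpen_mem_leftEnd hb
  refine ⟨Y b, dY b, ?_, ?_⟩
  · refine ((hY b hb'.le).tendsto.mono_left (leftEnd_coe_le hb')).congr' ?_
    filter_upwards [hmem] with x hx using e hx
  · refine ((hdY b hb'.le).tendsto.mono_left (leftEnd_coe_le hb')).congr' ?_
    filter_upwards [hmem] with x hx using e' hx

end RealSolutions

/-! ### Boundary conditions at the right endpoint -/

section EndConditions

lemma exists_angle {x y : ℝ} (h : x ≠ 0 ∨ y ≠ 0) :
    ∃ β ∈ Ico 0 Real.pi, ∃ r, r ≠ 0 ∧ x = r * Real.cos β ∧ y = r * Real.sin β := by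
  set w : ℂ := ⟨x, y⟩
  have hw : w ≠ 0 := fun h0 => by
    have h1 := congrArg Complex.re h0
    have h2 := congrArg Complex.im h0
    simp only [w, Complex.zero_re, Complex.zero_im] at h1 h2
    tauto
  have hn : ‖w‖ ≠ 0 := norm_ne_zero_iff.2 hw
  have hx : x = ‖w‖ * Real.cos w.arg := (Complex.norm_mul_cos_arg w).symm
  have hy : y = ‖w‖ * Real.sin w.arg := (Complex.norm_mul_sin_arg w).symm
  have h1 := Complex.neg_pi_lt_arg w
  have h2 := Complex.arg_le_pi w
  have hpi := Real.pi_pos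
  rcases lt_or_ge w.arg 0 with hneg | hpos
  · refine ⟨w.arg + Real.pi, ⟨by linarith, by linarith⟩, -‖w‖, neg_ne_zero.2 hn, ?_, ?_⟩
    · rw [Real.cos_add_pi]; linarith
    · rw [Real.sin_add_pi]; linarith
  · rcases h2.lt_or_eq with hlt | heq
    · exact ⟨w.arg, ⟨hpos, hlt⟩, ‖w‖, hn, hx, hy⟩
    · rw [heq] at hx hy
      refine ⟨0, ⟨le_rfl, hpi⟩, -‖w‖, neg_ne_zero.2 hn, ?_, ?_⟩
      · rw [hx]; simp
      · rw [hy]; simp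

/-- A nonzero vector of `ℂ²` that is proportional to its conjugate is a multiple of a real one. -/
lemma exists_angle_of_star_mul_eq {L M : ℂ} (h : L ≠ 0 ∨ M ≠ 0)
    (hr : star L * M - star M * L = 0) :
    ∃ β ∈ Ico 0 Real.pi, ∃ k : ℂ, k ≠ 0 ∧ L = -k * Real.sin β ∧ M = k * Real.cos β := by
  by_cases hL : L = 0
  · exact ⟨0, ⟨le_rfl, Real.pi_pos⟩, M, h.resolve_left (not_not.2 hL), by simp [hL], by simp⟩
  have hL' : star L ≠ 0 := star_ne_zero.2 hL
  obtain ⟨ρ, hρ⟩ : ∃ ρ : ℝ, (ρ : ℂ) = M / L := by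
    refine (Complex.conj_eq_iff_real.1 ?_).imp fun _ h => h.symm
    rw [← RCLike.star_def, star_div₀, div_eq_div_iff hL' hL]
    linear_combination -hr
  rw [eq_div_iff hL] at hρ
  obtain ⟨β, hβ, r, hr, h1, h2⟩ := exists_angle (x := ρ) (y := -1) (Or.inr (by norm_num))
  refine ⟨β, hβ, r * L, mul_ne_zero (by exact_mod_cast hr) hL, ?_, ?_⟩
  · have : (-1 : ℂ) = r * Real.sin β := by exact_mod_cast h2
    linear_combination (-L) * this
  · rw [← hρ, h1]; push_cast; ring

lemma integrableOn_halfOpen_of_tendsto {b : EReal} (hb : 0 < b) (hbt : b ≠ ⊤) {f : ℝ → ℝ} {l : ℝ}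
    (hf : ContinuousOn f (halfOpen b)) (hl : Tendsto f (leftEnd b) (𝓝 l)) :
    IntegrableOn f (halfOpen b) := by
  lift b to ℝ using ⟨hbt, (bot_le.trans_lt hb).ne'⟩
  obtain ⟨x₀, hx₀, h⟩ := (mem_leftEnd hb).1
    (hl.norm.eventually (gt_mem_nhds (show ‖l‖ < ‖l‖ + 1 by linarith)))
  obtain ⟨C, hC⟩ := isCompact_Icc.exists_bound_of_continuousOn
    (hf.mono (Icc_subset_halfOpen hx₀))
  refine IntegrableOn.of_bound (by simp [halfOpen_coe])
    (hf.aestronglyMeasurable (measurableSet_halfOpen b)) (max C (‖l‖ + 1)) ?_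
  filter_upwards [ae_restrict_mem (measurableSet_halfOpen b)] with x hx
  rcases le_or_gt x x₀ with hle | hlt
  · exact (hC x ⟨hx.1, hle⟩).trans (le_max_left _ _)
  · exact (le_of_lt (h x hx hlt)).trans (le_max_right _ _)

/-- The boundary condition at `b`, expressed by the limits `L, M` of the coordinates of a solution
with respect to the basis `u, v`, says that `(L, M)` is orthogonal to `(cos β, sin β)`. -/
def EndCondition.Matches (V : ℝ → ℝ) (b : EReal) (u du v dv : ℝ → ℝ) (e : EndCondition)
    (β : ℝ) : Prop :=
  ∀ (z : ℂ) (y dy : ℝ → ℂ), IsSchrodingerSolution V b z y dy → ∀ L M : ℂ,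
    Tendsto (coordFst v dv y dy) (leftEnd b) (𝓝 L) →
    Tendsto (coordSnd u du y dy) (leftEnd b) (𝓝 M) →
    (e.Holds b y dy ↔ (Real.cos β : ℂ) * L + (Real.sin β : ℂ) * M = 0)

/-- A solution of the canonical system that vanishes at one point is trivial. -/
lemma IsPhaseSolution.ne_zero {φ : ℝ → ℝ} {z : ℂ} {p q : ℝ → ℂ}
    (hφ : AEMeasurable φ (volume.restrict (Ici 0)))
    (hpq : IsPhaseSolution φ ⊤ z p q) (hp : p 0 ≠ 0) {t : ℝ} (ht : 0 ≤ t) :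
    p t ≠ 0 ∨ q t ≠ 0 := by
  by_contra! hcon
  obtain ⟨P, Q, hPQ, hP, hQ⟩ := exists_isPhaseSolution hφ (T := ⊤) EReal.zero_lt_top z 0 1
  have := hpq.wronskian_eq hPQ (show t ∈ halfOpen ⊤ by rw [halfOpen_top]; exact ht)
  rw [hcon.1, hcon.2, hP, hQ] at this
  exact hp (by simpa using this.symm)

namespace IsPolarBasis

variable {V : ℝ → ℝ} {b T : EReal} {α : ℝ} {u du v dv φ τ ξ : ℝ → ℝ} {z : ℂ} {y dy p q : ℝ → ℂ}

/-- At a regular endpoint the condition `y(b) cos β + y'(b) sin β = 0` corresponds to the angle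
of the vector `(u(b) cos β + u'(b) sin β, v(b) cos β + v'(b) sin β)`. -/
lemma matches_regular (h : IsPolarBasis V b α u du v dv T φ τ ξ) {U dU W dW β β' r : ℝ}
    (hu : Tendsto u (leftEnd b) (𝓝 U)) (hdu : Tendsto du (leftEnd b) (𝓝 dU))
    (hv : Tendsto v (leftEnd b) (𝓝 W)) (hdv : Tendsto dv (leftEnd b) (𝓝 dW)) (hr : r ≠ 0)
    (h1 : U * Real.cos β + dU * Real.sin β = r * Real.cos β')
    (h2 : W * Real.cos β + dW * Real.sin β = r * Real.sin β') :
    (EndCondition.regular β).Matches V b u du v dv β' := by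
  intro z y dy _ L M hL hM
  have := leftEnd_neBot h.b_pos
  have hlim : Tendsto (fun x => y x * (Real.cos β : ℂ) + dy x * (Real.sin β : ℂ)) (leftEnd b)
      (𝓝 (r * (Real.cos β' * L + Real.sin β' * M))) := by
    have hof : ∀ {f : ℝ → ℝ} {l : ℝ}, Tendsto f (leftEnd b) (𝓝 l) →
        Tendsto (fun x => (f x : ℂ)) (leftEnd b) (𝓝 (l : ℂ)) := fun hf =>
      (Complex.continuous_ofReal.tendsto _).comp hf
    have h3 := (hL.mul (hof ((hu.mul_const (Real.cos β)).add (hdu.mul_const (Real.sin β))))).add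
      (hM.mul (hof ((hv.mul_const (Real.cos β)).add (hdv.mul_const (Real.sin β)))))
    rw [h1, h2] at h3
    convert! h3.congr' ?_ using 2
    · push_cast; ring
    · filter_upwards [halfOpen_mem_leftEnd h.b_pos] with x hx
      rw [(h.eq_coord (y := y) (dy := dy) hx).1, (h.eq_coord (y := y) (dy := dy) hx).2]
      push_cast; ring
  have hr' : (r : ℂ) ≠ 0 := by exact_mod_cast hr
  constructor
  · intro hH
    exact (mul_eq_zero.1 (tendsto_nhds_unique hlim hH)).resolve_left hr'
  · intro hH
    rw [hH, mul_zero] at hlim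
    exact hlim

lemma wronskian_star_eq (h : IsPolarBasis V b α u du v dv T φ τ ξ) (f df y dy : ℝ → ℂ) {x : ℝ}
    (hx : x ∈ halfOpen b) :
    wronskian (fun x => star (f x)) (fun x => star (df x)) y dy x =
      star (coordFst v dv f df x) * coordSnd u du y dy x -
        star (coordSnd u du f df x) * coordFst v dv y dy x := by
  have hW := h.wronskian_eq_one hx
  simp only [wronskian, coordFst, coordSnd, RCLike.star_def, map_sub, map_mul,
    Complex.conj_ofReal]
  linear_combination (-((starRingEnd ℂ) (f x) * dy x - (starRingEnd ℂ) (df x) * y x)) * hW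

lemma tendsto_wronskian_star (h : IsPolarBasis V b α u du v dv T φ τ ξ) {f df : ℝ → ℂ}
    {K N L M : ℂ}
    (hK : Tendsto (coordFst v dv f df) (leftEnd b) (𝓝 K))
    (hN : Tendsto (coordSnd u du f df) (leftEnd b) (𝓝 N))
    (hL : Tendsto (coordFst v dv y dy) (leftEnd b) (𝓝 L))
    (hM : Tendsto (coordSnd u du y dy) (leftEnd b) (𝓝 M)) :
    Tendsto (wronskian (fun x => star (f x)) (fun x => star (df x)) y dy) (leftEnd b)
      (𝓝 (star K * M - star N * L)) := by
  refine ((hK.star.mul hM).sub (hN.star.mul hL)).congr' ?_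
  filter_upwards [halfOpen_mem_leftEnd h.b_pos] with x hx
  exact (h.wronskian_star_eq f df y dy hx).symm

/-- In the limit circle case the reference solution determines a real direction in the limit. -/
lemma matches_limitCircle (h : IsPolarBasis V b α u du v dv T φ τ ξ) {z₀ : ℂ} {f df : ℝ → ℂ}
    {β : ℝ} {k : ℂ} (hk : k ≠ 0)
    (hK : Tendsto (coordFst v dv f df) (leftEnd b) (𝓝 (-k * Real.sin β)))
    (hN : Tendsto (coordSnd u du f df) (leftEnd b) (𝓝 (k * Real.cos β))) :
    (EndCondition.limitCircle z₀ f df).Matches V b u du v dv β := by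
  intro z y dy _ L M hL hM
  have := leftEnd_neBot h.b_pos
  have hlim := h.tendsto_wronskian_star hK hN hL hM
  have e : star (-k * Real.sin β) * M - star (k * Real.cos β) * L =
      -star k * (Real.cos β * L + Real.sin β * M) := by
    simp only [RCLike.star_def, map_mul, map_neg, Complex.conj_ofReal]; ring
  rw [e] at hlim
  constructor
  · intro hH
    exact (mul_eq_zero.1 (tendsto_nhds_unique hlim hH)).resolve_left
      (neg_ne_zero.2 (star_ne_zero.2 hk))
  · intro hH
    rw [hH, mul_zero] at hlim
    exact hlim

lemma limit_wronskian (h : IsPolarBasis V b α u du v dv T φ τ ξ) {U dU W dW : ℝ}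
    (hu : Tendsto u (leftEnd b) (𝓝 U)) (hdu : Tendsto du (leftEnd b) (𝓝 dU))
    (hv : Tendsto v (leftEnd b) (𝓝 W)) (hdv : Tendsto dv (leftEnd b) (𝓝 dW)) :
    U * dW - dU * W = 1 := by
  have := leftEnd_neBot h.b_pos
  refine tendsto_nhds_unique ((hu.mul hdv).sub (hdu.mul hv)) (tendsto_const_nhds.congr' ?_)
  filter_upwards [halfOpen_mem_leftEnd h.b_pos] with x hx
  have := h.wronskian_eq_one hx
  exact_mod_cast this.symm

/-- If the new time stays bounded, every admissible boundary condition at `b` is given by an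
angle. -/
lemma exists_matches {T : ℝ} (h : IsPolarBasis V b α u du v dv T φ τ ξ) {e : EndCondition}
    (he : e.Admissible V b α) : ∃ β ∈ Ico 0 Real.pi, e.Matches V b u du v dv β := by
  have hT : (0 : ℝ) < T := by exact_mod_cast h.pos_end
  rcases e with _ | β | ⟨z₀, f, df⟩
  · exact absurd h.isLimitCircle he
  · obtain ⟨hV, -⟩ := he
    obtain ⟨U, dU, hU, hdU⟩ := hV.exists_tendsto h.b_pos h.deriv_u h.deriv_du
    obtain ⟨W, dW, hW, hdW⟩ := hV.exists_tendsto h.b_pos h.deriv_v h.deriv_dv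
    have hwr := h.limit_wronskian hU hdU hW hdW
    obtain ⟨β', hβ', r, hr, h1, h2⟩ := exists_angle (x := U * Real.cos β + dU * Real.sin β)
      (y := W * Real.cos β + dW * Real.sin β) (by
        by_contra! hcon
        have hc : Real.cos β = 0 := by
          linear_combination dW * hcon.1 - dU * hcon.2 - Real.cos β * hwr
        have hs : Real.sin β = 0 := by
          linear_combination U * hcon.2 - W * hcon.1 - Real.sin β * hwr
        have := Real.cos_sq_add_sin_sq β
        rw [hc, hs] at this
        norm_num at this)
    exact ⟨β', hβ', h.matches_regular hU hdU hW hdW hr h1 h2⟩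
  · obtain ⟨-, -, -, hf, ⟨m₀, hf0, hdf0⟩, hlim⟩ := he
    obtain ⟨p, q, hpq, hc⟩ := h.exists_phaseSolution_top hf
    obtain ⟨hK, hN⟩ := h.exists_tendsto_coord hpq hc
    have hp0 : p 0 ≠ 0 := by
      have := (hc 0 (zero_mem_halfOpen h.b_pos)).1
      rw [h.time.zero, coordFst, hf0, hdf0, h.init_v, h.init_dv] at this
      rw [← this]
      have hcs : (Real.cos α : ℂ) ^ 2 + (Real.sin α : ℂ) ^ 2 = 1 := by
        exact_mod_cast Real.cos_sq_add_sin_sq α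
      intro h0
      exact one_ne_zero (α := ℂ) (by linear_combination h0 - hcs)
    have := leftEnd_neBot h.b_pos
    obtain ⟨β, hβ, k, hk, h1, h2⟩ := exists_angle_of_star_mul_eq
      (hpq.ne_zero h.measurable hp0 hT.le)
      (tendsto_nhds_unique (h.tendsto_wronskian_star hK hN hK hN) hlim)
    rw [h1] at hK
    rw [h2] at hN
    exact ⟨β, hβ, h.matches_limitCircle hk hK hN⟩

/-- If the new time is unbounded, the only admissible boundary condition is none at all. -/
lemma eq_limitPoint (h : IsPolarBasis V b α u du v dv ⊤ φ τ ξ) {e : EndCondition}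
    (he : e.Admissible V b α) : e = .limitPoint := by
  rcases e with _ | β | ⟨z₀, f, df⟩
  · rfl
  · exfalso
    obtain ⟨hV, -⟩ := he
    obtain ⟨U, dU, hU, -⟩ := hV.exists_tendsto h.b_pos h.deriv_u h.deriv_du
    obtain ⟨W, dW, hW, -⟩ := hV.exists_tendsto h.b_pos h.deriv_v h.deriv_dv
    -- `u² + v²` is integrable up to the finite endpoint `b`, so the new time is bounded
    have hint := integrableOn_halfOpen_of_tendsto h.b_pos hV.1 h.time.cont
      ((hU.pow 2).add (hW.pow 2))
    have := (h.time.integrableOn_iff (fun _ => (1 : ℝ))).2 (by simpa using hint)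
    rw [halfOpen_top] at this
    exact not_integrableOn_one_Ioi 0 (this.mono_set Ioi_subset_Ici_self)
  · exact absurd he.1 h.not_isLimitCircle

/-- If the new time stays bounded and `φ` is the constant `β` afterwards, then there is an
admissible boundary condition at `b` that is given by the angle `β`. -/
lemma exists_admissible {T : ℝ} (h : IsPolarBasis V b α u du v dv T φ τ ξ) {β : ℝ}
    (hβ : ∀ t, T < t → φ t = β)
    (hsin : ¬ ∀ᵐ t ∂volume.restrict (Ioi 0), Real.sin (φ t) = 0) :
    ∃ e : EndCondition, e.Admissible V b α ∧ e.Matches V b u du v dv β := by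
  have hT : (0 : ℝ) < T := by exact_mod_cast h.pos_end
  by_cases hV : IsRegularEnd V b
  · obtain ⟨U, dU, hU, hdU⟩ := hV.exists_tendsto h.b_pos h.deriv_u h.deriv_du
    obtain ⟨W, dW, hW, hdW⟩ := hV.exists_tendsto h.b_pos h.deriv_v h.deriv_dv
    have hwr := h.limit_wronskian hU hdU hW hdW
    have hcs := Real.cos_sq_add_sin_sq β
    obtain ⟨β', hβ', r, hr, h1, h2⟩ := exists_angle (x := dW * Real.cos β - dU * Real.sin β)
      (y := U * Real.sin β - W * Real.cos β) (by
        by_contra! hcon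
        have hc : Real.cos β = 0 := by
          linear_combination U * hcon.1 + dU * hcon.2 - Real.cos β * hwr
        have hs : Real.sin β = 0 := by
          linear_combination W * hcon.1 + dW * hcon.2 - Real.sin β * hwr
        rw [hc, hs] at hcs
        norm_num at hcs)
    refine ⟨.regular β', ⟨hV, hβ'⟩, h.matches_regular hU hdU hW hdW (inv_ne_zero hr) ?_ ?_⟩
    · rw [eq_inv_mul_iff_mul_eq₀ hr]
      linear_combination (-U) * h1 - dU * h2 + Real.cos β * hwr
    · rw [eq_inv_mul_iff_mul_eq₀ hr]
      linear_combination (-W) * h1 - dW * h2 + Real.sin β * hwr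
  · obtain ⟨p, q, hpq, hp0, hi⟩ := exists_squareIntegrable_isPhaseSolution_ne_zero h.measurable
      hsin (z := Complex.I) (by simp)
    have hT0 := (hpq.integrableOn_iff_of_const_after h.measurable hT.le hβ).1 hi
    have hpq' := hpq.const_mul (p 0)⁻¹
    have hsol := h.isSchrodingerSolution (hpq'.mono le_top)
    set f : ℝ → ℂ := fun x => (p 0)⁻¹ * p (τ x) * u x + (p 0)⁻¹ * q (τ x) * v x with hf
    set df : ℝ → ℂ := fun x => (p 0)⁻¹ * p (τ x) * du x + (p 0)⁻¹ * q (τ x) * dv x with hdf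
    obtain ⟨hK, hN⟩ := h.exists_tendsto_coord (y := f) (dy := df) hpq' fun x hx =>
      h.coord_eq hx rfl rfl
    have hne := hpq'.ne_zero h.measurable (by simp [hp0]) hT.le
    set L := (p 0)⁻¹ * p T
    set M := (p 0)⁻¹ * q T
    have hLM : (Real.cos β : ℂ) * L + (Real.sin β : ℂ) * M = 0 := by
      linear_combination (p 0)⁻¹ * hT0
    have hcs : (Real.cos β : ℂ) ^ 2 + (Real.sin β : ℂ) ^ 2 = 1 := by
      exact_mod_cast Real.cos_sq_add_sin_sq β
    -- `(L, M)` is orthogonal to `(cos β, sin β)`, so it is a multiple of `(-sin β, cos β)`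
    set k : ℂ := Real.cos β * M - Real.sin β * L with hk
    have hL : L = -k * Real.sin β := by
      rw [hk]; linear_combination (-L) * hcs + Real.cos β * hLM
    have hM : M = k * Real.cos β := by
      rw [hk]; linear_combination (-M) * hcs + Real.sin β * hLM
    have hk0 : k ≠ 0 := fun h0 => by
      rw [hL, hM, h0] at hne; simp at hne
    have hwr := h.tendsto_wronskian_star hK hN hK hN
    rw [hL] at hK
    rw [hM] at hN
    refine ⟨.limitCircle Complex.I f df, ⟨h.isLimitCircle, hV, by simp, hsol,
      ⟨(p 0)⁻¹ * q 0, ?_, ?_⟩, ?_⟩, h.matches_limitCircle hk0 hK hN⟩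
    · simp only [hf, h.time.zero, h.init_u, h.init_v, inv_mul_cancel₀ hp0, one_mul]
    · simp only [hdf, h.time.zero, h.init_du, h.init_dv, inv_mul_cancel₀ hp0, one_mul]
      push_cast; ring
    · convert hwr using 2
      rw [hL, hM]
      simp only [RCLike.star_def, map_mul, map_neg, Complex.conj_ofReal]; ring

end IsPolarBasis

end EndConditions

/-! ### Expressing a Schrödinger problem by a canonical system -/

section Expressed

namespace IsPolarBasis

variable {T : EReal} {u du v dv φ ξ : ℝ → ℝ}

lemma coordFst_zero {V : ℝ → ℝ} {b : EReal} {α : ℝ} {τ : ℝ → ℝ} {y dy : ℝ → ℂ}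
    (h : IsPolarBasis V b α u du v dv T φ τ ξ) :
    coordFst v dv y dy 0 = -dy 0 * (Real.sin α : ℂ) + y 0 * (Real.cos α : ℂ) := by
  rw [coordFst, h.init_v, h.init_dv]; ring

lemma coordSnd_zero {V : ℝ → ℝ} {b : EReal} {α : ℝ} {τ : ℝ → ℝ} {y dy : ℝ → ℂ}
    (h : IsPolarBasis V b α u du v dv T φ τ ξ) :
    coordSnd u du y dy 0 = dy 0 * (Real.cos α : ℂ) + y 0 * (Real.sin α : ℂ) := by
  rw [coordSnd, h.init_u, h.init_du]; push_cast; ring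

/-- If the conditions at the right endpoints agree, the correspondence of the solutions makes the
Weyl solutions of the Schrödinger problem correspond to the square-integrable solutions of the
canonical system, so that the `m` functions are equal. -/
lemma isMFunction {S : SchrodingerProblem} {τ : ℝ → ℝ}
    (h : IsPolarBasis S.V S.b S.α u du v dv T φ τ ξ)
    (hend : (T = ⊤ ∧ S.endCond = .limitPoint) ∨ ∃ T' β : ℝ, T = T' ∧ (∀ t, T' < t → φ t = β) ∧
      S.endCond.Matches S.V S.b u du v dv β) {m : ℂ → ℂ}
    (hm : IsCanonicalMFunction (projMat φ) m) : S.IsMFunction m := by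
  have hholds : ∀ {z : ℂ} {y dy p q : ℝ → ℂ}, IsSchrodingerSolution S.V S.b z y dy →
      IsPhaseSolution φ ⊤ z p q → (∀ x ∈ halfOpen S.b, coordFst v dv y dy x = p (τ x) ∧
        coordSnd u du y dy x = q (τ x)) →
      (S.endCond.Holds S.b y dy ↔ IntegrableOn (fun t => ‖phaseProj φ p q t‖ ^ 2) (Ioi 0)) := by
    intro z y dy p q hy hpq hc
    rcases hend with ⟨rfl, he⟩ | ⟨T', β, rfl, hβ, he⟩
    · rw [he, EndCondition.Holds, h.squareIntegrable_iff (h.eq_of_coord hc), halfOpen_top,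
        integrableOn_Ici_iff_integrableOn_Ioi]
    · have hT : (0 : ℝ) < T' := by exact_mod_cast h.pos_end
      obtain ⟨hL, hM⟩ := h.exists_tendsto_coord hpq hc
      rw [he z y dy hy _ _ hL hM, hpq.integrableOn_iff_of_const_after h.measurable hT.le hβ]
  have h0 := zero_mem_halfOpen h.b_pos
  intro z hz
  obtain ⟨⟨w, hw⟩, hall⟩ := hm z hz
  constructor
  · obtain ⟨hw, hw0, hwi⟩ := (isHIntegrableSolution_iff h.measurable).1 hw
    have hy := h.isSchrodingerSolution (hw.mono le_top)
    have hc : ∀ x ∈ halfOpen S.b, _ := fun x hx => h.coord_eq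
      (y := fun x => w (τ x) 0 * u x + w (τ x) 1 * v x)
      (dy := fun x => w (τ x) 0 * du x + w (τ x) 1 * dv x) hx rfl rfl
    refine ⟨_, _, hy, ?_, (hholds hy hw hc).2 hwi⟩
    by_contra! hcon
    obtain ⟨e1, e2⟩ := hc 0 h0
    rw [h.time.zero, h.coordFst_zero, hcon.1, hcon.2] at e1
    rw [h.time.zero, h.coordSnd_zero, hcon.1, hcon.2] at e2
    refine hw0 (funext fun i => ?_)
    fin_cases i
    · simpa using e1.symm
    · simpa using e2.symm
  · rintro y dy ⟨hy, hy0, hyH⟩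
    obtain ⟨p, q, hpq, hc⟩ := h.exists_phaseSolution_top hy
    obtain ⟨e1, e2⟩ := hc 0 h0
    rw [h.time.zero, h.coordFst_zero] at e1
    rw [h.time.zero, h.coordSnd_zero] at e2
    rw [e1, e2]
    refine hall (fun t => ![p t, q t]) ((isHIntegrableSolution_iff h.measurable).2
      ⟨hpq, fun hw0 => ?_, (hholds hy hpq hc).1 hyH⟩)
    have hp0 : p 0 = 0 := congrFun hw0 0
    have hq0 : q 0 = 0 := congrFun hw0 1
    have hcs : (Real.cos S.α : ℂ) ^ 2 + (Real.sin S.α : ℂ) ^ 2 = 1 := by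
      exact_mod_cast Real.cos_sq_add_sin_sq S.α
    have hy1 : y 0 = 0 := by
      linear_combination (Real.cos S.α : ℂ) * (e1 + hp0) + (Real.sin S.α : ℂ) * (e2 + hq0) -
        y 0 * hcs
    have hy2 : dy 0 = 0 := by
      linear_combination (-Real.sin S.α : ℂ) * (e1 + hp0) + (Real.cos S.α : ℂ) * (e2 + hq0) -
        dy 0 * hcs
    exact hy0.elim (fun h => h hy1) (fun h => h hy2)

theorem isExpressedBy {S : SchrodingerProblem}
    (h : IsPolarBasis S.V S.b S.α u du v dv T φ (newTime u v) ξ)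
    (hsin : ¬ ∀ᵐ t ∂volume.restrict (Ioi 0), Real.sin (φ t) = 0)
    (hend : (T = ⊤ ∧ S.endCond = .limitPoint) ∨ ∃ T' β : ℝ, T = T' ∧ (∀ t, T' < t → φ t = β) ∧
      S.endCond.Matches S.V S.b u du v dv β) : S.IsExpressedBy T φ := by
  refine ⟨isTraceNormed_projMat h.measurable, ⟨u, du, v, dv, ?_, h.time.tendsto_end h.b_pos,
    h.polar, fun z y dy => ⟨fun hy => ?_, ?_⟩⟩, ?_⟩
  · refine ⟨?_, ?_, h.init_u, h.init_du, h.init_v, h.init_dv⟩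
    · exact (isSchrodingerSolution_iff h.locInt).2 ⟨h.deriv_u.ofReal,
        h.deriv_du.ofReal.congr_deriv fun x _ => by push_cast; ring⟩
    · exact (isSchrodingerSolution_iff h.locInt).2 ⟨h.deriv_v.ofReal,
        h.deriv_dv.ofReal.congr_deriv fun x _ => by push_cast; ring⟩
  · refine ⟨fun t => ![coordFst v dv y dy (ξ t), coordSnd u du y dy (ξ t)],
      (isCanonicalSolution_iff h.measurable).2 (h.isPhaseSolution hy), fun x hx => ?_⟩
    simp only [h.time.left_inv x hx]
    exact h.eq_coord hx
  · rintro ⟨w, hw, hyw⟩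
    refine h.isSchrodingerSolution_congr
      (h.isSchrodingerSolution ((isCanonicalSolution_iff h.measurable).1 hw)) ?_ ?_
    · exact fun x hx => (hyw x hx).1.symm
    · exact fun x hx => (hyw x hx).2.symm
  · obtain ⟨m, hm⟩ := exists_isCanonicalMFunction h.measurable hsin
    exact ⟨m, h.isMFunction hend hm, hm⟩

end IsPolarBasis

namespace IsSchrodingerPhase

variable {α : ℝ} {T : EReal} {φ φ₁ φ₂ φ₃ : ℝ → ℝ}

lemma aemeasurable (h : IsSchrodingerPhase α T φ φ₁ φ₂ φ₃) :
    AEMeasurable φ (volume.restrict (Ici 0)) := by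
  have hc : ContinuousOn φ (halfOpen T) := fun t ht =>
    (h.hasDeriv₁ t ht).continuousWithinAt.mono (halfOpen_subset_Ici T)
  have h1 : AEMeasurable φ (volume.restrict (halfOpen T)) :=
    hc.aemeasurable (measurableSet_halfOpen T)
  rcases eq_or_ne T ⊤ with rfl | hT
  · rwa [halfOpen_top] at h1
  obtain ⟨β, -, hβ⟩ := h.const_after hT
  lift T to ℝ using ⟨hT, (bot_le.trans_lt h.tb_pos).ne'⟩
  have h2 : AEMeasurable φ (volume.restrict (Ioi T)) :=
    (aemeasurable_const (b := β)).congr <| by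
      filter_upwards [ae_restrict_mem measurableSet_Ioi] with t ht
      exact (hβ t (by exact_mod_cast ht)).symm
  have h3 : AEMeasurable φ (volume.restrict {T}) := by simp
  refine (aemeasurable_union_iff.2 ⟨aemeasurable_union_iff.2 ⟨h1, h3⟩, h2⟩).mono_set ?_
  intro t ht
  rcases lt_trichotomy t T with hlt | rfl | hgt
  · exact Or.inl (Or.inl ⟨ht, by exact_mod_cast hlt⟩)
  · exact Or.inl (Or.inr rfl)
  · exact Or.inr hgt

lemma not_ae_sin_eq_zero (h : IsSchrodingerPhase α T φ φ₁ φ₂ φ₃) :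
    ¬ ∀ᵐ t ∂volume.restrict (Ioi 0), Real.sin (φ t) = 0 := by
  intro hae
  obtain ⟨t₁, ht₁, hpos⟩ := exists_gt_mem_halfOpen (zero_mem_halfOpen h.tb_pos)
  have hsub : Ioo 0 t₁ ⊆ halfOpen T := Ioo_subset_Icc_self.trans (Icc_subset_halfOpen ht₁)
  have hc : ContinuousOn (fun t => Real.sin (φ t)) (Ioo 0 t₁) := fun t ht =>
    (Real.continuous_sin.continuousAt.comp
      ((h.hasDeriv₁ t (hsub ht)).hasDerivAt (Ici_mem_nhds ht.1)).continuousAt).continuousWithinAt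
  have hzero : EqOn (fun t => Real.sin (φ t)) (fun _ => 0) (Ioo 0 t₁) :=
    Measure.eqOn_open_of_ae_eq
      (ae_restrict_of_ae_restrict_of_subset (fun t ht => ht.1) hae) isOpen_Ioo hc continuousOn_const
  have ht : t₁ / 2 ∈ Ioo 0 t₁ := ⟨by linarith, by linarith⟩
  have hd := ((h.hasDeriv₁ _ (hsub ht)).hasDerivAt (Ici_mem_nhds ht.1)).sin
  have hd0 : HasDerivAt (fun t => Real.sin (φ t)) 0 (t₁ / 2) :=
    (hasDerivAt_const _ (0 : ℝ)).congr_of_eventuallyEq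
      (hzero.eventuallyEq_of_mem (isOpen_Ioo.mem_nhds ht))
  have hcos := (mul_eq_zero.1 (hd.unique hd0)).resolve_right (h.deriv_pos _ (hsub ht)).ne'
  have hsin : Real.sin (φ (t₁ / 2)) = 0 := hzero ht
  have := Real.sin_sq_add_cos_sq (φ (t₁ / 2))
  rw [hcos, hsin] at this
  norm_num at this

end IsSchrodingerPhase

end Expressed

/-! ### The phase of a Schrödinger problem -/

section PhaseOfProblem

variable {V u du v dv θ : ℝ → ℝ} {b : EReal} {α : ℝ}

/-- Prüfer's polar coordinates: for solutions `u, v` with Wronskian `1` the vector `(u, v)` is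
`√(u² + v²) (cos θ, sin θ)` when `θ' = 1 / (u² + v²)`. -/
lemma polar_of_deriv_angle (hu : ∀ x ∈ halfOpen b, HasDerivWithinAt u (du x) (Ici 0) x)
    (hv : ∀ x ∈ halfOpen b, HasDerivWithinAt v (dv x) (Ici 0) x)
    (hW : ∀ x ∈ halfOpen b, u x * dv x - du x * v x = 1)
    (hpos : ∀ x ∈ halfOpen b, 0 < u x ^ 2 + v x ^ 2)
    (hθ : ∀ x ∈ halfOpen b, HasDerivWithinAt θ (u x ^ 2 + v x ^ 2)⁻¹ (Ici 0) x)
    (hθ0 : θ 0 = α) (hu0 : u 0 = Real.cos α) (hv0 : v 0 = Real.sin α) :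
    ∀ x ∈ halfOpen b, u x = √(u x ^ 2 + v x ^ 2) * Real.cos (θ x) ∧
      v x = √(u x ^ 2 + v x ^ 2) * Real.sin (θ x) := by
  set r : ℝ → ℝ := fun x => √(u x ^ 2 + v x ^ 2)
  have hr : ∀ x ∈ halfOpen b, 0 < r x := fun x hx => Real.sqrt_pos.2 (hpos x hx)
  have hr2 : ∀ x ∈ halfOpen b, r x ^ 2 = u x ^ 2 + v x ^ 2 := fun x hx =>
    Real.sq_sqrt (hpos x hx).le
  have hrd : ∀ x ∈ halfOpen b,
      HasDerivWithinAt r ((u x * du x + v x * dv x) / r x) (Ici 0) x := fun x hx => by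
    have := (((hu x hx).pow 2).add ((hv x hx).pow 2)).sqrt (hpos x hx).ne'
    convert! this using 1
    have := (hr x hx).ne'
    simp only [Pi.add_apply, Pi.pow_apply]
    change _ = _ / (2 * r x)
    field_simp
    push_cast; ring
  -- both components of `(u + i v) exp (-i θ) / r` have derivative `0`
  have h1 : ∀ x ∈ halfOpen b, HasDerivWithinAt
      (fun x => (u x * Real.cos (θ x) + v x * Real.sin (θ x)) / r x) 0 (Ici 0) x := fun x hx => by
    have := (((hu x hx).mul (hθ x hx).cos).add ((hv x hx).mul (hθ x hx).sin)).div (hrd x hx)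
      (hr x hx).ne'
    convert! this using 1
    have hrx := (hr x hx).ne'
    simp only [Pi.add_apply, Pi.mul_apply]
    rw [← hr2 x hx, eq_comm, div_eq_zero_iff]
    left
    field_simp
    rw [hr2 x hx]
    linear_combination (v x * Real.cos (θ x) - u x * Real.sin (θ x)) * (-(hW x hx))
  have h2 : ∀ x ∈ halfOpen b, HasDerivWithinAt
      (fun x => (v x * Real.cos (θ x) - u x * Real.sin (θ x)) / r x) 0 (Ici 0) x := fun x hx => by
    have := (((hv x hx).mul (hθ x hx).cos).sub ((hu x hx).mul (hθ x hx).sin)).div (hrd x hx)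
      (hr x hx).ne'
    convert! this using 1
    have hrx := (hr x hx).ne'
    simp only [Pi.sub_apply, Pi.mul_apply]
    rw [← hr2 x hx, eq_comm, div_eq_zero_iff]
    left
    field_simp
    rw [hr2 x hx]
    linear_combination (u x * Real.cos (θ x) + v x * Real.sin (θ x)) * (hW x hx)
  have hr0 : r 0 = 1 := by
    simp only [r, hu0, hv0, Real.cos_sq_add_sin_sq, Real.sqrt_one]
  intro x hx
  have e1 := (HasLocACDeriv.of_hasDerivWithinAt_of_continuousOn h1
    continuousOn_const).eq_of_deriv_eq_zero (fun _ _ => rfl) hx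
  have e2 := (HasLocACDeriv.of_hasDerivWithinAt_of_continuousOn h2
    continuousOn_const).eq_of_deriv_eq_zero (fun _ _ => rfl) hx
  have hcs := Real.cos_sq_add_sin_sq α
  have hcs' := Real.cos_sq_add_sin_sq (θ x)
  rw [div_eq_iff (hr x hx).ne', hr0, hθ0, hu0, hv0, div_one] at e1 e2
  constructor
  · linear_combination Real.cos (θ x) * e1 - Real.sin (θ x) * e2 - u x * hcs' +
      r x * Real.cos (θ x) * hcs
  · linear_combination Real.sin (θ x) * e1 + Real.cos (θ x) * e2 - v x * hcs' +
      r x * Real.sin (θ x) * hcs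

open Classical in
/-- Every Schrödinger equation has a polar basis; its phase may be continued by any constant. -/
lemma exists_isPolarBasis (hb : 0 < b) (hV : LocallyIntegrableOn V (halfOpen b)) (α : ℝ) :
    ∃ u du v dv T ξ, 0 < T ∧ ∀ β ∈ Ico 0 Real.pi, ∃ φ φ₁ φ₂ φ₃,
      IsSchrodingerPhase α T φ φ₁ φ₂ φ₃ ∧ (∀ t : ℝ, T < t → φ t = β) ∧
      IsPolarBasis V b α u du v dv T φ (newTime u v) ξ := by
  obtain ⟨u, du, hu, hdu, hu0, hdu0⟩ :=
    exists_real_schrodinger_solution hV hb (Real.cos α) (-Real.sin α)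
  obtain ⟨v, dv, hv, hdv, hv0, hdv0⟩ :=
    exists_real_schrodinger_solution hV hb (Real.sin α) (Real.cos α)
  have hW : ∀ x ∈ halfOpen b, u x * dv x - du x * v x = 1 := fun x hx => by
    rw [schrodinger_wronskian_eq hu hdu hv hdv hx, hu0, hdu0, hv0, hdv0]
    linear_combination Real.cos_sq_add_sin_sq α
  set ρ : ℝ → ℝ := fun x => u x ^ 2 + v x ^ 2 with hρ
  have hρpos : ∀ x ∈ halfOpen b, 0 < ρ x := fun x hx => by
    have : u x ≠ 0 ∨ v x ≠ 0 := by
      by_contra! hcon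
      have := hW x hx
      rw [hcon.1, hcon.2] at this
      norm_num at this
    rcases this with h | h
    · exact add_pos_of_pos_of_nonneg (by positivity) (sq_nonneg _)
    · exact add_pos_of_nonneg_of_pos (sq_nonneg _) (by positivity)
  have hu' : ∀ x ∈ halfOpen b, HasDerivWithinAt u (du x) (Ici 0) x := fun x hx =>
    hu.hasDerivWithinAt hdu.continuousOn hx
  have hv' : ∀ x ∈ halfOpen b, HasDerivWithinAt v (dv x) (Ici 0) x := fun x hx =>
    hv.hasDerivWithinAt hdv.continuousOn hx
  have hρc : ContinuousOn ρ (halfOpen b) := (hu.continuousOn.pow 2).add (hv.continuousOn.pow 2)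
  obtain ⟨T, ξ, htime⟩ := exists_isTimeChange hb hρc hρpos
  have hsymm := htime.symm hb
  have hT := htime.pos_end hb
  have hξ0 := htime.inv_zero hb
  -- `w = 1 / (u² + v²)` and the angle `θ` with `θ' = w`
  set w : ℝ → ℝ := fun x => (ρ x)⁻¹ with hw
  have hwc : ContinuousOn w (halfOpen b) := hρc.inv₀ fun x hx => (hρpos x hx).ne'
  set m : ℝ → ℝ := fun x => u x * du x + v x * dv x with hm
  have hmAC := (hu.mul hdu).add (hv.mul hdv)
  have hw' : ∀ x ∈ halfOpen b, HasDerivWithinAt w (-2 * m x * w x ^ 2) (Ici 0) x := fun x hx => by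
    have := (((hu' x hx).pow 2).add ((hv' x hx).pow 2)).inv (hρpos x hx).ne'
    convert! this using 1
    have := (hρpos x hx).ne'
    simp only [Pi.add_apply, Pi.pow_apply, hw, hm]
    change _ = _ / ρ x ^ 2
    field_simp
    push_cast; ring
  have hwAC : HasLocACDeriv b w (fun x => -2 * m x * w x ^ 2) :=
    .of_hasDerivWithinAt_of_continuousOn hw'
      ((continuousOn_const.mul hmAC.continuousOn).mul (hwc.pow 2))
  set θ : ℝ → ℝ := fun x => α + ∫ s in (0 : ℝ)..x, w s with hθ
  have hθAC : HasLocACDeriv b θ w :=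
    ⟨fun x hx => hwc.intervalIntegrable_halfOpen hx, by simp [hθ]⟩
  have hθ' : ∀ x ∈ halfOpen b, HasDerivWithinAt θ (w x) (Ici 0) x := fun x hx =>
    hθAC.hasDerivWithinAt hwc hx
  have hθ0 : θ 0 = α := by simp [hθ]
  have hpolar := polar_of_deriv_angle hu' hv' hW hρpos hθ' hθ0 hu0 hv0
  have hρ0 : ρ 0 = 1 := by simp only [hρ, hu0, hv0, Real.cos_sq_add_sin_sq]
  refine ⟨u, du, v, dv, T, ξ, hT, fun β hβ => ?_⟩
  set φ : ℝ → ℝ := (halfOpen T).piecewise (fun t => θ (ξ t)) (fun _ => β)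
  have hφ : EqOn φ (fun t => θ (ξ t)) (halfOpen T) := piecewise_eqOn _ _ _
  have hφT : ∀ t : ℝ, T < t → φ t = β := fun t ht =>
    piecewise_eq_of_notMem _ _ _ fun h => (h.2.trans ht).false
  -- in the new time, `φ' = w²`, `φ'' = -4 (u u' + v v') w⁴`
  have hd1 : ∀ t ∈ halfOpen T, HasDerivWithinAt φ (w (ξ t) ^ 2) (Ici 0) t := fun t ht => by
    have h1 := hsymm.comp_hasDerivWithinAt ht (hθ' _ (htime.mapsTo_inv ht))
    rw [sq]
    refine h1.congr_of_eventuallyEq ?_ (hφ ht)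
    exact hφ.eventuallyEq_of_mem (halfOpen_mem_nhdsWithin ht)
  have hd2 : ∀ t ∈ halfOpen T, HasDerivWithinAt (fun t => w (ξ t) ^ 2)
      (-4 * (m (ξ t) * w (ξ t) ^ 4)) (Ici 0) t := fun t ht => by
    have h1 := hsymm.comp_hasDerivWithinAt ht ((hw' _ (htime.mapsTo_inv ht)).pow 2)
    convert! h1 using 1
    simp only [hw]; push_cast; ring
  have hd3 := hsymm.comp ((hmAC.mul (hwAC.pow 3)).const_mul (-4))
  have hpos1 : ∀ t ∈ halfOpen T, 0 < w (ξ t) ^ 2 := fun t ht =>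
    pow_pos (inv_pos.2 (hρpos _ (htime.mapsTo_inv ht))) 2
  have hphase : IsSchrodingerPhase α T φ (fun t => w (ξ t) ^ 2)
      (fun t => -4 * (m (ξ t) * w (ξ t) ^ 4)) _ :=
    { tb_pos := hT
      hasDeriv₁ := hd1
      hasDeriv₂ := hd2
      locInt₃ := hd3.locallyIntegrableOn
      deriv₃ := hd3.2
      strictMono := strictMonoOn_halfOpen hd1 hpos1
      deriv_pos := hpos1
      init := by rw [hφ (zero_mem_halfOpen hT)]; simp only [hξ0, hθ0]
      init₁ := by simp [hξ0, hw, hρ0]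
      init₂ := by simp only [hξ0, hm, hu0, hv0, hdu0, hdv0]; ring
      const_after := fun _ => ⟨β, hβ, hφT⟩ }
  refine ⟨φ, _, _, _, hphase, hφT, ⟨hb, hV, hu, hdu, hv, hdv, hu0, hdu0, hv0, hdv0, htime,
    fun x hx => ⟨√(ρ x), Real.sqrt_pos.2 (hρpos x hx), ?_⟩, hphase.aemeasurable⟩⟩
  have : φ (newTime u v x) = θ x := by
    rw [show newTime u v x = ∫ s in (0 : ℝ)..x, ρ s from rfl, hφ (htime.mapsTo hx)]
    exact congrArg θ (htime.left_inv x hx)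
  rw [this]
  exact hpolar x hx

theorem SchrodingerProblem.exists_isExpressedBy (S : SchrodingerProblem) :
    ∃ (tb : EReal) (φ φ₁ φ₂ φ₃ : ℝ → ℝ), IsSchrodingerPhase S.α tb φ φ₁ φ₂ φ₃ ∧
      S.IsExpressedBy tb φ := by
  obtain ⟨u, du, v, dv, T, ξ, hT, h⟩ := exists_isPolarBasis S.b_pos S.locInt S.α
  obtain ⟨φ, φ₁, φ₂, φ₃, hphase, -, hbasis⟩ := h 0 ⟨le_rfl, Real.pi_pos⟩
  rcases eq_or_ne T ⊤ with rfl | hTt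
  · exact ⟨⊤, φ, φ₁, φ₂, φ₃, hphase, hbasis.isExpressedBy hphase.not_ae_sin_eq_zero
      (Or.inl ⟨rfl, hbasis.eq_limitPoint S.admissible⟩)⟩
  · lift T to ℝ using ⟨hTt, (bot_le.trans_lt hT).ne'⟩
    -- the boundary condition at `b` determines the constant by which the phase is continued
    obtain ⟨β, hβ, hmatch⟩ := hbasis.exists_matches S.admissible
    obtain ⟨φ, φ₁, φ₂, φ₃, hphase, hφ, hbasis⟩ := h β hβ
    exact ⟨T, φ, φ₁, φ₂, φ₃, hphase, hbasis.isExpressedBy hphase.not_ae_sin_eq_zero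
      (Or.inr ⟨T, β, rfl, fun t ht => hφ t (by exact_mod_cast ht), hmatch⟩)⟩

end PhaseOfProblem

/-! ### The Schrödinger problem of a phase -/

section ProblemOfPhase

/-- The potential in terms of the new time. -/
noncomputable def phasePotential (φ₁ φ₂ φ₃ : ℝ → ℝ) (t : ℝ) : ℝ :=
  7 / 16 * (φ₂ t ^ 2 / φ₁ t ^ 3) - 1 / 4 * (φ₃ t / φ₁ t ^ 2) - φ₁ t

namespace IsSchrodingerPhase

variable {α : ℝ} {T b : EReal} {φ φ₁ φ₂ φ₃ X η : ℝ → ℝ}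

lemma continuousOn₁ (h : IsSchrodingerPhase α T φ φ₁ φ₂ φ₃) : ContinuousOn φ₁ (halfOpen T) :=
  fun t ht => (h.hasDeriv₂ t ht).continuousWithinAt.mono (halfOpen_subset_Ici T)

lemma hasLocACDeriv₂ (h : IsSchrodingerPhase α T φ φ₁ φ₂ φ₃) : HasLocACDeriv T φ₂ φ₃ :=
  ⟨locallyIntegrableOn_halfOpen_iff.1 h.locInt₃, h.deriv₃⟩

/-- With `κ = φ'^(1/4)`, the functions `y = C / κ` and `y' = -φ'' C / (4 κ⁷) - κ S` satisfy
`dy/dt = κ² y'` and `dy'/dt = κ² V y`, where `(C, S)` is `(cos φ, sin φ)` or a rotation of it.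
As `dx/dt = κ²`, this is the Schrödinger equation in the new time. -/
lemma hasLocACDeriv_amplitude (h : IsSchrodingerPhase α T φ φ₁ φ₂ φ₃) {C S κ : ℝ → ℝ}
    (hκ : ∀ t, κ t = √√(φ₁ t))
    (hC : ∀ t ∈ halfOpen T, HasDerivWithinAt C (-S t * φ₁ t) (Ici 0) t)
    (hS : ∀ t ∈ halfOpen T, HasDerivWithinAt S (C t * φ₁ t) (Ici 0) t) :
    HasLocACDeriv T (fun t => (κ t)⁻¹ * C t)
      (fun t => κ t ^ 2 * (-(1 / 4) * ((κ t)⁻¹ ^ 7 * (φ₂ t * C t)) - κ t * S t)) ∧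
    HasLocACDeriv T (fun t => -(1 / 4) * ((κ t)⁻¹ ^ 7 * (φ₂ t * C t)) - κ t * S t)
      (fun t => κ t ^ 2 * (phasePotential φ₁ φ₂ φ₃ t * ((κ t)⁻¹ * C t))) := by
  have hpos : ∀ t ∈ halfOpen T, 0 < κ t := fun t ht => by
    rw [hκ]; exact Real.sqrt_pos.2 (Real.sqrt_pos.2 (h.deriv_pos t ht))
  have hκ2 : ∀ t, κ t ^ 2 = √(φ₁ t) := fun t => by
    rw [hκ, Real.sq_sqrt (Real.sqrt_nonneg _)]
  have hκ4 : ∀ t ∈ halfOpen T, φ₁ t = κ t ^ 4 := fun t ht => by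
    rw [show κ t ^ 4 = (κ t ^ 2) ^ 2 by ring, hκ2, Real.sq_sqrt (h.deriv_pos t ht).le]
  have hκd : ∀ t ∈ halfOpen T, HasDerivWithinAt κ (φ₂ t / (4 * κ t ^ 3)) (Ici 0) t :=
    fun t ht => by
    have hp := h.deriv_pos t ht
    have := ((h.hasDeriv₂ t ht).sqrt hp.ne').sqrt (Real.sqrt_pos.2 hp).ne'
    rw [show κ = fun t => √√(φ₁ t) from funext hκ]
    convert! this using 1
    have h0 := (hpos t ht).ne'
    rw [← hκ, ← hκ2]
    field_simp
    norm_num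
    exact Or.inl (by rw [hκ])
  have hκc : ContinuousOn κ (halfOpen T) := fun t ht =>
    (hκd t ht).continuousWithinAt.mono (halfOpen_subset_Ici T)
  have hCc : ContinuousOn C (halfOpen T) := fun t ht =>
    (hC t ht).continuousWithinAt.mono (halfOpen_subset_Ici T)
  have hSc : ContinuousOn S (halfOpen T) := fun t ht =>
    (hS t ht).continuousWithinAt.mono (halfOpen_subset_Ici T)
  have h2 := h.hasLocACDeriv₂
  have hκ3 : ∀ t ∈ halfOpen T, 4 * κ t ^ 3 ≠ 0 := fun t ht =>
    mul_ne_zero (by norm_num) (pow_pos (hpos t ht) 3).ne'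
  have hκAC : HasLocACDeriv T κ (fun t => φ₂ t / (4 * κ t ^ 3)) :=
    .of_hasDerivWithinAt_of_continuousOn hκd (h2.continuousOn.div
      (continuousOn_const.mul (hκc.pow 3)) hκ3)
  have hiAC : HasLocACDeriv T (fun t => (κ t)⁻¹) (fun t => -(φ₂ t / (4 * κ t ^ 3)) / κ t ^ 2) :=
    .of_hasDerivWithinAt_of_continuousOn (fun t ht => (hκd t ht).inv (hpos t ht).ne')
      ((h2.continuousOn.div (continuousOn_const.mul (hκc.pow 3)) hκ3).neg.div (hκc.pow 2) fun t ht => (pow_pos (hpos t ht) 2).ne')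
  have hCAC : HasLocACDeriv T C (fun t => -S t * φ₁ t) :=
    .of_hasDerivWithinAt_of_continuousOn hC (hSc.neg.mul h.continuousOn₁)
  have hSAC : HasLocACDeriv T S (fun t => C t * φ₁ t) :=
    .of_hasDerivWithinAt_of_continuousOn hS (hCc.mul h.continuousOn₁)
  constructor
  · refine (hiAC.mul hCAC).congr_deriv fun t ht => ?_
    have h0 := (hpos t ht).ne'
    simp only [hκ4 t ht]
    field_simp
    ring
  · refine ((((hiAC.pow 6).mul (h2.mul hCAC)).const_mul (-(1 / 4))).sub
      (hκAC.mul hSAC)).congr_deriv fun t ht => ?_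
    have h0 := (hpos t ht).ne'
    simp only [phasePotential, hκ4 t ht, inv_pow]
    field_simp
    push_cast
    ring

lemma locallyIntegrableOn_phasePotential (h : IsSchrodingerPhase α T φ φ₁ φ₂ φ₃) :
    LocallyIntegrableOn (fun t => √(φ₁ t) * phasePotential φ₁ φ₂ φ₃ t) (halfOpen T) := by
  refine locallyIntegrableOn_halfOpen_iff.2 fun x hx => ?_
  have hs : uIcc 0 x ⊆ halfOpen T := by rw [uIcc_of_le hx.1]; exact Icc_subset_halfOpen hx
  have hc1 := h.continuousOn₁
  have hc2 := h.hasLocACDeriv₂.continuousOn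
  have hne : ∀ n : ℕ, ∀ t ∈ halfOpen T, φ₁ t ^ n ≠ 0 := fun n t ht =>
    pow_ne_zero n (h.deriv_pos t ht).ne'
  have e : (fun t => √(φ₁ t) * phasePotential φ₁ φ₂ φ₃ t) = fun t =>
      √(φ₁ t) * (7 / 16 * (φ₂ t ^ 2 / φ₁ t ^ 3) - φ₁ t) -
        (√(φ₁ t) * (1 / 4) / φ₁ t ^ 2) * φ₃ t := by
    ext t; simp only [phasePotential]; ring
  rw [e]
  refine IntervalIntegrable.sub ?_ ?_
  · exact (hc1.sqrt.mul ((continuousOn_const.mul ((hc2.pow 2).div (hc1.pow 3) (hne 3))).sub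
      hc1)).intervalIntegrable_halfOpen hx
  · exact (h.hasLocACDeriv₂.1 x hx).continuousOn_mul
      (((hc1.sqrt.mul continuousOn_const).div (hc1.pow 2) (hne 2)).mono hs)

/-- The polar basis of the Schrödinger equation that belongs to the phase `φ`; here `X` is the
change of variables `x(t) = ∫ √φ'` and `η` its inverse. -/
lemma exists_isPolarBasis (h : IsSchrodingerPhase α T φ φ₁ φ₂ φ₃)
    (hX : IsTimeChange T b X (fun t => √(φ₁ t)) η) :
    ∃ u du v dv, IsPolarBasis (fun x => phasePotential φ₁ φ₂ φ₃ (η x)) b α u du v dv T φ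
      (newTime u v) X := by
  have hη := hX.symm h.tb_pos
  have hb := hX.pos_end h.tb_pos
  have hη0 : η 0 = 0 := hη.zero
  set κ : ℝ → ℝ := fun t => √√(φ₁ t) with hκ
  have hκ2 : ∀ t, κ t ^ 2 = √(φ₁ t) := fun t => by
    rw [hκ, Real.sq_sqrt (Real.sqrt_nonneg _)]
  have hpos : ∀ t ∈ halfOpen T, 0 < κ t := fun t ht =>
    Real.sqrt_pos.2 (Real.sqrt_pos.2 (h.deriv_pos t ht))
  have hκ0 : κ 0 = 1 := by simp [hκ, h.init₁]
  have key : ∀ C S : ℝ → ℝ,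
      (∀ t ∈ halfOpen T, HasDerivWithinAt C (-S t * φ₁ t) (Ici 0) t) →
      (∀ t ∈ halfOpen T, HasDerivWithinAt S (C t * φ₁ t) (Ici 0) t) →
      ∃ dy : ℝ → ℝ, HasLocACDeriv b (fun x => (κ (η x))⁻¹ * C (η x)) dy ∧
        HasLocACDeriv b dy (fun x => phasePotential φ₁ φ₂ φ₃ (η x) *
          ((κ (η x))⁻¹ * C (η x))) ∧ dy 0 = -S 0 := by
    intro C S hC hS
    obtain ⟨h1, h2⟩ := h.hasLocACDeriv_amplitude (κ := κ) (fun _ => rfl) hC hS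
    have hcancel : ∀ x ∈ halfOpen b, ∀ a : ℝ, (√(φ₁ (η x)))⁻¹ • (κ (η x) ^ 2 * a) = a :=
      fun x hx a => by
      have := pow_pos (hpos _ (hη.mapsTo hx)) 2
      rw [← hκ2, smul_eq_mul, inv_mul_cancel_left₀ this.ne']
    refine ⟨_, (hη.comp h1).congr_deriv fun x hx => hcancel x hx _,
      (hη.comp h2).congr_deriv fun x hx => hcancel x hx _, ?_⟩
    simp only [hη0, hκ0, h.init₂]; ring
  obtain ⟨du, hu, hdu, hdu0⟩ := key (fun t => Real.cos (φ t)) (fun t => Real.sin (φ t))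
    (fun t ht => (h.hasDeriv₁ t ht).cos) (fun t ht => (h.hasDeriv₁ t ht).sin)
  obtain ⟨dv, hv, hdv, hdv0⟩ := key (fun t => Real.sin (φ t)) (fun t => -Real.cos (φ t))
    (fun t ht => by simpa using (h.hasDeriv₁ t ht).sin)
    (fun t ht => by simpa using (h.hasDeriv₁ t ht).cos.fun_neg)
  set u : ℝ → ℝ := fun x => (κ (η x))⁻¹ * Real.cos (φ (η x)) with hu_def
  set v : ℝ → ℝ := fun x => (κ (η x))⁻¹ * Real.sin (φ (η x)) with hv_def
  have hρ : EqOn (fun x => (√(φ₁ (η x)))⁻¹) (fun x => u x ^ 2 + v x ^ 2) (halfOpen b) :=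
    fun x _ => by
    simp only [hu_def, hv_def, ← hκ2, mul_pow, ← mul_add, Real.cos_sq_add_sin_sq, inv_pow, mul_one]
  obtain ⟨hτ, htime⟩ := hη.congr_density hρ
  have hV : LocallyIntegrableOn (fun x => phasePotential φ₁ φ₂ φ₃ (η x)) (halfOpen b) := by
    have h1 : HasLocACDeriv T
        (fun t => ∫ s in (0 : ℝ)..t, √(φ₁ s) * phasePotential φ₁ φ₂ φ₃ s) _ :=
      ⟨locallyIntegrableOn_halfOpen_iff.1 h.locallyIntegrableOn_phasePotential, by simp⟩
    refine ((hη.comp h1).congr_deriv fun x hx => ?_).locallyIntegrableOn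
    have := Real.sqrt_pos.2 (h.deriv_pos _ (hη.mapsTo hx))
    simp only [smul_eq_mul, inv_mul_cancel_left₀ this.ne']
  refine ⟨u, du, v, dv, hb, hV, hu, hdu, hv, hdv, ?_, ?_, ?_, ?_, htime, fun x hx =>
    ⟨(κ (η x))⁻¹, inv_pos.2 (hpos _ (hη.mapsTo hx)), ?_⟩, h.aemeasurable⟩
  · simp [hu_def, hη0, hκ0, h.init]
  · rw [hdu0, h.init]
  · simp [hv_def, hη0, hκ0, h.init]
  · rw [hdv0, h.init, neg_neg]
  · rw [← show η x = newTime u v x from hτ hx]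
    exact ⟨rfl, rfl⟩

theorem exists_schrodingerProblem (h : IsSchrodingerPhase α T φ φ₁ φ₂ φ₃)
    (hα : α ∈ Ico 0 Real.pi) : ∃ S : SchrodingerProblem, S.α = α ∧ S.IsExpressedBy T φ ∧
      Tendsto (fun t => ((∫ s in (0 : ℝ)..t, √(φ₁ s) : ℝ) : EReal)) (leftEnd T) (𝓝 S.b) ∧
      ∀ t ∈ halfOpen T, S.V (∫ s in (0 : ℝ)..t, √(φ₁ s)) = phasePotential φ₁ φ₂ φ₃ t := by
  obtain ⟨b, η, hX⟩ := exists_isTimeChange h.tb_pos h.continuousOn₁.sqrt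
    fun t ht => Real.sqrt_pos.2 (h.deriv_pos t ht)
  obtain ⟨u, du, v, dv, hbasis⟩ := h.exists_isPolarBasis hX
  have hsin := h.not_ae_sin_eq_zero
  have hVt : ∀ t ∈ halfOpen T, phasePotential φ₁ φ₂ φ₃ (η (∫ s in (0 : ℝ)..t, √(φ₁ s))) =
      phasePotential φ₁ φ₂ φ₃ t := fun t ht => by
    rw [hX.left_inv t ht]
  rcases eq_or_ne T ⊤ with rfl | hT
  · exact ⟨⟨b, hbasis.b_pos, _, hbasis.locInt, α, hα, .limitPoint, hbasis.not_isLimitCircle⟩, rfl,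
      hbasis.isExpressedBy hsin (Or.inl ⟨rfl, rfl⟩), hX.tendsto_end h.tb_pos, hVt⟩
  · obtain ⟨β, -, hβ⟩ := h.const_after hT
    have hT' := hX.tendsto_end h.tb_pos
    lift T to ℝ using ⟨hT, (bot_le.trans_lt h.tb_pos).ne'⟩
    have hβ' : ∀ t, T < t → φ t = β := fun t ht => hβ t (by exact_mod_cast ht)
    obtain ⟨e, he, hmatch⟩ := hbasis.exists_admissible hβ' hsin
    exact ⟨⟨b, hbasis.b_pos, _, hbasis.locInt, α, hα, e, he⟩, rfl,
      hbasis.isExpressedBy hsin (Or.inr ⟨T, β, rfl, hβ', hmatch⟩), hT', hVt⟩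

end IsSchrodingerPhase

end ProblemOfPhase

theorem proposition1 :
    -- every Schrödinger problem comes from a canonical system of the special form
    (∀ S : SchrodingerProblem, ∃ (tb : EReal) (φ φ₁ φ₂ φ₃ : ℝ → ℝ),
      IsSchrodingerPhase S.α tb φ φ₁ φ₂ φ₃ ∧ S.IsExpressedBy tb φ) ∧
    -- conversely, every canonical system of the special form comes from a Schrödinger problem,
    -- with `x(t) = ∫₀ᵗ √φ'`, `b = lim_{t ↑ t_b} x(t)` and an explicit potential
    (∀ (α : ℝ) (tb : EReal) (φ φ₁ φ₂ φ₃ : ℝ → ℝ), α ∈ Set.Ico 0 Real.pi →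
      IsSchrodingerPhase α tb φ φ₁ φ₂ φ₃ →
      ∃ S : SchrodingerProblem, S.α = α ∧ S.IsExpressedBy tb φ ∧
        Filter.Tendsto (fun t => ((∫ s in (0 : ℝ)..t, √(φ₁ s) : ℝ) : EReal))
          (leftEnd tb) (nhds S.b) ∧
        ∀ t ∈ halfOpen tb, S.V (∫ s in (0 : ℝ)..t, √(φ₁ s)) =
          7 / 16 * (φ₂ t ^ 2 / φ₁ t ^ 3) - 1 / 4 * (φ₃ t / φ₁ t ^ 2) - φ₁ t) := by
  exact ⟨fun S => S.exists_isExpressedBy,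
    fun _ _ _ _ _ _ hα h => h.exists_schrodingerProblem hα⟩
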